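/- **Theorem 6.1.** Let $q>0$ be real, let $\alpha$ be a real number that is not a negative integer, let $\beta$ be a complex number that is real or purely imaginary, and let $(a_n)_{n\ge1}$ be complex numbers such that $$F(s)=\sum_{n=1}^\infty \frac{a_n}{n^s}$$ converges absolutely for $\Re s>1$. Put $$\Phi(s)=\left(\frac{\sqrt q}{\pi}\right)^{s}\,\Gamma\!\left(\frac{\alpha+\beta+\frac12+s}{2}\right)\Gamma\!\left(\frac{\alpha-\beta+\frac12+s}{2}\right)F(s)\qquad(\Re s>1),$$ and, for $x,y>0$, $$f(x,y)=y^{1/2}\sum_{n=1}^\infty a_n\,H_\alpha\!\left(\frac{2\pi n x}{\sqrt q}\right)K_\beta\!\left(\frac{2\pi n y}{\sqrt q}\right),\qquad H_\alpha(x)=x^{1/2}J_\alpha(x),$$ where $J_\alpha$ is the Bessel function of the first kind and $K_\beta$ the modified Bessel function of the second kind; write $f(re^{i\theta})=f(r\cos\theta,r\sin\theta)$. Then the following two statements are equivalent. 1. $\Phi$ extends to an entire function of finite order on $\mathbb C$ (that is, $\Phi(s)=O(\exp(|s|^{\rho}))$ on $\mathbb C$ for some $\rho>0$), and this extension satisfies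 $\Phi(s)=\overline{\Phi(1-\overline{s})}$ for all $s\in\mathbb C$. 2. $f(re^{i\theta})=\overline{f(r^{-1}e^{i\theta})}$ for all $r>0$ and all $0<\theta<\pi/2$. -/

import Mathlib

open scoped ComplexConjugate

noncomputable section

namespace SelbergDegreeTwo

/-- The Bessel function of the first kind `J_α(x)` of real order `α`, for `x > 0`, by its
ascending series `∑ (-1)^m / (m! Γ(m + α + 1)) (x/2)^(2m + α)`. Mathlib's `Real.Gamma` is `0` at
the poles of `Γ`, so that `(Real.Gamma t)⁻¹` is `1/Γ(t)` for every real `t`. -/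
def besselJ (α x : ℝ) : ℝ :=
  ∑' m : ℕ, (-1) ^ m * ((m.factorial : ℝ)⁻¹ * (Real.Gamma (m + α + 1))⁻¹) *
    (x / 2) ^ (2 * (m : ℝ) + α)

/-- The modified Bessel function of the second kind `K_β(x)` of complex order `β`, for `x > 0`, by
its integral representation `∫₀^∞ exp(-x cosh t) cosh(β t) dt`. -/
def besselK (β : ℂ) (x : ℝ) : ℂ :=
  ∫ t in Set.Ioi (0 : ℝ), (Real.exp (-(x * Real.cosh t)) : ℂ) * Complex.cosh (β * t)

/-- `H_α(x) = x^{1/2} J_α(x)`. -/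
def besselH (α x : ℝ) : ℝ := x ^ (1 / 2 : ℝ) * besselJ α x

/-- The Bessel series
`f(x, y) = y^{1/2} ∑_{n ≥ 1} a_n H_α(2π n x / √q) K_β(2π n y / √q)`, for `x, y > 0`. -/
def besselSeries (q α : ℝ) (β : ℂ) (a : ℕ → ℂ) (x y : ℝ) : ℂ :=
  ((y ^ (1 / 2 : ℝ) : ℝ) : ℂ) *
    ∑' n : ℕ+, a n * (besselH α (2 * Real.pi * (n : ℕ) * x / √q) : ℂ) *
      besselK β (2 * Real.pi * (n : ℕ) * y / √q)

/-- The function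
`(√q/π)^s Γ((α + β + 1/2 + s)/2) Γ((α - β + 1/2 + s)/2) F(s)`, `F(s) = ∑_{n ≥ 1} a_n n^{-s}`.
It has its intended value for `Re s > 1` away from the poles of the two gamma factors. -/
def completedSeries (q α : ℝ) (β : ℂ) (a : ℕ → ℂ) (s : ℂ) : ℂ :=
  ((√q / Real.pi : ℝ) : ℂ) ^ s * Complex.Gamma ((α + β + 1 / 2 + s) / 2) *
    Complex.Gamma ((α - β + 1 / 2 + s) / 2) * LSeries a s

/-- `Φ` is an entire function that continues `completedSeries`: the two agree at all points of the
half-plane `Re s > 1` that are not poles of one of the gamma factors. -/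
def IsEntireContinuation (q α : ℝ) (β : ℂ) (a : ℕ → ℂ) (Φ : ℂ → ℂ) : Prop :=
  Differentiable ℂ Φ ∧
    ∀ s : ℂ, 1 < s.re →
      (∀ m : ℕ, (α + β + 1 / 2 + s) / 2 ≠ -(m : ℂ)) →
      (∀ m : ℕ, (α - β + 1 / 2 + s) / 2 ≠ -(m : ℂ)) →
      Φ s = completedSeries q α β a s

/-- Finite order (of growth) of an entire function: `Φ(s) = O(exp(|s|^ρ))` for some real `ρ`. -/
def HasFiniteOrder (Φ : ℂ → ℂ) : Prop :=
  ∃ ρ C : ℝ, 0 < ρ ∧ ∀ s : ℂ, ‖Φ s‖ ≤ C * Real.exp (‖s‖ ^ ρ)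

end SelbergDegreeTwo

end

noncomputable section

namespace SelbergDegreeTwo

open Filter Topology Set MeasureTheory Asymptotics

/-! ### Reciprocal gamma values and rising factorials -/

/-! Fix a ray through the point `(c, b)` of the open quarter circle and take the Mellin transform of
the Bessel series in the radius `r`. Writing `J_α` as a power of its argument times the entire
series `cliff` and `K_β` as an integral over `u`, then integrating termwise, gives for large `Re s`
the identity of `mellin_besselSeries`: the transform at `s - 1/2` is a positive constant times
`rayFactor` times `completedSeries`. Here `rayFactor` is `b^β` times a regularized Gauss series in
`c²` whose two upper parameters are exchanged by `s ↦ 1 - s`. It is entire in `s`, and it is also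
even in `β` because `K_β` is. For `β` real or imaginary it therefore has the same conjugate symmetry
as the functional equation (`conj_rayFactor_one_sub`), so on each ray the functional equation for
the completed series matches the symmetry `r ↦ 1/r` of the Bessel series.

From the functional equation to the inversion (`raySymm_of_continuation`): on a line far to the
right the Mellin transform decays quadratically, by integration by parts on the kernel; on the
mirrored line it decays by symmetry. Finite order permits Phragmén–Lindelöf in between
(`exists_strip_decay`), so the contour of Mellin inversion can be moved across, and the symmetry on
the new contour yields the inversion formula.

From the inversion to the functional equation (`exists_continuation_of_raySymm`): the series decays
exponentially at infinity, hence rapidly at zero, so its Mellin transform is entire and symmetric.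
The continuation is obtained on dividing by `rayFactor`. A fixed ray does not suffice, since
`rayFactor` may vanish; but for `c` of size `1/(1 + |s|)` the Gauss series is dominated by its
nonzero constant term (`exists_rayFactor_lower_bound`). All rays give the same quotient, so the ray
may be chosen depending on `s`. This removes every possible pole and, since the kernel bound carries
the same power of `c` as the constant being divided out, gives finite order too. -/

/-- The real number `γ` is not a negative integer. -/
def NotNegInt (γ : ℝ) : Prop := ∀ k : ℕ, γ ≠ -((k : ℝ) + 1)

/-- The coefficient `1 / Γ(m + γ + 1)`. -/
def invGamma (γ : ℝ) (m : ℕ) : ℝ := (Real.Gamma (m + γ + 1))⁻¹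

lemma NotNegInt.add_one {γ : ℝ} (h : NotNegInt γ) : NotNegInt (γ + 1) := fun k hk =>
  h (k + 1) (by push_cast; linarith)

lemma NotNegInt.add_ne_zero {γ : ℝ} (h : NotNegInt γ) (m : ℕ) : (m : ℝ) + γ + 1 ≠ 0 :=
  fun hk => h m (by linarith)

lemma invGamma_succ {γ : ℝ} (h : NotNegInt γ) (m : ℕ) :
    invGamma γ m = (m + γ + 1) * invGamma γ (m + 1) := by
  have h0 := h.add_ne_zero m
  unfold invGamma
  rw [show ((m + 1 : ℕ) : ℝ) + γ + 1 = (m + γ + 1) + 1 by push_cast; ring,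
    Real.Gamma_add_one h0, mul_inv, mul_inv_cancel_left₀ h0]

lemma invGamma_add_one (γ : ℝ) (m : ℕ) : invGamma (γ + 1) m = invGamma γ (m + 1) := by
  unfold invGamma; push_cast; congr 2; ring

lemma invGamma_zero_ne {γ : ℝ} (h : NotNegInt γ) : invGamma γ 0 ≠ 0 := by
  unfold invGamma
  refine inv_ne_zero (Real.Gamma_ne_zero fun m hm => h m ?_)
  push_cast at hm; linarith

lemma exists_le_mul_pow_of_eventually_le {x : ℕ → ℝ} {q : ℝ} (hq : 0 < q)
    (h : ∀ᶠ m in atTop, x (m + 1) ≤ q * x m) : ∃ C > 0, ∀ m, x m ≤ C * q ^ m := by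
  obtain ⟨N, hN⟩ := eventually_atTop.1 h
  have hb : ∃ C > 0, ∀ m ≤ N, x m ≤ C * q ^ m := by
    refine ⟨1 + ∑ m ∈ Finset.range (N + 1), |x m| / q ^ m, by positivity, fun m hm => ?_⟩
    rw [← div_le_iff₀ (by positivity)]
    have := Finset.single_le_sum (f := fun m => |x m| / q ^ m) (fun i _ => by positivity)
      (Finset.mem_range.2 (Nat.lt_succ_of_le hm))
    have h2 : x m / q ^ m ≤ |x m| / q ^ m := by gcongr; exact le_abs_self _
    linarith
  obtain ⟨C, hC, hb⟩ := hb
  refine ⟨C, hC, fun m => ?_⟩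
  rcases le_total m N with hm | hm
  · exact hb m hm
  · induction m, hm using Nat.le_induction with
    | base => exact hb N le_rfl
    | succ m hm ih =>
      calc x (m + 1) ≤ q * x m := hN m hm
        _ ≤ q * (C * q ^ m) := by gcongr
        _ = C * q ^ (m + 1) := by ring

/-- The ratio of consecutive terms is `(m + 1) / |m + γ + 1|`, which tends to `1`. A base
arbitrarily close to `1` is needed for the Gauss series, whose radius of convergence is `1`;
elsewhere base `2` is enough. -/
lemma exists_factorial_mul_invGamma_le {γ : ℝ} (h : NotNegInt γ) {q : ℝ} (hq : 1 < q) :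
    ∃ C > 0, ∀ m : ℕ, m.factorial * |invGamma γ m| ≤ C * q ^ m := by
  refine exists_le_mul_pow_of_eventually_le (by linarith) ?_
  have h1 : ∀ᶠ m : ℕ in atTop, (|γ| + 1) + (|γ| + 1) / (q - 1) ≤ (m : ℝ) :=
    tendsto_natCast_atTop_atTop.eventually_ge_atTop _
  filter_upwards [h1] with m hm
  have hq' : 0 < q - 1 := by linarith
  have h2 : 0 ≤ (|γ| + 1) / (q - 1) := by positivity
  have h3 : -|γ| ≤ γ := neg_abs_le γ
  have hpos : 0 < (m : ℝ) + γ + 1 := by linarith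
  have h4 : (|γ| + 1) / (q - 1) ≤ m + γ + 1 := by linarith
  rw [div_le_iff₀ hq'] at h4
  rw [invGamma_succ h m, abs_mul, abs_of_pos hpos, Nat.factorial_succ]
  push_cast
  have : (m : ℝ) + 1 ≤ q * (m + γ + 1) := by nlinarith
  calc ((m : ℝ) + 1) * m.factorial * |invGamma γ (m + 1)|
      ≤ (q * (m + γ + 1)) * m.factorial * |invGamma γ (m + 1)| := by gcongr
    _ = _ := by ring

/-- The rising factorial `z (z + 1) ⋯ (z + m - 1)`. -/
def rising (z : ℂ) (m : ℕ) : ℂ := ∏ k ∈ Finset.range m, (z + k)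

@[simp] lemma rising_zero (z : ℂ) : rising z 0 = 1 := by simp [rising]

lemma rising_succ (z : ℂ) (m : ℕ) : rising z (m + 1) = rising z m * (z + m) :=
  Finset.prod_range_succ _ _

lemma rising_succ' (z : ℂ) (m : ℕ) : rising z (m + 1) = z * rising (z + 1) m := by
  unfold rising
  rw [Finset.prod_range_succ', mul_comm]
  simp only [Nat.cast_zero, add_zero]
  congr 1
  refine Finset.prod_congr rfl fun k _ => ?_
  push_cast; ring

lemma conj_rising (z : ℂ) (m : ℕ) : conj (rising z m) = rising (conj z) m := by
  simp [rising, map_prod]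

lemma differentiable_rising (m : ℕ) : Differentiable ℂ fun z => rising z m := by
  unfold rising; fun_prop

lemma Gamma_add_nat {z : ℂ} (hz : 0 < z.re) (m : ℕ) :
    Complex.Gamma (z + m) = rising z m * Complex.Gamma z := by
  induction m with
  | zero => simp
  | succ m ih =>
    have : z + m ≠ 0 := fun h => by
      have := congrArg Complex.re h
      simp at this
      have h2 : (0 : ℝ) ≤ m := m.cast_nonneg
      linarith
    rw [Nat.cast_succ, ← add_assoc, Complex.Gamma_add_one _ this, ih, rising_succ]; ring

/-- The bound is the rising factorial of `N + 1`. It is sharp enough to keep the Gauss series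
convergent up to radius `1`, uniformly for parameters of size at most `N + 1`. -/
lemma norm_rising_le_choose {z : ℂ} {N : ℕ} (hz : ‖z‖ ≤ N + 1) (m : ℕ) :
    ‖rising z m‖ ≤ m.factorial * (m + N).choose N := by
  induction m with
  | zero => simp
  | succ m ih =>
    rw [rising_succ, norm_mul]
    have h1 : ‖z + m‖ ≤ N + 1 + m := (norm_add_le _ _).trans (by simpa using hz)
    calc ‖rising z m‖ * ‖z + m‖ ≤ (m.factorial * (m + N).choose N) * (N + 1 + m) := by gcongr
      _ = (m + 1).factorial * (m + 1 + N).choose N := by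
        rw [Nat.factorial_succ]
        have h2 : (m + N + 1 : ℕ) * (m + N).choose m = (m + 1 + N).choose (m + 1) * (m + 1) := by
          have := Nat.add_one_mul_choose_eq (m + N) m
          rw [this]; congr 2; ring
        have e1 : (m + N).choose m = (m + N).choose N := Nat.choose_symm_add
        have e2 : (m + 1 + N).choose (m + 1) = (m + 1 + N).choose N := Nat.choose_symm_add
        rw [e1, e2] at h2
        have h3 : ((m : ℝ) + N + 1) * ((m + N).choose N : ℕ) =
          ((m + 1 + N).choose N : ℕ) * (m + 1) := by exact_mod_cast h2
        push_cast
        linear_combination (m.factorial : ℝ) * h3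

/-- Cruder than `norm_rising_le_choose`, but explicit in the size of the parameter: each factor
satisfies `‖z + k‖ ≤ X (k + 1)`. It serves where the variable is small compared with `X⁻²`. -/
lemma norm_rising_le_pow {z : ℂ} {X : ℝ} (hz : 1 + ‖z‖ ≤ X) (m : ℕ) :
    ‖rising z m‖ ≤ m.factorial * X ^ m := by
  have hX : 0 ≤ X := by linarith [norm_nonneg z]
  induction m with
  | zero => simp
  | succ m ih =>
    rw [rising_succ, norm_mul, Nat.factorial_succ]
    have h1 : ‖z + m‖ ≤ X * (m + 1) := by
      have := norm_add_le z m
      simp only [Complex.norm_natCast] at this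
      have hm : (0:ℝ) ≤ m := m.cast_nonneg
      nlinarith [norm_nonneg z]
    calc ‖rising z m‖ * ‖z + m‖ ≤ (m.factorial * X ^ m) * (X * (m + 1)) := by gcongr
      _ = _ := by push_cast; ring

/-- Chu–Vandermonde. -/
lemma sum_antidiagonal_rising {γ : ℝ} (h : NotNegInt γ) (D : ℂ) (n : ℕ) :
    ∑ ij ∈ Finset.HasAntidiagonal.antidiagonal n,
      (n.choose ij.1 : ℂ) * ((-1) ^ ij.2 * rising D ij.2 * invGamma γ ij.2) =
      rising (γ + 1 - D) n * invGamma γ n := by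
  induction n generalizing γ D with
  | zero => simp
  | succ n ih =>
    -- Pascal's rule splits the sum into two of length `n`: one with the same `γ` and `D`, the other
    -- with both raised by `1`. Hence the induction over all `γ` and `D`.
    rw [Finset.sum_antidiagonal_choose_succ_mul
      (fun _ j => (-1) ^ j * rising D j * (invGamma γ j : ℂ))]
    have e1 : ∑ ij ∈ Finset.HasAntidiagonal.antidiagonal n, (n.choose ij.1 : ℂ) *
        ((-1) ^ (ij.2 + 1) * rising D (ij.2 + 1) * invGamma γ (ij.2 + 1)) =
        -D * ∑ ij ∈ Finset.HasAntidiagonal.antidiagonal n, (n.choose ij.1 : ℂ) *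
          ((-1) ^ ij.2 * rising (D + 1) ij.2 * invGamma (γ + 1) ij.2) := by
      rw [Finset.mul_sum]
      refine Finset.sum_congr rfl fun ij _ => ?_
      rw [rising_succ', invGamma_add_one]; ring
    have e2 : ∑ ij ∈ Finset.HasAntidiagonal.antidiagonal n, (n.choose ij.2 : ℂ) *
        ((-1) ^ ij.2 * rising D ij.2 * invGamma γ ij.2) = 
        ∑ ij ∈ Finset.HasAntidiagonal.antidiagonal n, (n.choose ij.1 : ℂ) *
        ((-1) ^ ij.2 * rising D ij.2 * invGamma γ ij.2) := by
      refine Finset.sum_congr rfl fun ij hij => ?_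
      rw [Nat.choose_symm_of_eq_add (Finset.HasAntidiagonal.mem_antidiagonal.1 hij).symm]
    rw [e1, e2, ih h, ih h.add_one, invGamma_add_one, rising_succ]
    have h0 := invGamma_succ h n
    have h1 : (invGamma γ n : ℂ) = (n + γ + 1) * invGamma γ (n + 1) := by exact_mod_cast h0
    rw [h1]
    push_cast
    rw [show (γ : ℂ) + 1 + 1 - (D + 1) = γ + 1 - D by ring]
    ring

lemma summable_rising_div_factorial {γ : ℝ} (h : NotNegInt γ) (D x : ℂ) :
    Summable fun m : ℕ => ‖rising D m * invGamma γ m / m.factorial * x ^ m‖ := by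
  obtain ⟨C, hC, hb⟩ := exists_factorial_mul_invGamma_le h one_lt_two
  refine .of_nonneg_of_le (fun _ => norm_nonneg _) (fun m => ?_)
    ((Real.summable_pow_div_factorial ((1 + ‖D‖) * 2 * ‖x‖)).mul_left C)
  rw [norm_mul, norm_div, norm_mul, norm_pow, Complex.norm_natCast, Complex.norm_real,
    Real.norm_eq_abs]
  have h1 := norm_rising_le_pow (le_refl (1 + ‖D‖)) m
  calc ‖rising D m‖ * |invGamma γ m| / m.factorial * ‖x‖ ^ m
      ≤ (m.factorial * (1 + ‖D‖) ^ m) * |invGamma γ m| / m.factorial * ‖x‖ ^ m := by gcongr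
    _ = (m.factorial * |invGamma γ m|) * ((1 + ‖D‖) ^ m / m.factorial * ‖x‖ ^ m) := by ring
    _ ≤ (C * 2 ^ m) * ((1 + ‖D‖) ^ m / m.factorial * ‖x‖ ^ m) :=
        mul_le_mul_of_nonneg_right (hb m) (by positivity)
    _ = _ := by rw [mul_pow, mul_pow]; ring

/-- Kummer's transformation of the confluent hypergeometric series. -/
lemma kummer_transformation {γ : ℝ} (h : NotNegInt γ) (A x : ℂ) :
    ∑' m : ℕ, rising A m * invGamma γ m / m.factorial * (-x) ^ m =
      Complex.exp (-x) *
        ∑' m : ℕ, rising (γ + 1 - A) m * invGamma γ m / m.factorial * x ^ m := by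
  rw [Complex.exp_eq_exp_ℂ, NormedSpace.exp_eq_tsum_div,
    tsum_mul_tsum_eq_tsum_sum_antidiagonal_of_summable_norm
      (NormedSpace.norm_expSeries_div_summable (-x))
      (summable_rising_div_factorial h _ x)]
  refine tsum_congr fun n => ?_
  -- The `n`-th coefficient of the Cauchy product with the exponential series is a Chu–Vandermonde
  -- sum.
  have hv := sum_antidiagonal_rising h (γ + 1 - A) n
  rw [sub_sub_cancel] at hv
  rw [← hv, Finset.sum_div, Finset.sum_mul]
  refine Finset.sum_congr rfl fun ij hij => ?_
  have hij' := Finset.HasAntidiagonal.mem_antidiagonal.1 hij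
  have hc : (n.choose ij.1 : ℂ) * (ij.1.factorial * ij.2.factorial) = n.factorial := by
    have := Nat.choose_mul_factorial_mul_factorial (n := n) (k := ij.1) (by omega)
    rw [show n - ij.1 = ij.2 by omega, mul_assoc] at this
    exact_mod_cast this
  have f1 : (ij.1.factorial : ℂ) ≠ 0 := by exact_mod_cast ij.1.factorial_ne_zero
  have f2 : (ij.2.factorial : ℂ) ≠ 0 := by exact_mod_cast ij.2.factorial_ne_zero
  have f3 : (n.factorial : ℂ) ≠ 0 := by exact_mod_cast n.factorial_ne_zero
  have hx : (-x) ^ n = (-x) ^ ij.1 * ((-1) ^ ij.2 * x ^ ij.2) := by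
    rw [← hij', pow_add, neg_pow x ij.2]
  have hs : ((-1 : ℂ) ^ ij.2) * (-1) ^ ij.2 = 1 := by rw [← mul_pow]; simp
  rw [hx, ← hc]
  rw [← hc] at f3
  have f4 : (n.choose ij.1 : ℂ) ≠ 0 := left_ne_zero_of_mul f3
  field_simp
  linear_combination
    ((-x) ^ ij.1 * x ^ ij.2 * rising (γ + 1 - A) ij.2 * invGamma γ ij.2 : ℂ) * hs

/-! ### The entire function underlying the Bessel function of the first kind -/

/-- The series `∑ (-1)^m v^m / (m! Γ(m + γ + 1))`. -/
def cliff (γ v : ℝ) : ℝ := ∑' m : ℕ, (-1) ^ m * ((m.factorial : ℝ)⁻¹ * invGamma γ m) * v ^ m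

lemma besselJ_eq_cliff (α : ℝ) {x : ℝ} (hx : 0 < x) :
    besselJ α x = (x / 2) ^ α * cliff α (x ^ 2 / 4) := by
  unfold besselJ cliff invGamma
  rw [← tsum_mul_left]
  refine tsum_congr fun m => ?_
  rw [Real.rpow_add (by positivity), show (2 * (m : ℝ)) = ((2 * m : ℕ) : ℝ) by push_cast; ring,
    Real.rpow_natCast, pow_mul, show (x / 2) ^ 2 = x ^ 2 / 4 by ring]
  ring

lemma exists_cliff_coeff_bound {γ : ℝ} (h : NotNegInt γ) : ∃ C > 0, ∀ m : ℕ,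
    |(-1) ^ m * ((m.factorial : ℝ)⁻¹ * invGamma γ m)| ≤ C * (2 ^ m / m.factorial) := by
  obtain ⟨C, hC, hb⟩ := exists_factorial_mul_invGamma_le h one_lt_two
  refine ⟨C, hC, fun m => ?_⟩
  rw [abs_mul, abs_pow, abs_neg, abs_one, one_pow, one_mul, abs_mul, abs_inv, Nat.abs_cast]
  have h1 : (1 : ℝ) ≤ m.factorial := by exact_mod_cast m.factorial_pos
  have h2 : |invGamma γ m| ≤ C * 2 ^ m := by
    refine le_trans ?_ (hb m)
    nlinarith [abs_nonneg (invGamma γ m)]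
  calc _ ≤ (m.factorial : ℝ)⁻¹ * (C * 2 ^ m) := by gcongr
    _ = _ := by ring

lemma summable_cliff {γ : ℝ} (h : NotNegInt γ) (v : ℝ) :
    Summable fun m : ℕ => |(-1) ^ m * ((m.factorial : ℝ)⁻¹ * invGamma γ m) * v ^ m| := by
  obtain ⟨C, hC, hb⟩ := exists_cliff_coeff_bound h
  refine .of_nonneg_of_le (fun _ => abs_nonneg _) (fun m => ?_)
    ((Real.summable_pow_div_factorial (2 * |v|)).mul_left C)
  rw [abs_mul, abs_pow]
  calc _ ≤ C * (2 ^ m / m.factorial) * |v| ^ m := by gcongr; exact hb m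
    _ = _ := by rw [mul_pow]; ring

lemma hasDerivAt_cliff {γ : ℝ} (h : NotNegInt γ) (v : ℝ) :
    HasDerivAt (cliff γ) (-cliff (γ + 1) v) v := by
  obtain ⟨C, hC, hb⟩ := exists_cliff_coeff_bound h
  set c : ℕ → ℝ := fun m => (-1) ^ m * ((m.factorial : ℝ)⁻¹ * invGamma γ m) with hc
  set R : ℝ := |v| + 1
  have hR : 0 < R := by positivity
  have hc' : ∀ m, c (m + 1) * (m + 1) =
      -((-1) ^ m * ((m.factorial : ℝ)⁻¹ * invGamma (γ + 1) m)) := fun m => by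
    simp only [hc]
    rw [invGamma_add_one, Nat.factorial_succ]
    have : ((m : ℝ) + 1) ≠ 0 := by positivity
    have : (m.factorial : ℝ) ≠ 0 := by positivity
    push_cast
    field_simp
    ring
  have key : HasDerivAt (fun z => ∑' m, c m * z ^ m) (∑' m, c m * (m * v ^ (m - 1))) v := by
    refine hasDerivAt_tsum_of_isPreconnected
      (u := fun m : ℕ => C * (2 ^ m / m.factorial * (m * R ^ (m - 1))))
      (t := Metric.ball (0 : ℝ) R) ?_ Metric.isOpen_ball (convex_ball _ _).isPreconnected
      (fun m y _ => (hasDerivAt_pow m y).const_mul _) (fun m y hy => ?_) (y₀ := (0 : ℝ))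
      (by simpa using hR) ?_ (by simp [R])
    · refine Summable.mul_left C ?_
      rw [← summable_nat_add_iff 1]
      refine ((Real.summable_pow_div_factorial (2 * R)).mul_left 2).congr fun m => ?_
      rw [Nat.factorial_succ]
      have : ((m : ℝ) + 1) ≠ 0 := by positivity
      have : (m.factorial : ℝ) ≠ 0 := by positivity
      push_cast
      rw [mul_pow, pow_succ]
      field_simp
    · rw [norm_mul, norm_mul (m : ℝ), Real.norm_natCast, norm_pow]
      have hy' : ‖y‖ ≤ R := by simpa using (mem_ball_zero_iff.1 hy).le
      calc _ ≤ (C * (2 ^ m / m.factorial)) * (m * R ^ (m - 1)) := by gcongr; exact hb m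
        _ = _ := by ring
    · exact (summable_cliff h 0).of_abs
  have hsum : Summable fun m : ℕ => c m * (m * v ^ (m - 1)) := by
    rw [← summable_nat_add_iff 1]
    refine ((summable_cliff h.add_one v).of_abs.neg).congr fun m => ?_
    rw [Nat.add_sub_cancel, ← mul_assoc]
    push_cast
    rw [← mul_assoc, hc']; ring
  refine HasDerivAt.congr_deriv (f := cliff γ) key ?_
  rw [hsum.tsum_eq_zero_add]
  simp only [Nat.cast_zero, zero_mul, mul_zero, zero_add, Nat.add_sub_cancel]
  rw [cliff, ← tsum_neg]
  refine tsum_congr fun m => ?_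
  push_cast
  rw [← mul_assoc, hc']; ring

lemma continuous_cliff {γ : ℝ} (h : NotNegInt γ) : Continuous (cliff γ) :=
  continuous_iff_continuousAt.2 fun v => (hasDerivAt_cliff h v).continuousAt

/-- The three-term recurrence of Bessel functions: in `1/Γ(m+γ+1) = (m+γ+1)/Γ(m+γ+2)` the part `m`
cancels against the factorial and shifts the index. -/
lemma cliff_contiguous {γ : ℝ} (h : NotNegInt γ) (v : ℝ) :
    cliff γ v = (γ + 1) * cliff (γ + 1) v - v * cliff (γ + 1 + 1) v := by
  have s0 := (summable_cliff h v).of_abs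
  have s1 := (summable_cliff h.add_one v).of_abs
  have s2 := (summable_cliff h.add_one.add_one v).of_abs
  unfold cliff
  rw [s0.tsum_eq_zero_add, s1.tsum_eq_zero_add, mul_add, ← tsum_mul_left, ← tsum_mul_left,
    add_sub_assoc, ← Summable.tsum_sub]
  · simp only [pow_zero, Nat.factorial_zero, Nat.cast_one, inv_one, one_mul, mul_one]
    congr 1
    · rw [invGamma_succ h, invGamma_add_one]; simp
    · refine tsum_congr fun m => ?_
      rw [invGamma_succ h, invGamma_add_one, invGamma_add_one, invGamma_add_one,
        Nat.factorial_succ]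
      have : ((m : ℝ) + 1) ≠ 0 := by positivity
      have : (m.factorial : ℝ) ≠ 0 := by positivity
      push_cast
      field_simp
      ring
  · exact (((summable_nat_add_iff 1).2 s1).mul_left (γ + 1))
  · exact s2.mul_left v

/-- An energy argument replaces Bessel asymptotics. With `E = c_γ² + v c_{γ+1}²`, where `c_γ` is
`cliff γ`, the contiguous relation collapses the derivative to `E' = -(2γ+1) c_{γ+1}²`. Hence `v E'
≤ M E` once `M ≥ |2γ+1|`, and `E / v^M` decreases on `[1, ∞)`. -/
lemma exists_cliff_bound {γ : ℝ} (h : NotNegInt γ) :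
    ∃ C > 0, ∃ M : ℕ, ∀ v ≥ 0, |cliff γ v| ≤ C * (1 + v) ^ M := by
  obtain ⟨M, hM⟩ := exists_nat_ge |2 * γ + 1|
  set E : ℝ → ℝ := fun v => cliff γ v ^ 2 + v * cliff (γ + 1) v ^ 2 with hE
  have hE0 : ∀ v ≥ 0, 0 ≤ E v := fun v hv => by positivity
  have hder : ∀ v, HasDerivAt E (-(2 * γ + 1) * cliff (γ + 1) v ^ 2) v := fun v => by
    have h1 := ((hasDerivAt_cliff h v).pow 2).add
      ((hasDerivAt_id v).mul ((hasDerivAt_cliff h.add_one v).pow 2))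
    refine h1.congr_deriv ?_
    simp only [id, Nat.cast_ofNat, Pi.pow_apply]
    have := cliff_contiguous h v
    linear_combination 2 * cliff (γ + 1) v * (1 : ℝ) * this - 4 * cliff (γ+1) v * this
  have hanti : AntitoneOn (fun v => E v / v ^ M) (Ici 1) := by
    have hd : ∀ v ∈ Ici (1:ℝ), HasDerivAt (fun v => E v / v ^ M)
        ((-(2 * γ + 1) * cliff (γ + 1) v ^ 2 * v ^ M - E v * (M * v ^ (M - 1))) / (v ^ M) ^ 2) v :=
      fun v hv => (hder v).div (hasDerivAt_pow M v)
        (pow_ne_zero _ (by linarith [mem_Ici.1 hv] : v ≠ 0))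
    refine antitoneOn_of_deriv_nonpos (convex_Ici 1)
      (fun v hv => (hd v hv).continuousAt.continuousWithinAt)
      (fun v hv => (hd v (interior_subset hv)).differentiableAt.differentiableWithinAt)
      (fun v hv => ?_)
    have hv1 : 1 ≤ v := interior_subset hv
    rw [(hd v hv1).deriv]
    refine div_nonpos_of_nonpos_of_nonneg ?_ (by positivity)
    rcases Nat.eq_zero_or_pos M with rfl | hM0
    · have : 2 * γ + 1 = 0 := abs_nonpos_iff.1 (by simpa using hM)
      simp [this]
    · have hp : v ^ M = v * v ^ (M - 1) := by rw [← pow_succ']; congr 1; omega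
      have h3 : -(2 * γ + 1) ≤ M := (neg_le_abs _).trans hM
      have h4 : -(2 * γ + 1) * (v * cliff (γ + 1) v ^ 2) ≤ M * E v := by
        calc -(2 * γ + 1) * (v * cliff (γ + 1) v ^ 2) ≤ M * (v * cliff (γ + 1) v ^ 2) := by
              gcongr
          _ ≤ M * E v := by
              gcongr
              have := sq_nonneg (cliff γ v)
              simp only [hE]; linarith
      rw [hp]
      have h5 : 0 ≤ v ^ (M - 1) := by positivity
      nlinarith [mul_le_mul_of_nonneg_right h4 h5]
  obtain ⟨B, hB⟩ := (isCompact_Icc (a := (0:ℝ)) (b := 1)).exists_bound_of_continuousOn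
    (continuous_cliff h).continuousOn
  refine ⟨|B| + E 1 + 1, by have := hE0 1 zero_le_one; positivity, M, fun v hv => ?_⟩
  have hE1 := hE0 1 zero_le_one
  have hp : (1:ℝ) ≤ (1 + v) ^ M := one_le_pow₀ (by linarith)
  rcases le_total v 1 with h1 | h1
  · have := hB v ⟨hv, h1⟩
    rw [Real.norm_eq_abs] at this
    have := this.trans (le_abs_self B)
    nlinarith [abs_nonneg B]
  · have h2 := hanti (mem_Ici.2 le_rfl) (mem_Ici.2 h1) h1
    simp only [one_pow, div_one] at h2
    rw [div_le_iff₀ (by positivity)] at h2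
    have h3 : cliff γ v ^ 2 ≤ E v := by
      have : 0 ≤ v * cliff (γ + 1) v ^ 2 := by positivity
      simp only [hE]; linarith
    have h4 : v ^ M ≤ (1 + v) ^ M := by gcongr; linarith
    have h5 : cliff γ v ^ 2 ≤ E 1 * (1 + v) ^ M := h3.trans (h2.trans (by gcongr))
    refine abs_le_of_sq_le_sq ?_ (by positivity)
    have : (|B| + E 1 + 1) * 1 ≤ (|B| + E 1 + 1) * (1 + v) ^ M := by gcongr
    nlinarith [abs_nonneg B, mul_nonneg (abs_nonneg B) (by linarith : 0 ≤ (1 + v) ^ M)]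

/-! ### The modified Bessel function of the second kind -/

/-- The integral `∫₀^∞ cosh(t)^j exp(-x cosh t) cosh(β t) dt`, which is `(-1)^j` times the `j`-th
derivative of `K_β`. -/
def besselKMoment (β : ℂ) (j : ℕ) (x : ℝ) : ℂ :=
  ∫ t in Ioi (0 : ℝ), ((Real.cosh t ^ j * Real.exp (-(x * Real.cosh t)) : ℝ) : ℂ) *
    Complex.cosh (β * t)

lemma besselKMoment_zero (β : ℂ) (x : ℝ) : besselKMoment β 0 x = besselK β x := by
  simp [besselKMoment, besselK]

lemma norm_cosh_le_exp (z : ℂ) : ‖Complex.cosh z‖ ≤ Real.exp ‖z‖ := by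
  rw [Complex.cosh, norm_div]
  have h1 : ‖Complex.exp z‖ ≤ Real.exp ‖z‖ := Complex.norm_exp_le_exp_norm z
  have h2 : ‖Complex.exp (-z)‖ ≤ Real.exp ‖z‖ := by simpa using Complex.norm_exp_le_exp_norm (-z)
  have := (norm_add_le _ _).trans (add_le_add h1 h2)
  simp only [Complex.norm_ofNat]
  linarith

lemma exp_neg_le_factorial_div_pow {y : ℝ} (hy : 0 < y) (n : ℕ) :
    Real.exp (-y) ≤ n.factorial / y ^ n := by
  rw [Real.exp_neg, ← inv_div]
  exact inv_anti₀ (by positivity) (Real.pow_div_factorial_le_exp y hy.le n)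

/-- Half of the exponential is kept as decay in `x`. The other half is traded for `(x cosh t)^(-N)`,
which absorbs `cosh^j t` and `|cosh (β t)| ≤ (2 cosh t)^B`; the one spare power of `cosh t` supplies
`exp(-t)`. -/
lemma exists_besselK_integrand_bound (β : ℂ) (j : ℕ) : ∃ C > 0, ∃ N : ℕ, ∀ x > 0, ∀ t ≥ 0,
    ‖((Real.cosh t ^ j * Real.exp (-(x * Real.cosh t)) : ℝ) : ℂ) * Complex.cosh (β * t)‖ ≤
      C * (x ^ N)⁻¹ * Real.exp (-(x / 2)) * Real.exp (-t) := by
  obtain ⟨B, hB⟩ := exists_nat_ge ‖β‖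
  refine ⟨2 ^ B * ((j + B + 1).factorial * 2 ^ (j + B + 1)) * 2, by positivity, j + B + 1,
    fun x hx t ht => ?_⟩
  have hc1 : 1 ≤ Real.cosh t := Real.one_le_cosh t
  have hc0 : 0 < Real.cosh t := by linarith
  have hexp : Real.exp t ≤ 2 * Real.cosh t := by
    rw [Real.cosh_eq]; linarith [Real.exp_pos (-t)]
  have h1 : ‖Complex.cosh (β * t)‖ ≤ (2 * Real.cosh t) ^ B := by
    refine (norm_cosh_le_exp _).trans ?_
    rw [norm_mul, Complex.norm_real, Real.norm_of_nonneg ht]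
    calc Real.exp (‖β‖ * t) ≤ Real.exp (B * t) := by gcongr
      _ = Real.exp t ^ B := by rw [Real.exp_nat_mul]
      _ ≤ _ := by gcongr
  have h2 : Real.exp (-(x * Real.cosh t)) ≤ Real.exp (-(x / 2)) *
      ((j + B + 1).factorial / (x / 2 * Real.cosh t) ^ (j + B + 1)) := by
    calc Real.exp (-(x * Real.cosh t))
        = Real.exp (-(x / 2 * Real.cosh t)) * Real.exp (-(x / 2 * Real.cosh t)) := by
          rw [← Real.exp_add]; ring_nf
      _ ≤ _ := by
        gcongr
        · nlinarith
        · exact exp_neg_le_factorial_div_pow (by positivity) _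
  have h3 : (Real.cosh t)⁻¹ ≤ 2 * Real.exp (-t) := by
    rw [Real.exp_neg, ← div_eq_mul_inv, inv_eq_one_div, div_le_div_iff₀ hc0 (Real.exp_pos t)]
    linarith
  rw [norm_mul, Complex.norm_real, Real.norm_of_nonneg (by positivity)]
  calc Real.cosh t ^ j * Real.exp (-(x * Real.cosh t)) * ‖Complex.cosh (β * t)‖
      ≤ Real.cosh t ^ j * (Real.exp (-(x / 2)) *
        ((j + B + 1).factorial / (x / 2 * Real.cosh t) ^ (j + B + 1))) *
          (2 * Real.cosh t) ^ B := by gcongr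
    _ = 2 ^ B * ((j + B + 1).factorial * 2 ^ (j + B + 1)) * (x ^ (j + B + 1))⁻¹ *
        Real.exp (-(x / 2)) * (Real.cosh t)⁻¹ := by
      rw [mul_pow, mul_pow, div_pow]
      field_simp
      ring
    _ ≤ 2 ^ B * ((j + B + 1).factorial * 2 ^ (j + B + 1)) * (x ^ (j + B + 1))⁻¹ *
        Real.exp (-(x / 2)) * (2 * Real.exp (-t)) := by gcongr
    _ = _ := by ring

lemma continuous_besselK_integrand (β : ℂ) (j : ℕ) (x : ℝ) : Continuous fun t : ℝ =>
    ((Real.cosh t ^ j * Real.exp (-(x * Real.cosh t)) : ℝ) : ℂ) * Complex.cosh (β * t) := by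
  have := Real.continuous_cosh
  have := Complex.continuous_cosh
  fun_prop

lemma integrableOn_besselK_integrand (β : ℂ) (j : ℕ) {x : ℝ} (hx : 0 < x) :
    IntegrableOn (fun t : ℝ => ((Real.cosh t ^ j * Real.exp (-(x * Real.cosh t)) : ℝ) : ℂ) *
      Complex.cosh (β * t)) (Ioi 0) := by
  obtain ⟨C, hC, N, hb⟩ := exists_besselK_integrand_bound β j
  refine Integrable.mono' ((integrableOn_exp_neg_Ioi 0).const_mul
    (C * (x ^ N)⁻¹ * Real.exp (-(x / 2))))
    (continuous_besselK_integrand β j x).aestronglyMeasurable ?_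
  filter_upwards [ae_restrict_mem measurableSet_Ioi] with t ht
  exact hb x hx t (le_of_lt ht)

lemma exists_besselKMoment_bound (β : ℂ) (j : ℕ) : ∃ C > 0, ∃ N : ℕ, ∀ x > 0,
    ‖besselKMoment β j x‖ ≤ C * (x ^ N)⁻¹ * Real.exp (-(x / 2)) := by
  obtain ⟨C, hC, N, hb⟩ := exists_besselK_integrand_bound β j
  refine ⟨C, hC, N, fun x hx => ?_⟩
  have h := norm_integral_le_of_norm_le ((integrableOn_exp_neg_Ioi 0).const_mul
    (C * (x ^ N)⁻¹ * Real.exp (-(x / 2))))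
    ((ae_restrict_mem measurableSet_Ioi).mono fun t ht => hb x hx t (le_of_lt ht))
  rwa [integral_const_mul, integral_exp_neg_Ioi_zero, mul_one] at h

lemma hasDerivAt_besselKMoment (β : ℂ) (j : ℕ) {x : ℝ} (hx : 0 < x) :
    HasDerivAt (besselKMoment β j) (-besselKMoment β (j + 1) x) x := by
  obtain ⟨C, hC, N, hb⟩ := exists_besselK_integrand_bound β (j + 1)
  have hx2 : 0 < x / 2 := by linarith
  have key := (hasDerivAt_integral_of_dominated_loc_of_deriv_le (μ := volume.restrict (Ioi 0))
    (F := fun (y : ℝ) (t : ℝ) => ((Real.cosh t ^ j * Real.exp (-(y * Real.cosh t)) : ℝ) : ℂ) *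
      Complex.cosh (β * t))
    (F' := fun (y : ℝ) (t : ℝ) => -(((Real.cosh t ^ (j + 1) *
      Real.exp (-(y * Real.cosh t)) : ℝ) : ℂ) * Complex.cosh (β * t)))
    (bound := fun t => C * ((x / 2) ^ N)⁻¹ * Real.exp (-(x / 2 / 2)) * Real.exp (-t))
    (Ioi_mem_nhds (show x / 2 < x by linarith))
    (Eventually.of_forall fun y => (continuous_besselK_integrand β j y).aestronglyMeasurable)
    (integrableOn_besselK_integrand β j hx)
    (continuous_besselK_integrand β (j + 1) x).neg.aestronglyMeasurable ?_ ?_ ?_).2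
  · rw [integral_neg] at key
    exact key
  · filter_upwards [ae_restrict_mem measurableSet_Ioi] with t ht y hy
    have hy' : x / 2 < y := hy
    rw [norm_neg]
    refine (hb y (by linarith) t (le_of_lt ht)).trans ?_
    gcongr
  · exact (integrableOn_exp_neg_Ioi 0).const_mul _
  · refine Eventually.of_forall fun t y _ => ?_
    have h1 : HasDerivAt (fun y : ℝ => Real.cosh t ^ j * Real.exp (-(y * Real.cosh t)))
        (-(Real.cosh t ^ (j + 1) * Real.exp (-(y * Real.cosh t)))) y := by
      have := ((((hasDerivAt_id y).mul_const (Real.cosh t)).neg).exp).const_mul (Real.cosh t ^ j)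
      refine this.congr_deriv ?_
      simp only [id, Pi.neg_apply]; ring
    refine (h1.ofReal_comp.mul_const (Complex.cosh (β * t))).congr_deriv ?_
    push_cast; ring

lemma continuousOn_besselKMoment (β : ℂ) (j : ℕ) : ContinuousOn (besselKMoment β j) (Ioi 0) :=
  fun _ hx => (hasDerivAt_besselKMoment β j hx).continuousAt.continuousWithinAt

lemma besselK_neg (β : ℂ) (x : ℝ) : besselK (-β) x = besselK β x := by
  unfold besselK
  simp only [neg_mul, Complex.cosh_neg]

/-- The half-line integral of `cosh (β t)` is half of the full-line integral of `exp (β t)`, because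
`cosh t` is even. The substitutions `v = exp t` and `v = 2u/x` then give the stated form, in which
`x²` enters linearly in the exponent. -/
lemma besselK_eq_integral (β : ℂ) {x : ℝ} (hx : 0 < x) :
    besselK β x = 1 / 2 * ((2 / x : ℝ) : ℂ) ^ β *
      ∫ u in Ioi (0 : ℝ), (u : ℂ) ^ (β - 1) * (Real.exp (-(u + x ^ 2 / 4 / u)) : ℝ) := by
  set g : ℝ → ℂ := fun v => (v : ℂ) ^ (β - 1) * (Real.exp (-(x / 2 * (v + v⁻¹))) : ℝ) with hg
  have hG : ∀ t : ℝ, |Real.exp t| • g (Real.exp t) =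
      (Real.exp (-(x * Real.cosh t)) : ℂ) * Complex.exp (β * t) := fun t => by
    simp only [hg]
    rw [abs_of_pos (Real.exp_pos t), Complex.real_smul, ← Real.exp_neg, Real.cosh_eq,
      Complex.ofReal_exp, Complex.cpow_def_of_ne_zero (Complex.exp_ne_zero _),
      ← Complex.ofReal_exp, ← Complex.ofReal_log (Real.exp_pos t).le, Real.log_exp,
      mul_left_comm, ← mul_assoc, Complex.ofReal_exp, mul_comm, ← Complex.exp_add]
    congr 2
    · congr 1; ring
    · ring
  have hI : ∀ β' : ℂ, IntegrableOn (fun t : ℝ =>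
      (Real.exp (-(x * Real.cosh t)) : ℂ) * Complex.exp (β' * t)) (Ioi 0) := fun β' => by
    obtain ⟨C, hC, N, hb⟩ := exists_besselK_integrand_bound (‖β'‖ : ℂ) 0
    refine Integrable.mono' (((integrableOn_exp_neg_Ioi 0).const_mul
      (C * (x ^ N)⁻¹ * Real.exp (-(x / 2)))).const_mul 2) ?_ ?_
    · have := Real.continuous_cosh
      exact Continuous.aestronglyMeasurable (by fun_prop)
    filter_upwards [ae_restrict_mem measurableSet_Ioi] with t ht
    refine le_trans ?_ (mul_le_mul_of_nonneg_left (hb x hx t (le_of_lt ht)) zero_le_two)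
    rw [norm_mul, norm_mul, pow_zero, one_mul, Complex.norm_real, mul_left_comm]
    gcongr
    have e1 : Complex.cosh (‖β'‖ * t) = ((Real.cosh (‖β'‖ * t) : ℝ) : ℂ) := by push_cast; rfl
    rw [e1, Complex.norm_real, Real.norm_of_nonneg (Real.cosh_pos _).le, Complex.norm_exp,
      Real.cosh_eq]
    have h2 : Real.exp (β' * t).re ≤ Real.exp (‖β'‖ * t) := by
      gcongr
      rw [Complex.re_mul_ofReal]
      exact mul_le_mul_of_nonneg_right (Complex.re_le_norm _) (le_of_lt ht)
    linarith [Real.exp_pos (-(‖β'‖ * t))]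
  have h1 : ∫ v in Ioi (0 : ℝ), g v = 2 * besselK β x := by
    have himg : Real.exp '' univ = Ioi 0 := by rw [image_univ, Real.range_exp]
    rw [← himg, integral_image_eq_integral_abs_deriv_smul MeasurableSet.univ
      (fun t _ => (Real.hasDerivAt_exp t).hasDerivWithinAt) Real.exp_injective.injOn,
      setIntegral_univ]
    simp_rw [hG]
    have hneg : ∀ t : ℝ, (Real.exp (-(x * Real.cosh (-t))) : ℂ) * Complex.exp (β * (-t : ℝ)) =
        (Real.exp (-(x * Real.cosh t)) : ℂ) * Complex.exp (-β * t) := fun t => by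
      rw [Real.cosh_neg]; push_cast; ring_nf
    have hIic : IntegrableOn (fun t : ℝ =>
        (Real.exp (-(x * Real.cosh t)) : ℂ) * Complex.exp (β * t)) (Iic 0) := by
      have h : IntegrableOn (fun t : ℝ =>
          (Real.exp (-(x * Real.cosh t)) : ℂ) * Complex.exp (-β * t)) (Ici 0) :=
        (integrableOn_Ici_iff_integrableOn_Ioi (by simp)).2 (hI (-β))
      have h' := ((integrable_indicator_iff measurableSet_Ici).2 h).comp_neg
      refine (integrable_indicator_iff measurableSet_Iic).1 (h'.congr (Eventually.of_forall
        fun t => ?_))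
      simp only [indicator, mem_Iic, mem_Ici, Left.nonneg_neg_iff]
      split_ifs
      · rw [← hneg, neg_neg]
      · rfl
    have hcomp := integral_comp_neg_Ioi (0 : ℝ) fun t : ℝ =>
      (Real.exp (-(x * Real.cosh t)) : ℂ) * Complex.exp (β * t)
    simp_rw [hneg] at hcomp
    rw [neg_zero] at hcomp
    rw [← intervalIntegral.integral_Iic_add_Ioi hIic (hI β), ← hcomp, ← integral_add (hI (-β)) (hI β), besselK, ← integral_const_mul]
    refine integral_congr_ae (Eventually.of_forall fun t => ?_)
    simp only [Complex.cosh]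
    ring_nf
  have h2 := integral_comp_mul_left_Ioi g 0 (show 0 < 2 / x by positivity)
  rw [mul_zero, h1] at h2
  have h3 : ∀ u ∈ Ioi (0 : ℝ), g (2 / x * u) = ((2 / x : ℝ) : ℂ) ^ (β - 1) *
      ((u : ℂ) ^ (β - 1) * (Real.exp (-(u + x ^ 2 / 4 / u)) : ℝ)) := fun u hu => by
    simp only [hg]
    rw [Complex.ofReal_mul, Complex.mul_cpow_ofReal_nonneg (by positivity) (le_of_lt hu), mul_assoc]
    have : u ≠ 0 := ne_of_gt hu
    congr 5
    field_simp
    ring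
  rw [setIntegral_congr_fun measurableSet_Ioi h3, integral_const_mul] at h2
  have hne : ((2 / x : ℝ) : ℂ) ≠ 0 := by
    rw [Complex.ofReal_ne_zero]; positivity
  rw [Complex.cpow_sub _ _ hne, Complex.cpow_one] at h2
  rw [mul_assoc, mul_comm (_ ^ β)]
  rw [div_mul_eq_mul_div, Complex.real_smul, Complex.ofReal_inv] at h2
  generalize ∫ u in Ioi (0 : ℝ), (u : ℂ) ^ (β - 1) * (Real.exp (-(u + x ^ 2 / 4 / u)) : ℝ) = I at *
  field_simp at h2 ⊢
  linear_combination -h2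

/-! ### The regularized hypergeometric series -/

/-- The series `∑ (D)_m (B)_m z^m / (m! Γ(γ + 1 + m))`. -/
def hyp (γ : ℝ) (D B : ℂ) (z : ℝ) : ℂ :=
  ∑' m : ℕ, rising D m * rising B m * invGamma γ m / m.factorial * (z : ℂ) ^ m

/-- A single term is at most the sum of the negative binomial series. -/
lemma choose_mul_pow_le {τ : ℝ} (h0 : 0 < τ) (h1 : τ < 1) (N m : ℕ) :
    ((m + N).choose N : ℝ) * τ ^ m ≤ (1 / (1 - τ)) ^ (N + 1) := by
  have hτ : ‖τ‖ < 1 := by rwa [Real.norm_of_nonneg h0.le]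
  have h := hasSum_choose_mul_geometric_of_norm_lt_one N hτ
  rw [one_div_pow]
  exact le_hasSum h m fun _ _ => by positivity

/-- Bernoulli's inequality gives `z ≤ τ⁴` for `τ = (3 + z)/4`. Of the four factors `τ^m`, two pay
for the binomials bounding the rising factorials, one for `m! / |Γ(m+γ+1)|`, and the last is the
geometric majorant. The dependence on the size of the parameters is only exponential in `N`. -/
lemma exists_hyp_term_bound {γ : ℝ} (h : NotNegInt γ) {z : ℝ} (hz0 : 0 ≤ z) (hz1 : z < 1) :
    ∃ C > 0, ∃ L > 1, ∃ τ : ℝ, 0 < τ ∧ τ < 1 ∧ ∀ (N : ℕ) (D B : ℂ), ‖D‖ ≤ N + 1 → ‖B‖ ≤ N + 1 →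
      ∀ m : ℕ, ‖rising D m‖ * ‖rising B m‖ * |invGamma γ m| / m.factorial * z ^ m ≤
        C * L ^ (N + 1) * τ ^ m := by
  set τ : ℝ := (3 + z) / 4 with hτ
  have h0 : 0 < τ := by rw [hτ]; positivity
  have h1 : τ < 1 := by rw [hτ]; linarith
  have hzτ : z ≤ τ ^ 4 := by
    have := one_add_mul_le_pow (a := (z - 1) / 4) (by linarith) 4
    have e : 1 + (z - 1) / 4 = τ := by rw [hτ]; ring
    rw [e] at this
    push_cast at this; linarith
  obtain ⟨C, hC, hb⟩ := exists_factorial_mul_invGamma_le h (one_lt_one_div h0 h1)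
  have hL : 1 < 1 / (1 - τ) := one_lt_one_div (by linarith) (by linarith)
  refine ⟨C, hC, (1 / (1 - τ)) ^ 2, one_lt_pow₀ hL two_ne_zero, τ, h0, h1,
    fun N D B hD hB m => ?_⟩
  have e1 := norm_rising_le_choose hD m
  have e2 := norm_rising_le_choose hB m
  have e3 := choose_mul_pow_le h0 h1 N m
  have e4 : m.factorial * |invGamma γ m| * τ ^ m ≤ C := by
    have := hb m
    rw [one_div_pow, ← div_eq_mul_one_div, le_div_iff₀ (by positivity)] at this
    exact this
  have hf : (m.factorial : ℝ) ≠ 0 := by positivity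
  calc ‖rising D m‖ * ‖rising B m‖ * |invGamma γ m| / m.factorial * z ^ m
      ≤ (m.factorial * (m + N).choose N) * (m.factorial * (m + N).choose N) * |invGamma γ m| /
        m.factorial * (τ ^ 4) ^ m := by gcongr
    _ = ((m + N).choose N * τ ^ m) * ((m + N).choose N * τ ^ m) *
        (m.factorial * |invGamma γ m| * τ ^ m) * τ ^ m := by
      rw [← pow_mul, show 4 * m = m + m + m + m by ring, pow_add, pow_add, pow_add]
      field_simp
    _ ≤ (1 / (1 - τ)) ^ (N + 1) * (1 / (1 - τ)) ^ (N + 1) * C * τ ^ m := by gcongr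
    _ = _ := by ring

lemma norm_hyp_term (γ : ℝ) (D B : ℂ) {z : ℝ} (hz : 0 ≤ z) (m : ℕ) :
    ‖rising D m * rising B m * invGamma γ m / m.factorial * (z : ℂ) ^ m‖ =
      ‖rising D m‖ * ‖rising B m‖ * |invGamma γ m| / m.factorial * z ^ m := by
  rw [norm_mul, norm_div, norm_mul, norm_mul, norm_pow, Complex.norm_natCast, Complex.norm_real,
    Complex.norm_real, Real.norm_eq_abs, Real.norm_of_nonneg hz]

lemma exists_nat_norm_le_add_one (D B : ℂ) : ∃ N : ℕ, ‖D‖ ≤ N + 1 ∧ ‖B‖ ≤ N + 1 := by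
  obtain ⟨N, hN⟩ := exists_nat_ge (max ‖D‖ ‖B‖)
  exact ⟨N, by linarith [le_max_left ‖D‖ ‖B‖], by linarith [le_max_right ‖D‖ ‖B‖]⟩

lemma summable_norm_hyp {γ : ℝ} (h : NotNegInt γ) {z : ℝ} (hz0 : 0 ≤ z) (hz1 : z < 1) (D B : ℂ) :
    Summable fun m : ℕ =>
      ‖rising D m‖ * ‖rising B m‖ * |invGamma γ m| / m.factorial * z ^ m := by
  obtain ⟨C, _, L, _, τ, h0, h1, hb⟩ := exists_hyp_term_bound h hz0 hz1
  obtain ⟨N, hD, hB⟩ := exists_nat_norm_le_add_one D B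
  exact .of_nonneg_of_le (fun m => by positivity) (hb N D B hD hB)
    ((summable_geometric_of_lt_one h0.le h1).mul_left _)

lemma exists_norm_hyp_le {γ : ℝ} (h : NotNegInt γ) {z : ℝ} (hz0 : 0 ≤ z) (hz1 : z < 1) :
    ∃ C > 0, ∃ L > 1, ∀ (N : ℕ) (D B : ℂ), ‖D‖ ≤ N + 1 → ‖B‖ ≤ N + 1 →
      ‖hyp γ D B z‖ ≤ C * L ^ (N + 1) := by
  obtain ⟨C, hC, L, hL, τ, h0, h1, hb⟩ := exists_hyp_term_bound h hz0 hz1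
  refine ⟨C * (1 - τ)⁻¹, mul_pos hC (inv_pos.2 (by linarith)), L, hL, fun N D B hD hB => ?_⟩
  have hg := (hasSum_geometric_of_lt_one h0.le h1).mul_left (C * L ^ (N + 1))
  refine (tsum_of_norm_bounded hg fun m => ?_).trans (le_of_eq (by ring))
  rw [norm_hyp_term γ D B hz0]
  exact hb N D B hD hB m

lemma differentiable_hyp {γ : ℝ} (h : NotNegInt γ) {z : ℝ} (hz0 : 0 ≤ z) (hz1 : z < 1)
    {D B : ℂ → ℂ} (hD : Differentiable ℂ D) (hB : Differentiable ℂ B) :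
    Differentiable ℂ fun s => hyp γ (D s) (B s) z := by
  intro s₀
  obtain ⟨C, hC, L, hL, τ, h0, h1, hb⟩ := exists_hyp_term_bound h hz0 hz1
  obtain ⟨N, hN1, hN2⟩ := exists_nat_norm_le_add_one (‖D s₀‖ + 1 : ℝ) (‖B s₀‖ + 1 : ℝ)
  rw [Complex.norm_real, Real.norm_of_nonneg (by positivity)] at hN1 hN2
  have hU : IsOpen {s | ‖D s‖ < N + 1 ∧ ‖B s‖ < N + 1} :=
    (isOpen_lt hD.continuous.norm continuous_const).inter
      (isOpen_lt hB.continuous.norm continuous_const)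
  have key := Complex.differentiableOn_tsum_of_summable_norm
    (F := fun (m : ℕ) s =>
      rising (D s) m * rising (B s) m * invGamma γ m / m.factorial * (z : ℂ) ^ m)
    ((summable_geometric_of_lt_one h0.le h1).mul_left (C * L ^ (N + 1)))
    (fun m => ?_) hU (fun m s hs => ?_)
  · exact (key s₀ ⟨by linarith, by linarith⟩).differentiableAt
      (hU.mem_nhds ⟨by linarith, by linarith⟩)
  · have h1 := (differentiable_rising m).comp hD
    have h2 := (differentiable_rising m).comp hB
    exact ((((h1.mul h2).mul_const _).div_const _).mul_const _).differentiableOn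
  · rw [norm_hyp_term γ _ _ hz0]
    exact hb N _ _ hs.1.le hs.2.le m

lemma hyp_comm (γ : ℝ) (D B : ℂ) (z : ℝ) : hyp γ D B z = hyp γ B D z := by
  unfold hyp
  simp_rw [mul_comm (rising D _)]

lemma conj_hyp (γ : ℝ) (D B : ℂ) (z : ℝ) : conj (hyp γ D B z) = hyp γ (conj D) (conj B) z := by
  unfold hyp
  rw [Complex.conj_tsum]
  refine tsum_congr fun m => ?_
  simp [conj_rising]

/-! ### Mellin transforms -/

lemma integrableOn_cpow_mul_exp_neg {z : ℂ} (hz : 0 < z.re) {ρ : ℝ} (hρ : 0 < ρ) :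
    IntegrableOn (fun u : ℝ => (u : ℂ) ^ (z - 1) * (Real.exp (-(ρ * u)) : ℝ)) (Ioi 0) := by
  have h := integrableOn_rpow_mul_exp_neg_mul_rpow (s := z.re - 1) (p := 1) (b := ρ)
    (by linarith) one_pos hρ
  refine Integrable.mono' h ?_ ?_
  · refine ContinuousOn.aestronglyMeasurable (fun u hu => ?_) measurableSet_Ioi
    exact ((Complex.continuousAt_ofReal_cpow_const u _ (Or.inr (ne_of_gt hu))).mul
      (by fun_prop)).continuousWithinAt
  · filter_upwards [ae_restrict_mem measurableSet_Ioi] with u hu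
    rw [norm_mul, Complex.norm_cpow_eq_rpow_re_of_pos hu, Complex.norm_real,
      Real.norm_of_nonneg (Real.exp_pos _).le, Real.rpow_one, neg_mul]
    simp

lemma Real_Gamma_add_nat {x : ℝ} (hx : 0 < x) (m : ℕ) :
    Real.Gamma (x + m) = ‖rising (x : ℂ) m‖ * Real.Gamma x := by
  have h := congrArg norm (Gamma_add_nat (z := (x : ℂ)) (by simpa using hx) m)
  rw [norm_mul, ← Complex.ofReal_natCast, ← Complex.ofReal_add, Complex.Gamma_ofReal,
    Complex.Gamma_ofReal, Complex.norm_real, Complex.norm_real,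
    Real.norm_of_nonneg (Real.Gamma_pos_of_pos (by positivity)).le,
    Real.norm_of_nonneg (Real.Gamma_pos_of_pos hx).le] at h
  exact h

lemma integral_cpow_exp_tsum {B : ℂ} (hB : 0 < B.re) {ρ : ℝ} (hρ : 0 < ρ) {d : ℕ → ℂ}
    (hd : Summable fun m : ℕ => ‖d m‖ * ‖rising (B.re : ℂ) m‖ / ρ ^ m) :
    ∫ u in Ioi (0 : ℝ), (u : ℂ) ^ (B - 1) * (Real.exp (-(ρ * u)) : ℝ) * ∑' m, d m * (u : ℂ) ^ m =
      Complex.Gamma B * (1 / ρ : ℂ) ^ B * ∑' m, d m * rising B m / (ρ : ℂ) ^ m := by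
  have hBm : ∀ m : ℕ, 0 < (B + m).re := fun m => by
    rw [Complex.add_re, Complex.natCast_re]; positivity
  have hF : ∀ m : ℕ, ∀ u ∈ Ioi (0 : ℝ),
      (u : ℂ) ^ (B - 1) * (Real.exp (-(ρ * u)) : ℝ) * (d m * (u : ℂ) ^ m) =
      d m * ((u : ℂ) ^ (B + m - 1) * (Real.exp (-(ρ * u)) : ℝ)) := fun m u hu => by
    rw [show B + m - 1 = B - 1 + m by ring,
      Complex.cpow_add _ _ (Complex.ofReal_ne_zero.2 (ne_of_gt hu)), Complex.cpow_natCast]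
    ring
  have hint : ∀ m : ℕ, IntegrableOn (fun u : ℝ =>
      (u : ℂ) ^ (B - 1) * (Real.exp (-(ρ * u)) : ℝ) * (d m * (u : ℂ) ^ m)) (Ioi 0) := fun m =>
    ((integrableOn_cpow_mul_exp_neg (hBm m) hρ).const_mul (d m)).congr
      ((ae_restrict_mem measurableSet_Ioi).mono fun u hu => (hF m u hu).symm)
  have hnorm : ∀ m : ℕ, ∫ u in Ioi (0 : ℝ),
      ‖(u : ℂ) ^ (B - 1) * (Real.exp (-(ρ * u)) : ℝ) * (d m * (u : ℂ) ^ m)‖ =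
      ((1 / ρ) ^ B.re * Real.Gamma B.re) * (‖d m‖ * ‖rising (B.re : ℂ) m‖ / ρ ^ m) := fun m => by
    have h1 : ∀ u ∈ Ioi (0 : ℝ),
        ‖(u : ℂ) ^ (B - 1) * (Real.exp (-(ρ * u)) : ℝ) * (d m * (u : ℂ) ^ m)‖ =
        ‖d m‖ * (u ^ (B.re + m - 1) * Real.exp (-(ρ * u))) := fun u hu => by
      rw [hF m u hu, norm_mul, norm_mul, Complex.norm_cpow_eq_rpow_re_of_pos hu,
        Complex.norm_real, Real.norm_of_nonneg (Real.exp_pos _).le]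
      simp
    rw [setIntegral_congr_fun measurableSet_Ioi h1, integral_const_mul,
      Real.integral_rpow_mul_exp_neg_mul_Ioi (by positivity) hρ, Real_Gamma_add_nat hB,
      Real.rpow_add (by positivity), Real.rpow_natCast, one_div_pow]
    ring
  have key := hasSum_integral_of_summable_integral_norm hint
    (by simp_rw [hnorm]; exact hd.mul_left _)
  have e1 : ∀ u : ℝ, ∑' m, (u : ℂ) ^ (B - 1) * (Real.exp (-(ρ * u)) : ℝ) * (d m * (u : ℂ) ^ m) =
      (u : ℂ) ^ (B - 1) * (Real.exp (-(ρ * u)) : ℝ) * ∑' m, d m * (u : ℂ) ^ m := fun u =>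
    tsum_mul_left
  simp_rw [e1] at key
  rw [← key.tsum_eq, ← tsum_mul_left]
  refine tsum_congr fun m => ?_
  have hρ' : (1 / ρ : ℂ) ≠ 0 := one_div_ne_zero (Complex.ofReal_ne_zero.2 hρ.ne')
  have h2 := Complex.integral_cpow_mul_exp_neg_mul_Ioi (hBm m) hρ
  rw [setIntegral_congr_fun measurableSet_Ioi (hF m), integral_const_mul]
  have h3 : ∫ u in Ioi (0 : ℝ), (u : ℂ) ^ (B + m - 1) * (Real.exp (-(ρ * u)) : ℝ) =
      (1 / ρ : ℂ) ^ (B + m) * Complex.Gamma (B + m) := by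
    rw [← h2]; push_cast; rfl
  rw [h3, Gamma_add_nat hB, Complex.cpow_add _ _ hρ', Complex.cpow_natCast, one_div_pow]
  ring

/-- Termwise integration gives the confluent series at `-l/p`. Kummer's transformation pulls out the
factor `exp(-l/p)`, without which the later termwise integration need not converge absolutely. -/
lemma integral_cpow_cliff_exp {γ : ℝ} (h : NotNegInt γ) {A : ℂ} (hA : 0 < A.re) (l : ℝ) {p : ℝ}
    (hp : 0 < p) :
    ∫ w in Ioi (0 : ℝ), (w : ℂ) ^ (A - 1) * (Real.exp (-(p * w)) : ℝ) * (cliff γ (l * w) : ℂ) =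
      Complex.Gamma A * (1 / p : ℂ) ^ A * (Complex.exp (-(l / p)) *
        ∑' m : ℕ, rising (γ + 1 - A) m * invGamma γ m / m.factorial * (l / p : ℂ) ^ m) := by
  have hs := summable_rising_div_factorial h (A.re : ℂ) (l / p)
  have h1 : ∀ w : ℝ, (cliff γ (l * w) : ℂ) =
      ∑' m : ℕ, ((invGamma γ m : ℂ) / m.factorial * (-l) ^ m) * (w : ℂ) ^ m := fun w => by
    rw [cliff, Complex.ofReal_tsum]
    refine tsum_congr fun m => ?_
    push_cast
    rw [neg_pow (l : ℂ), mul_pow]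
    ring
  simp_rw [h1]
  rw [integral_cpow_exp_tsum hA hp, ← kummer_transformation h A]
  · congr 1
    refine tsum_congr fun m => ?_
    rw [← neg_div, div_pow]
    ring
  · refine hs.congr fun m => ?_
    simp only [norm_mul, norm_div, norm_pow, norm_neg, Complex.norm_real, Real.norm_of_nonneg hp.le]
    rw [div_pow]
    ring

/-- The integral over the first variable is `(u/p)^X Γ(X)`, leaving the Gamma integral at `X + y` in
the second. -/
lemma integrable_cpow_mul_exp_prod {X y p : ℝ} (hX : 0 < X) (hXy : 0 < X + y) (hp : 0 < p) :
    Integrable (fun z : ℝ × ℝ => z.1 ^ (X - 1) * z.2 ^ (y - 1) *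
      Real.exp (-(z.2 + p * z.1 / z.2)))
      ((volume.restrict (Ioi 0)).prod (volume.restrict (Ioi 0))) := by
  have hmeas : AEStronglyMeasurable (fun z : ℝ × ℝ => z.1 ^ (X - 1) * z.2 ^ (y - 1) *
      Real.exp (-(z.2 + p * z.1 / z.2)))
      ((volume.restrict (Ioi 0)).prod (volume.restrict (Ioi 0))) := by
    refine Measurable.aestronglyMeasurable ?_
    fun_prop
  have hE : ∀ u ∈ Ioi (0 : ℝ), ∀ w : ℝ,
      w ^ (X - 1) * u ^ (y - 1) * Real.exp (-(u + p * w / u)) =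
      (u ^ (y - 1) * Real.exp (-u)) * (w ^ (X - 1) * Real.exp (-(p / u * w))) := fun u hu w => by
    rw [neg_add, Real.exp_add, div_mul_eq_mul_div]; ring
  have hinner : ∀ u ∈ Ioi (0 : ℝ),
      IntegrableOn (fun w : ℝ => w ^ (X - 1) * Real.exp (-(p / u * w))) (Ioi 0) := fun u hu => by
    have := integrableOn_rpow_mul_exp_neg_mul_rpow (s := X - 1) (p := 1) (b := p / u)
      (by linarith) one_pos (div_pos hp hu)
    simpa only [Real.rpow_one, neg_mul] using this
  rw [integrable_prod_iff' hmeas]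
  constructor
  · filter_upwards [ae_restrict_mem measurableSet_Ioi] with u hu
    simp_rw [hE u hu]
    exact (hinner u hu).const_mul _
  · have h3 := (Real.GammaIntegral_convergent hXy).const_mul ((1 / p) ^ X * Real.Gamma X)
    refine h3.congr ?_
    filter_upwards [ae_restrict_mem measurableSet_Ioi] with u hu
    have hu' : (0 : ℝ) < u := hu
    have h4 : ∀ w ∈ Ioi (0 : ℝ), ‖w ^ (X - 1) * u ^ (y - 1) * Real.exp (-(u + p * w / u))‖ =
        (u ^ (y - 1) * Real.exp (-u)) * (w ^ (X - 1) * Real.exp (-(p / u * w))) := fun w hw => by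
      rw [← hE u hu, Real.norm_of_nonneg]
      have : (0 : ℝ) < w := hw
      positivity
    rw [setIntegral_congr_fun measurableSet_Ioi h4, integral_const_mul,
      Real.integral_rpow_mul_exp_neg_mul_Ioi hX (div_pos hp hu'), one_div_div,
      div_eq_mul_one_div u p, Real.mul_rpow hu'.le (by positivity),
      show X + y - 1 = X + (y - 1) by ring, Real.rpow_add hu']
    ring

/-- Since `cliff` grows at most polynomially, two integrals of the preceding type dominate, with
exponents `Re A` and `Re A + M`. -/
lemma integrable_cliff_kernel {γ : ℝ} (h : NotNegInt γ) {A β : ℂ} (hA : 0 < A.re)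
    (hB : 0 < (A + β).re) {l p : ℝ} (hl : 0 ≤ l) (hp : 0 < p) :
    Integrable (fun z : ℝ × ℝ => (z.1 : ℂ) ^ (A - 1) * (cliff γ (l * z.1) : ℂ) *
      ((z.2 : ℂ) ^ (β - 1) * (Real.exp (-(z.2 + p * z.1 / z.2)) : ℝ)))
      ((volume.restrict (Ioi 0)).prod (volume.restrict (Ioi 0))) := by
  obtain ⟨C, hC, M, hb⟩ := exists_cliff_bound h
  rw [Complex.add_re] at hB
  have i1 := integrable_cpow_mul_exp_prod hA hB hp
  have i2 := integrable_cpow_mul_exp_prod (X := A.re + M) (y := β.re) (by positivity)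
    (by have : (0 : ℝ) ≤ M := M.cast_nonneg
        linarith) hp
  refine Integrable.mono' ((i1.add (i2.const_mul (l ^ M))).const_mul (C * 2 ^ M)) ?_ ?_
  · have := (continuous_cliff h).measurable
    refine Measurable.aestronglyMeasurable ?_
    fun_prop
  · rw [Measure.prod_restrict]
    filter_upwards [ae_restrict_mem (measurableSet_Ioi.prod measurableSet_Ioi)] with z hz
    obtain ⟨w, u⟩ := z
    have hw : (0 : ℝ) < w := hz.1
    have hu : (0 : ℝ) < u := hz.2
    simp only [norm_mul, Complex.norm_cpow_eq_rpow_re_of_pos hw,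
      Complex.norm_cpow_eq_rpow_re_of_pos hu, Complex.norm_real, Complex.sub_re, Complex.one_re,
      Real.norm_eq_abs, Real.abs_exp, Pi.add_apply]
    have h1 : |cliff γ (l * w)| ≤ C * (2 ^ M * (1 + l ^ M * w ^ M)) := by
      refine (hb _ (by positivity)).trans ?_
      gcongr
      have := add_pow_le (zero_le_one) (by positivity : 0 ≤ l * w) M
      rw [one_pow, mul_pow] at this
      refine this.trans ?_
      gcongr
      · norm_num
      · omega
    rw [show A.re + M - 1 = A.re - 1 + M by ring, Real.rpow_add hw, Real.rpow_natCast]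
    calc w ^ (A.re - 1) * |cliff γ (l * w)| *
          (u ^ (β.re - 1) * Real.exp (-(u + p * w / u)))
        ≤ w ^ (A.re - 1) * (C * (2 ^ M * (1 + l ^ M * w ^ M))) *
          (u ^ (β.re - 1) * Real.exp (-(u + p * w / u))) := by gcongr
      _ = _ := by ring

/-- After interchanging the integrals, the exponential from Kummer's transformation joins `exp(-u)`
to form `exp(-(1 + l/p)u)`. The outer integral then produces a Gauss series at `(l/p)/(1 + l/p) <
1`, whereas direct expansion would land at `-l/p`, possibly outside the unit disc. -/
lemma mellin_cliff_mul_integral {γ : ℝ} (h : NotNegInt γ) {A β : ℂ} (hA : 0 < A.re)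
    (hB : 0 < (A + β).re) {l p : ℝ} (hl : 0 ≤ l) (hp : 0 < p) :
    mellin (fun w => (cliff γ (l * w) : ℂ) * ∫ u in Ioi (0 : ℝ),
      (u : ℂ) ^ (β - 1) * (Real.exp (-(u + p * w / u)) : ℝ)) A =
    Complex.Gamma A * Complex.Gamma (A + β) * (1 / p : ℂ) ^ A *
      (1 / ((1 + l / p : ℝ) : ℂ)) ^ (A + β) * hyp γ (γ + 1 - A) (A + β) (l / p / (1 + l / p)) := by
  have hκ : 0 ≤ l / p := by positivity
  have hρ : 0 < 1 + l / p := by positivity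
  have e1 : ∀ w : ℝ, (w : ℂ) ^ (A - 1) • ((cliff γ (l * w) : ℂ) * ∫ u in Ioi (0 : ℝ),
      (u : ℂ) ^ (β - 1) * (Real.exp (-(u + p * w / u)) : ℝ)) =
      ∫ u in Ioi (0 : ℝ), (w : ℂ) ^ (A - 1) * (cliff γ (l * w) : ℂ) *
        ((u : ℂ) ^ (β - 1) * (Real.exp (-(u + p * w / u)) : ℝ)) := fun w => by
    rw [integral_const_mul, smul_eq_mul, mul_assoc]
  simp_rw [mellin, e1]
  rw [integral_integral_swap (integrable_cliff_kernel h hA hB hl hp)]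
  have e2 : ∀ u ∈ Ioi (0 : ℝ), ∫ w in Ioi (0 : ℝ), (w : ℂ) ^ (A - 1) * (cliff γ (l * w) : ℂ) *
        ((u : ℂ) ^ (β - 1) * (Real.exp (-(u + p * w / u)) : ℝ)) =
      (Complex.Gamma A * (1 / p : ℂ) ^ A) * ((u : ℂ) ^ (A + β - 1) *
        (Real.exp (-((1 + l / p) * u)) : ℝ) *
        ∑' m : ℕ, (rising (γ + 1 - A) m * invGamma γ m / m.factorial * (l / p : ℂ) ^ m) *
          (u : ℂ) ^ m) := fun u hu => by
    have hu' : (0 : ℝ) < u := hu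
    have h1 : ∀ w : ℝ, (w : ℂ) ^ (A - 1) * (cliff γ (l * w) : ℂ) *
        ((u : ℂ) ^ (β - 1) * (Real.exp (-(u + p * w / u)) : ℝ)) =
        ((u : ℂ) ^ (β - 1) * (Real.exp (-u) : ℝ)) * ((w : ℂ) ^ (A - 1) *
          (Real.exp (-(p / u * w)) : ℝ) * (cliff γ (l * w) : ℂ)) := fun w => by
      rw [neg_add, Real.exp_add, div_mul_eq_mul_div]; push_cast; ring
    simp_rw [h1]
    rw [integral_const_mul, integral_cpow_cliff_exp h hA l (div_pos hp hu')]
    have hu0 : (u : ℂ) ≠ 0 := Complex.ofReal_ne_zero.2 hu'.ne'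
    have h2 : (1 / ((p / u : ℝ) : ℂ)) ^ A = (1 / p : ℂ) ^ A * (u : ℂ) ^ A := by
      rw [show (1 / ((p / u : ℝ) : ℂ)) = ((1 / p : ℝ) : ℂ) * (u : ℂ) by push_cast; field_simp,
        Complex.mul_cpow_ofReal_nonneg (by positivity) hu'.le]
      push_cast; rfl
    have h3 : (u : ℂ) ^ (A + β - 1) = (u : ℂ) ^ A * (u : ℂ) ^ (β - 1) := by
      rw [← Complex.cpow_add _ _ hu0]; ring_nf
    have h4 : ((Real.exp (-((1 + l / p) * u)) : ℝ) : ℂ) =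
        (Real.exp (-u) : ℝ) * Complex.exp (-(l / ((p / u : ℝ) : ℂ))) := by
      push_cast
      rw [← Complex.exp_add]
      congr 1
      have : (p : ℂ) ≠ 0 := Complex.ofReal_ne_zero.2 hp.ne'
      field_simp
      ring
    have h5 : ∀ m : ℕ, (l / ((p / u : ℝ) : ℂ)) ^ m = (l / p : ℂ) ^ m * (u : ℂ) ^ m := fun m => by
      rw [← mul_pow]; congr 1; push_cast; field_simp
    simp_rw [h5]
    rw [h2, h3, h4]
    simp_rw [mul_assoc]
    ring
  rw [setIntegral_congr_fun measurableSet_Ioi e2, integral_const_mul,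
    integral_cpow_exp_tsum hB hρ]
  · unfold hyp
    rw [show ∀ a b c d e : ℂ, a * b * c * d * e = a * c * (b * d * e) from fun _ _ _ _ _ => by ring]
    congr 2
    refine tsum_congr fun m => ?_
    push_cast
    rw [div_pow (l / p : ℂ)]
    ring
  · have hz1 : l / p / (1 + l / p) < 1 := by rw [div_lt_one hρ]; linarith
    refine (summable_norm_hyp h (by positivity) hz1 (γ + 1 - A)
      (((A + β).re : ℝ) : ℂ)).congr fun m => ?_
    simp only [norm_mul, norm_div, norm_pow, Complex.norm_real, Complex.norm_natCast,
      Real.norm_of_nonneg hp.le, Real.norm_of_nonneg hl, Real.norm_eq_abs]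
    rw [div_pow (l / p)]
    ring

/-- The Mellin transform of `H_α(a r) K_β(b r)` for `a² + b² = 1`. -/
theorem mellin_besselH_mul_besselK {α : ℝ} (h : NotNegInt α) {β s : ℂ} {a b : ℝ} (ha : 0 < a)
    (hb : 0 < b) (hab : a ^ 2 + b ^ 2 = 1) (hA : 0 < ((α - β + 1 / 2 + s) / 2).re)
    (hB : 0 < ((α + β + 1 / 2 + s) / 2).re) :
    mellin (fun r => (besselH α (a * r) : ℂ) * besselK β (b * r)) s =
      2 ^ (s - 3 / 2) * (a : ℂ) ^ (α + 1 / 2 : ℂ) * (b : ℂ) ^ β *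
        Complex.Gamma ((α + β + 1 / 2 + s) / 2) * Complex.Gamma ((α - β + 1 / 2 + s) / 2) *
        hyp α ((α + β + 1 / 2 + (1 - s)) / 2) ((α + β + 1 / 2 + s) / 2) (a ^ 2) := by
  set A := (α - β + 1 / 2 + s) / 2 with hAdef
  have hAB : A + β = (α + β + 1 / 2 + s) / 2 := by rw [hAdef]; ring
  rw [← hAB] at hB ⊢
  set φ : ℝ → ℂ := fun w => (cliff α (a ^ 2 / 4 * w) : ℂ) * ∫ u in Ioi (0 : ℝ),
      (u : ℂ) ^ (β - 1) * (Real.exp (-(u + b ^ 2 / 4 * w / u)) : ℝ) with hφ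
  -- Substitution `w = r²`. The powers of `r` split off from the two Bessel functions turn the
  -- exponent `s` into `2A`.
  have h1 : mellin (fun r => (besselH α (a * r) : ℂ) * besselK β (b * r)) s =
      ((a : ℂ) ^ (α + 1 / 2 : ℂ) * 2 ^ (-α : ℂ) * (1 / 2) * 2 ^ β * (b : ℂ) ^ (-β)) *
      mellin (fun r => φ (r ^ (2 : ℝ))) (2 * A) := by
    simp_rw [mellin]
    rw [← integral_const_mul]
    refine setIntegral_congr_fun measurableSet_Ioi fun r hr => ?_
    have hr' : (0 : ℝ) < r := hr
    have hr0 : (r : ℂ) ≠ 0 := Complex.ofReal_ne_zero.2 hr'.ne'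
    have ha0 : (a : ℂ) ≠ 0 := Complex.ofReal_ne_zero.2 ha.ne'
    have hr2 : r ^ (2 : ℝ) = r ^ 2 := by norm_cast
    simp only [smul_eq_mul, hφ, hr2]
    rw [besselK_eq_integral β (by positivity : 0 < b * r), besselH,
      besselJ_eq_cliff α (by positivity : 0 < a * r),
      show (a * r) ^ 2 / 4 = a ^ 2 / 4 * r ^ 2 by ring]
    have e1 : ∀ u : ℝ, (b * r) ^ 2 / 4 / u = b ^ 2 / 4 * r ^ 2 / u := fun u => by ring
    simp_rw [e1]
    have e2 : (((2 / (b * r) : ℝ)) : ℂ) ^ β = 2 ^ β * (b : ℂ) ^ (-β) * (r : ℂ) ^ (-β) := by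
      rw [show 2 / (b * r) = 2 * (b⁻¹ * r⁻¹) by field_simp, Complex.ofReal_mul,
        Complex.mul_cpow_ofReal_nonneg zero_le_two (by positivity), Complex.ofReal_mul,
        Complex.mul_cpow_ofReal_nonneg (by positivity) (by positivity), Complex.ofReal_inv,
        Complex.ofReal_inv, Complex.inv_cpow _ _ (by
          rw [Complex.arg_ofReal_of_nonneg hb.le]; exact Real.pi_pos.ne),
        Complex.inv_cpow _ _ (by
          rw [Complex.arg_ofReal_of_nonneg hr'.le]; exact Real.pi_pos.ne),
        Complex.cpow_neg, Complex.cpow_neg]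
      push_cast
      ring
    have e3 : (((a * r) ^ (1 / 2 : ℝ) * ((a * r / 2) ^ α * cliff α (a ^ 2 / 4 * r ^ 2)) : ℝ) : ℂ) =
        (a : ℂ) ^ (α + 1 / 2 : ℂ) * 2 ^ (-α : ℂ) * ((r : ℂ) ^ (α : ℂ) * (r : ℂ) ^ (1 / 2 : ℂ)) *
          cliff α (a ^ 2 / 4 * r ^ 2) := by
      rw [Real.div_rpow (by positivity) zero_le_two, div_eq_mul_inv (_ ^ α),
        ← Real.rpow_neg zero_le_two, Real.mul_rpow ha.le hr'.le, Real.mul_rpow ha.le hr'.le, Complex.cpow_add _ _ ha0]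
      push_cast [Complex.ofReal_cpow ha.le, Complex.ofReal_cpow hr'.le,
        Complex.ofReal_cpow zero_le_two]
      ring
    have e4 : (r : ℂ) ^ (2 * A - 1) = (r : ℂ) ^ (s - 1) * (r : ℂ) ^ (α : ℂ) *
        (r : ℂ) ^ (1 / 2 : ℂ) * (r : ℂ) ^ (-β) := by
      rw [← Complex.cpow_add _ _ hr0, ← Complex.cpow_add _ _ hr0, ← Complex.cpow_add _ _ hr0,
        hAdef]
      congr 1; ring
    rw [e2, e3, e4]
    ring
  rw [h1, mellin_comp_rpow, show (2 * A) / ((2 : ℝ) : ℂ) = A by push_cast; ring,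
    mellin_cliff_mul_integral h hA hB (by positivity) (by positivity)]
  have hb0 : (b : ℂ) ≠ 0 := Complex.ofReal_ne_zero.2 hb.ne'
  -- On the unit circle the variable of the Gauss series simplifies to `a²`.
  have hρ : 1 + a ^ 2 / 4 / (b ^ 2 / 4) = (b ^ 2)⁻¹ := by
    field_simp; linarith
  have hz : a ^ 2 / 4 / (b ^ 2 / 4) / (b ^ 2)⁻¹ = a ^ 2 := by field_simp
  rw [hρ, hz]
  have hbp : ∀ z : ℂ, ((b ^ 2 : ℝ) : ℂ) ^ z = (b : ℂ) ^ (2 * z) := fun z => by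
    rw [mul_comm, Complex.cpow_mul_ofNat, Complex.ofReal_pow, sq, sq, ← Complex.ofReal_mul,
      Complex.ofReal_mul, Complex.mul_cpow_ofReal_nonneg hb.le hb.le]
  have e5 : (1 / (((b ^ 2)⁻¹ : ℝ) : ℂ)) ^ (A + β) = (b : ℂ) ^ (2 * (A + β)) := by
    rw [← hbp]; push_cast; rw [one_div, inv_inv]
  have e6 : (1 / ((b ^ 2 / 4 : ℝ) : ℂ)) ^ A = 2 ^ (2 * A) * (b : ℂ) ^ (-(2 * A)) := by
    rw [show (1 / ((b ^ 2 / 4 : ℝ) : ℂ)) = ((4 : ℝ) : ℂ) * (((b ^ 2)⁻¹ : ℝ) : ℂ) by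
        push_cast; field_simp,
      Complex.mul_cpow_ofReal_nonneg (by norm_num) (by positivity), Complex.ofReal_inv,
      Complex.inv_cpow _ _ (by
          rw [Complex.arg_ofReal_of_nonneg (by positivity)]; exact Real.pi_pos.ne), hbp,
      Complex.cpow_neg]
    congr 1
    rw [mul_comm 2 A, Complex.cpow_mul_ofNat, show ((4 : ℝ) : ℂ) = ((2 : ℝ) : ℂ) * ((2 : ℝ) : ℂ) by
      push_cast; norm_num, Complex.mul_cpow_ofReal_nonneg zero_le_two zero_le_two, sq]
    push_cast; rfl
  have e7 : (b : ℂ) ^ β = (b : ℂ) ^ (-β) * (b : ℂ) ^ (-(2 * A)) * (b : ℂ) ^ (2 * (A + β)) := by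
    rw [← Complex.cpow_add _ _ hb0, ← Complex.cpow_add _ _ hb0]; congr 1; ring
  have e8 : (2 : ℂ) ^ (s - 3 / 2) = 2 ^ (-α : ℂ) * (1 / 2) * 2 ^ β * 2⁻¹ * 2 ^ (2 * A) := by
    have h2 : (1 / 2 : ℂ) = 2 ^ (-1 : ℂ) := by rw [Complex.cpow_neg_one, one_div]
    have h2' : (2⁻¹ : ℂ) = 2 ^ (-1 : ℂ) := by rw [Complex.cpow_neg_one]
    rw [h2, h2', ← Complex.cpow_add _ _ two_ne_zero, ← Complex.cpow_add _ _ two_ne_zero,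
      ← Complex.cpow_add _ _ two_ne_zero, ← Complex.cpow_add _ _ two_ne_zero, hAdef]
    congr 1; ring
  rw [e5, e6, e7, e8, show (α : ℂ) + 1 - A = (α + β + 1 / 2 + (1 - s)) / 2 by rw [hAdef]; ring]
  rw [Complex.real_smul, abs_of_pos two_pos]
  push_cast
  ring

/-! ### Exponentially decaying functions and their dilation series -/

/-- `g` is continuous on `(0, ∞)` and bounded there by `K r^(-p) exp(-δ r)`. -/
structure ExpDecay (g : ℝ → ℂ) (K δ : ℝ) (p : ℕ) : Prop where
  continuousOn : ContinuousOn g (Ioi 0)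
  bound : ∀ r > 0, ‖g r‖ ≤ K * (r ^ p)⁻¹ * Real.exp (-(δ * r))

lemma integrableOn_decay_majorant {δ x : ℝ} (hδ : 0 < δ) {p : ℕ} (hx : p < x) :
    IntegrableOn (fun r : ℝ => r ^ (x - 1) * ((r ^ p)⁻¹ * Real.exp (-(δ * r)))) (Ioi 0) := by
  have h := integrableOn_rpow_mul_exp_neg_mul_rpow (s := x - p - 1) (p := 1) (b := δ)
    (by linarith) one_pos hδ
  refine h.congr_fun (fun r hr => ?_) measurableSet_Ioi
  have hr' : (0 : ℝ) < r := hr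
  simp only [Real.rpow_one, neg_mul]
  rw [show x - p - 1 = (x - 1) - p by ring, Real.rpow_sub hr', Real.rpow_natCast]
  ring

lemma ExpDecay.mellinConvergent {g : ℝ → ℂ} {K δ : ℝ} {p : ℕ} (hg : ExpDecay g K δ p)
    (hδ : 0 < δ) {z : ℂ} (hz : p < z.re) : MellinConvergent g z := by
  refine Integrable.mono' ((integrableOn_decay_majorant hδ hz).const_mul K) ?_ ?_
  · refine (ContinuousOn.smul (f := fun u : ℝ => (u : ℂ) ^ (z - 1)) (fun u hu => ?_)
      hg.continuousOn).aestronglyMeasurable measurableSet_Ioi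
    exact (Complex.continuousAt_ofReal_cpow_const u _ (Or.inr (ne_of_gt hu))).continuousWithinAt
  · filter_upwards [ae_restrict_mem measurableSet_Ioi] with r hr
    have hr' : (0 : ℝ) < r := hr
    rw [norm_smul, Complex.norm_cpow_eq_rpow_re_of_pos hr, Complex.sub_re, Complex.one_re]
    calc r ^ (z.re - 1) * ‖g r‖
        ≤ r ^ (z.re - 1) * (K * (r ^ p)⁻¹ * Real.exp (-(δ * r))) := by
          gcongr; exact hg.bound r hr'
      _ = _ := by ring

/-- The series `r^{1/2} ∑ a_n g(l n r)`. -/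
def dilationSeries (a : ℕ → ℂ) (g : ℝ → ℂ) (l r : ℝ) : ℂ :=
  ∑' n : ℕ+, a n * (((r ^ (1 / 2 : ℝ) : ℝ) : ℂ) * g (l * (n : ℕ) * r))

lemma summable_pnat_norm_div {a : ℕ → ℂ} (ha : ∀ s : ℂ, 1 < s.re → LSeriesSummable a s) {p : ℕ}
    (hp : 2 ≤ p) : Summable fun n : ℕ+ => ‖a n‖ * (((n : ℕ) : ℝ) ^ p)⁻¹ := by
  have h := (ha p (by rw [Complex.natCast_re]; exact_mod_cast hp)).norm
  refine (h.comp_injective PNat.coe_injective).congr fun n => ?_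
  simp only [Function.comp]
  rw [LSeries.term_of_ne_zero n.ne_zero, norm_div, Complex.cpow_natCast, norm_pow,
    Complex.norm_natCast, div_eq_mul_inv]

/-- The power `r^(-p)` in the decay bound yields the convergent factor `n^(-p)`, while from the
exponential only `n ≥ 1` is used. The sum thus inherits a bound of the same shape. -/
lemma ExpDecay.dilationSeries_term_le {g : ℝ → ℂ} {K δ : ℝ} {p : ℕ} (hg : ExpDecay g K δ p)
    (hδ : 0 < δ) (a : ℕ → ℂ) {l : ℝ} (hl : 0 < l) (n : ℕ+) {r : ℝ} (hr : 0 < r) :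
    ‖a n * (((r ^ (1 / 2 : ℝ) : ℝ) : ℂ) * g (l * (n : ℕ) * r))‖ ≤
      (‖a n‖ * (((n : ℕ) : ℝ) ^ p)⁻¹) *
        (K * (l ^ p)⁻¹ * (r ^ (1 / 2 : ℝ) * (r ^ p)⁻¹ * Real.exp (-(δ * l * r)))) := by
  have hn : (1 : ℝ) ≤ (n : ℕ) := by exact_mod_cast n.pos
  have hK : 0 ≤ K := by
    have := (norm_nonneg _).trans (hg.bound 1 one_pos)
    simp only [one_pow, inv_one, mul_one] at this
    exact nonneg_of_mul_nonneg_left this (Real.exp_pos _)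
  have h1 := hg.bound (l * (n : ℕ) * r) (by positivity)
  rw [norm_mul, norm_mul, Complex.norm_real, Real.norm_of_nonneg (by positivity)]
  have h2 : δ * l * r ≤ δ * (l * (n : ℕ) * r) := by
    have : 0 < δ * l * r := by positivity
    nlinarith
  calc ‖a n‖ * (r ^ (1 / 2 : ℝ) * ‖g (l * (n : ℕ) * r)‖)
      ≤ ‖a n‖ * (r ^ (1 / 2 : ℝ) * (K * ((l * (n : ℕ) * r) ^ p)⁻¹ *
          Real.exp (-(δ * l * r)))) := by
        gcongr
        refine h1.trans ?_
        gcongr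
    _ = _ := by rw [mul_pow, mul_pow, mul_inv, mul_inv]; ring

lemma ExpDecay.norm_dilationSeries_le {g : ℝ → ℂ} {K δ : ℝ} {p : ℕ} (hg : ExpDecay g K δ p)
    (hδ : 0 < δ) {a : ℕ → ℂ} (ha : ∀ s : ℂ, 1 < s.re → LSeriesSummable a s) (hp : 2 ≤ p) {l : ℝ}
    (hl : 0 < l) {r : ℝ} (hr : 0 < r) :
    ‖dilationSeries a g l r‖ ≤ (∑' n : ℕ+, ‖a n‖ * (((n : ℕ) : ℝ) ^ p)⁻¹) *
      (K * (l ^ p)⁻¹ * (r ^ (1 / 2 : ℝ) * (r ^ p)⁻¹ * Real.exp (-(δ * l * r)))) :=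
  tsum_of_norm_bounded ((summable_pnat_norm_div ha hp).hasSum.mul_right _)
    fun n => hg.dilationSeries_term_le hδ a hl n hr

lemma ExpDecay.continuousOn_dilationSeries {g : ℝ → ℂ} {K δ : ℝ} {p : ℕ} (hg : ExpDecay g K δ p)
    (hδ : 0 < δ) {a : ℕ → ℂ} (ha : ∀ s : ℂ, 1 < s.re → LSeriesSummable a s) (hp : 2 ≤ p) {l : ℝ}
    (hl : 0 < l) : ContinuousOn (dilationSeries a g l) (Ioi 0) := by
  intro r₀ hr₀
  have hr₀' : (0 : ℝ) < r₀ := hr₀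
  have key : ContinuousOn (dilationSeries a g l) (Ioo (r₀ / 2) (2 * r₀)) := by
    have hK : 0 ≤ K := by
      have := (norm_nonneg _).trans (hg.bound 1 one_pos)
      simp only [one_pow, inv_one, mul_one] at this
      exact nonneg_of_mul_nonneg_left this (Real.exp_pos _)
    refine continuousOn_tsum (u := fun n : ℕ+ => (‖a n‖ * (((n : ℕ) : ℝ) ^ p)⁻¹) *
        (K * (l ^ p)⁻¹ * ((2 * r₀) ^ (1 / 2 : ℝ) * ((r₀ / 2) ^ p)⁻¹))) (fun n => ?_)
      ((summable_pnat_norm_div ha hp).mul_right _) (fun n r hr => ?_)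
    · have hn : (0 : ℝ) < (n : ℕ) := by exact_mod_cast n.pos
      refine continuousOn_const.mul (ContinuousOn.mul ?_ ?_)
      · exact Complex.continuous_ofReal.comp_continuousOn
          (continuousOn_id.rpow_const fun _ _ => Or.inr (by norm_num))
      · refine hg.continuousOn.comp (by fun_prop) fun r hr => ?_
        have : 0 < r := by linarith [hr.1]
        exact mem_Ioi.2 (by positivity)
    · have hr' : 0 < r := by linarith [hr.1]
      refine (hg.dilationSeries_term_le hδ a hl n hr').trans ?_
      have h1 : r ^ (1 / 2 : ℝ) * (r ^ p)⁻¹ * Real.exp (-(δ * l * r)) ≤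
          (2 * r₀) ^ (1 / 2 : ℝ) * ((r₀ / 2) ^ p)⁻¹ * 1 := by
        gcongr
        · exact hr.2.le
        · exact hr.1.le
        · exact Real.exp_le_one_iff.2 (by have : 0 < δ * l * r := by positivity
                                          linarith)
      rw [mul_one] at h1
      gcongr
  exact (key.continuousAt (Ioo_mem_nhds (by linarith) (by linarith))).continuousWithinAt

lemma LSeries_eq_tsum_pnat (a : ℕ → ℂ) (s : ℂ) :
    LSeries a s = ∑' n : ℕ+, a n * ((n : ℕ) : ℂ) ^ (-s) := by
  rw [LSeries, ← PNat.coe_injective.tsum_eq (f := LSeries.term a s)]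
  · refine tsum_congr fun n => ?_
    rw [LSeries.term_of_ne_zero n.ne_zero, Complex.cpow_neg, div_eq_mul_inv]
  · intro n hn
    have : n ≠ 0 := fun h => hn (by simp [h])
    exact ⟨⟨n, Nat.pos_of_ne_zero this⟩, rfl⟩

/-- Each dilation contributes `(l n)^(-s)`. The shift by `1/2` undoes the factor `r^{1/2}` in front
of the series. -/
lemma ExpDecay.mellin_dilationSeries {g : ℝ → ℂ} {K δ : ℝ} {p : ℕ} (hg : ExpDecay g K δ p)
    (hδ : 0 < δ) {a : ℕ → ℂ} (ha : ∀ s : ℂ, 1 < s.re → LSeriesSummable a s) (hp : 2 ≤ p) {l : ℝ}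
    (hl : 0 < l) {s : ℂ} (hs : p < s.re) :
    mellin (dilationSeries a g l) (s - 1 / 2) = (l : ℂ) ^ (-s) * LSeries a s * mellin g s := by
  have hterm : ∀ n : ℕ+, ∀ r ∈ Ioi (0 : ℝ),
      (r : ℂ) ^ (s - 1 / 2 - 1) * (a n * (((r ^ (1 / 2 : ℝ) : ℝ) : ℂ) * g (l * (n : ℕ) * r))) =
      a n * ((r : ℂ) ^ (s - 1) • g (l * (n : ℕ) * r)) := fun n r hr => by
    have hr' : (0 : ℝ) < r := hr
    rw [show s - 1 = (s - 1 / 2 - 1) + 1 / 2 by ring,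
      Complex.cpow_add _ _ (Complex.ofReal_ne_zero.2 hr'.ne'), Complex.ofReal_cpow hr'.le,
      smul_eq_mul]
    push_cast; ring
  have hln : ∀ n : ℕ+, 0 < l * (n : ℕ) := fun n => by
    have : (0 : ℝ) < (n : ℕ) := by exact_mod_cast n.pos
    positivity
  have hint : ∀ n : ℕ+, IntegrableOn (fun r : ℝ => (r : ℂ) ^ (s - 1 / 2 - 1) *
      (a n * (((r ^ (1 / 2 : ℝ) : ℝ) : ℂ) * g (l * (n : ℕ) * r)))) (Ioi 0) := fun n => by
    have h1 := ((MellinConvergent.comp_mul_left (hln n)).2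
      (hg.mellinConvergent hδ hs)).const_mul (a n)
    exact IntegrableOn.congr_fun h1 (fun r hr => (hterm n r hr).symm) measurableSet_Ioi
  have hmaj := integrableOn_decay_majorant (δ := δ * l) (by positivity) hs
  have key := hasSum_integral_of_summable_integral_norm hint (by
    refine .of_nonneg_of_le (fun n => integral_nonneg fun _ => norm_nonneg _) (fun n => ?_)
      ((summable_pnat_norm_div ha hp).mul_right (K * (l ^ p)⁻¹ *
        ∫ r in Ioi (0 : ℝ), r ^ (s.re - 1) * ((r ^ p)⁻¹ * Real.exp (-(δ * l * r)))))
    rw [← mul_assoc, ← integral_const_mul]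
    refine setIntegral_mono_on (hint n).norm (hmaj.const_mul _) measurableSet_Ioi fun r hr => ?_
    have hr' : (0 : ℝ) < r := hr
    rw [norm_mul, Complex.norm_cpow_eq_rpow_re_of_pos hr']
    refine (mul_le_mul_of_nonneg_left (hg.dilationSeries_term_le hδ a hl n hr')
      (by positivity)).trans (le_of_eq ?_)
    have e : (s - 1 / 2 - 1).re = s.re - 1 - 1 / 2 := by
      simp; ring
    have e2 : r ^ (s.re - 1) = r ^ (s.re - 1 - 1 / 2) * r ^ (1 / 2 : ℝ) := by
      rw [← Real.rpow_add hr']; ring_nf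
    rw [e, e2]
    ring)
  have h2 : mellin (dilationSeries a g l) (s - 1 / 2) = ∫ r in Ioi (0 : ℝ), ∑' n : ℕ+,
      (r : ℂ) ^ (s - 1 / 2 - 1) *
        (a n * (((r ^ (1 / 2 : ℝ) : ℝ) : ℂ) * g (l * (n : ℕ) * r))) := by
    simp_rw [mellin, dilationSeries, smul_eq_mul, tsum_mul_left]
  rw [h2, ← key.tsum_eq, LSeries_eq_tsum_pnat, ← tsum_mul_left, ← tsum_mul_right]
  refine tsum_congr fun n => ?_
  rw [setIntegral_congr_fun measurableSet_Ioi (hterm n), integral_const_mul]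
  have h3 := mellin_comp_mul_left g s (hln n)
  rw [mellin] at h3
  rw [h3, smul_eq_mul, Complex.ofReal_mul, Complex.mul_cpow_ofReal_nonneg hl.le
    (Nat.cast_nonneg _), Complex.ofReal_natCast]
  ring

/-! ### The Bessel series on a ray -/

/-- The product `H_α(c r) K_β(b r)`. -/
def besselKernel (α : ℝ) (β : ℂ) (c b r : ℝ) : ℂ := (besselH α (c * r) : ℂ) * besselK β (b * r)

lemma besselSeries_eq_dilationSeries (q α : ℝ) (β : ℂ) (a : ℕ → ℂ) {c b : ℝ} (hb : 0 ≤ b) {r : ℝ}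
    (hr : 0 ≤ r) : besselSeries q α β a (r * c) (r * b) =
      ((b ^ (1 / 2 : ℝ) : ℝ) : ℂ) *
        dilationSeries a (besselKernel α β c b) (2 * Real.pi / √q) r := by
  unfold besselSeries dilationSeries besselKernel
  rw [Real.mul_rpow hr hb, ← tsum_mul_left, ← tsum_mul_left]
  refine tsum_congr fun n => ?_
  rw [show 2 * Real.pi * (n : ℕ) * (r * c) / √q = c * (2 * Real.pi / √q * (n : ℕ) * r) by ring,
    show 2 * Real.pi * (n : ℕ) * (r * b) / √q = b * (2 * Real.pi / √q * (n : ℕ) * r) by ring]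
  push_cast; ring

lemma exists_one_add_pow_le_exp {δ : ℝ} (hδ : 0 < δ) (L : ℕ) :
    ∃ C > 0, ∀ r ≥ 0, (1 + r) ^ L ≤ C * Real.exp (δ * r) := by
  refine ⟨Real.exp δ * L.factorial / δ ^ L, by positivity, fun r hr => ?_⟩
  have h := Real.pow_div_factorial_le_exp (δ * (1 + r)) (by positivity) L
  rw [mul_pow, mul_add, mul_one, Real.exp_add] at h
  rw [div_mul_eq_mul_div, le_div_iff₀ (by positivity)]
  rw [div_le_iff₀ (by positivity)] at h
  linarith

lemma continuousOn_besselKernel {α : ℝ} (h : NotNegInt α) (β : ℂ) {c b : ℝ} (hc : 0 < c)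
    (hb : 0 < b) : ContinuousOn (besselKernel α β c b) (Ioi 0) := by
  have h1 : ContinuousOn (fun r => besselK β (b * r)) (Ioi 0) := by
    have : ContinuousOn (besselK β) (Ioi 0) := (continuousOn_besselKMoment β 0).congr
      fun x _ => (besselKMoment_zero β x).symm
    exact this.comp (by fun_prop) fun r hr => mul_pos hb hr
  have h2 : ContinuousOn (fun r => besselH α (c * r)) (Ioi 0) := by
    have : ContinuousOn (fun r => (c * r) ^ (1 / 2 : ℝ) *
        ((c * r / 2) ^ α * cliff α ((c * r) ^ 2 / 4))) (Ioi 0) := by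
      refine ContinuousOn.mul (ContinuousOn.rpow_const (by fun_prop) fun _ _ =>
        Or.inr (by norm_num)) (ContinuousOn.mul (ContinuousOn.rpow_const (by fun_prop)
          fun r hr => Or.inl ?_) ((continuous_cliff h).comp_continuousOn (by fun_prop)))
      have : 0 < c * r := mul_pos hc hr
      positivity
    exact this.congr fun r hr => by
      rw [besselH, besselJ_eq_cliff α (mul_pos hc hr)]
  exact (Complex.continuous_ofReal.comp_continuousOn h2).mul h1

/-- The exponent `p` serves all rays at once, and the dependence on `c` is kept explicit as
`c^(α+1/2)`. This is the power of `c` in `rayConst`, and the two cancel when `c` is later taken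
small. -/
lemma exists_expDecay_besselKernel {α : ℝ} (h : NotNegInt α) (β : ℂ) :
    ∃ p : ℕ, 2 ≤ p ∧ |α| + ‖β‖ ≤ p ∧ ∀ b₀ > 0, ∃ C > 0, ∀ c b : ℝ, 0 < c → b₀ ≤ b →
      c ^ 2 + b ^ 2 = 1 →
        ExpDecay (besselKernel α β c b) (C * c ^ (α + 1 / 2)) (b₀ / 4) p := by
  obtain ⟨C₁, hC₁, M, hM⟩ := exists_cliff_bound h
  obtain ⟨C₂, hC₂, N, hN⟩ := exists_besselKMoment_bound β 0
  obtain ⟨p, hp⟩ := exists_nat_ge (|α| + ‖β‖ + N + 2)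
  have hαβ : 0 ≤ |α| := abs_nonneg α
  have hβ0 := norm_nonneg β
  have hN0 : (0 : ℝ) ≤ N := N.cast_nonneg
  refine ⟨p, by exact_mod_cast (by linarith : (2 : ℝ) ≤ p), by linarith, fun b₀ hb₀ => ?_⟩
  -- The power of `r` left after factoring out `r^(-p)`: `p` is large enough that it is nonnegative
  -- and can be absorbed by the exponential.
  set e : ℝ := p + (α + 1 / 2) - N with he
  have he0 : 0 ≤ e := by linarith [neg_abs_le α]
  obtain ⟨L, hL⟩ := exists_nat_ge (e + 2 * M)
  obtain ⟨C₃, hC₃, hexp⟩ := exists_one_add_pow_le_exp (δ := b₀ / 4) (by positivity) L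
  refine ⟨2 ^ (-α) * C₁ * C₂ * (b₀ ^ N)⁻¹ * C₃, by positivity, fun c b hc hb hcb =>
    ⟨continuousOn_besselKernel h β hc (by linarith), fun r hr => ?_⟩⟩
  have hb' : 0 < b := by linarith
  have hc1 : c ≤ 1 := by nlinarith
  have h1 : |besselH α (c * r)| ≤
      c ^ (α + 1 / 2) * (2 ^ (-α) * C₁) * (r ^ (α + 1 / 2) * (1 + r) ^ (2 * M)) := by
    rw [besselH, besselJ_eq_cliff α (mul_pos hc hr), abs_mul, abs_mul, abs_of_pos (by positivity),
      abs_of_pos (by positivity)]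
    have h2 : |cliff α ((c * r) ^ 2 / 4)| ≤ C₁ * (1 + r) ^ (2 * M) := by
      refine (hM _ (by positivity)).trans ?_
      rw [pow_mul]
      gcongr
      have : (c * r) ^ 2 ≤ r ^ 2 := by gcongr; nlinarith
      nlinarith
    calc (c * r) ^ (1 / 2 : ℝ) * ((c * r / 2) ^ α * |cliff α ((c * r) ^ 2 / 4)|)
        ≤ (c * r) ^ (1 / 2 : ℝ) * ((c * r / 2) ^ α * (C₁ * (1 + r) ^ (2 * M))) := by gcongr
      _ = _ := by
        rw [Real.div_rpow (by positivity) zero_le_two, Real.mul_rpow hc.le hr.le,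
          Real.mul_rpow hc.le hr.le, Real.rpow_add hc, Real.rpow_add hr,
          Real.rpow_neg zero_le_two]
        ring
  have h2 : ‖besselK β (b * r)‖ ≤
      C₂ * (b₀ ^ N)⁻¹ * ((r ^ N)⁻¹ * Real.exp (-(b₀ * r / 2))) := by
    rw [← besselKMoment_zero]
    calc _ ≤ C₂ * ((b * r) ^ N)⁻¹ * Real.exp (-(b * r / 2)) := hN _ (by positivity)
      _ ≤ C₂ * ((b₀ * r) ^ N)⁻¹ * Real.exp (-(b₀ * r / 2)) := by gcongr
      _ = _ := by rw [mul_pow, mul_inv]; ring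
  have h3 : r ^ (α + 1 / 2) * (1 + r) ^ (2 * M) * (r ^ N)⁻¹ ≤
      (r ^ p)⁻¹ * (C₃ * Real.exp (b₀ / 4 * r)) := by
    have h4 : r ^ e * (1 + r) ^ (2 * M) ≤ (1 + r) ^ L := by
      calc r ^ e * (1 + r) ^ (2 * M) ≤ (1 + r) ^ e * (1 + r) ^ ((2 * M : ℕ) : ℝ) := by
            rw [Real.rpow_natCast]
            gcongr
            linarith
        _ = (1 + r) ^ (e + (2 * M : ℕ)) := (Real.rpow_add (by linarith) _ _).symm
        _ ≤ (1 + r) ^ (L : ℝ) := by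
            refine Real.rpow_le_rpow_of_exponent_le (by linarith) ?_
            push_cast; exact hL
        _ = _ := Real.rpow_natCast _ _
    have h5 : r ^ e = r ^ p * r ^ (α + 1 / 2) * (r ^ N)⁻¹ := by
      rw [he, Real.rpow_sub hr, Real.rpow_add hr, Real.rpow_natCast, Real.rpow_natCast,
        div_eq_mul_inv]
    rw [h5] at h4
    have h6 := h4.trans (hexp r hr.le)
    rw [inv_mul_eq_div, le_div_iff₀ (by positivity)]
    linarith
  rw [besselKernel, norm_mul, Complex.norm_real, Real.norm_eq_abs]
  have hexp2 : Real.exp (-(b₀ / 4 * r)) = Real.exp (b₀ / 4 * r) * Real.exp (-(b₀ * r / 2)) := by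
    rw [← Real.exp_add]; ring_nf
  rw [hexp2]
  calc |besselH α (c * r)| * ‖besselK β (b * r)‖
      ≤ (c ^ (α + 1 / 2) * (2 ^ (-α) * C₁) * (r ^ (α + 1 / 2) * (1 + r) ^ (2 * M))) *
        (C₂ * (b₀ ^ N)⁻¹ * ((r ^ N)⁻¹ * Real.exp (-(b₀ * r / 2)))) := by gcongr
    _ = (c ^ (α + 1 / 2) * (2 ^ (-α) * C₁) * C₂ * (b₀ ^ N)⁻¹ * Real.exp (-(b₀ * r / 2))) *
        (r ^ (α + 1 / 2) * (1 + r) ^ (2 * M) * (r ^ N)⁻¹) := by ring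
    _ ≤ (c ^ (α + 1 / 2) * (2 ^ (-α) * C₁) * C₂ * (b₀ ^ N)⁻¹ * Real.exp (-(b₀ * r / 2))) *
        ((r ^ p)⁻¹ * (C₃ * Real.exp (b₀ / 4 * r))) := by gcongr
    _ = _ := by ring

/-- The entire factor by which the Mellin transform of the Bessel series on the ray through
`(c, b)` differs from the completed series. -/
def rayFactor (α : ℝ) (β : ℂ) (c b : ℝ) (s : ℂ) : ℂ :=
  (b : ℂ) ^ β * hyp α ((α + β + 1 / 2 + (1 - s)) / 2) ((α + β + 1 / 2 + s) / 2) (c ^ 2)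

/-- The constant factor in the same relation. -/
def rayConst (α c b : ℝ) : ℝ := 2 ^ (-(3 / 2) : ℝ) * c ^ (α + 1 / 2) * b ^ (1 / 2 : ℝ)

lemma rayConst_pos (α : ℝ) {c b : ℝ} (hc : 0 < c) (hb : 0 < b) : 0 < rayConst α c b := by
  unfold rayConst; positivity

lemma gamma_arg_re_pos {α : ℝ} {β s : ℂ} {p : ℝ} (hp : |α| + ‖β‖ ≤ p) (hs : p < s.re) :
    0 < ((α + β + 1 / 2 + s) / 2).re ∧ 0 < ((α - β + 1 / 2 + s) / 2).re := by
  have h1 := neg_abs_le α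
  have h2 := Complex.abs_re_le_norm β
  have h3 := neg_abs_le β.re
  have h4 := le_abs_self β.re
  have e1 : ((α + β + 1 / 2 + s) / 2).re = (α + β.re + 1 / 2 + s.re) / 2 := by
    rw [Complex.div_ofNat_re]; simp
  have e2 : ((α - β + 1 / 2 + s) / 2).re = (α - β.re + 1 / 2 + s.re) / 2 := by
    rw [Complex.div_ofNat_re]; simp
  constructor
  · rw [e1]; linarith
  · rw [e2]; linarith

/-- The Gamma factors in the kernel's Mellin transform are exactly those of the completed series, so
the only dependence on the ray is through `rayConst` and the entire function `rayFactor`. -/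
lemma mellin_besselSeries {q α : ℝ} (hq : 0 < q) (h : NotNegInt α) {β : ℂ} {a : ℕ → ℂ}
    (ha : ∀ s : ℂ, 1 < s.re → LSeriesSummable a s) {c b : ℝ} (hc : 0 < c) (hb : 0 < b)
    (hcb : c ^ 2 + b ^ 2 = 1) {K δ : ℝ} {p : ℕ} (hg : ExpDecay (besselKernel α β c b) K δ p)
    (hδ : 0 < δ) (hp : 2 ≤ p) (hp' : |α| + ‖β‖ ≤ p) {s : ℂ} (hs : p < s.re) :
    mellin (fun r => besselSeries q α β a (r * c) (r * b)) (s - 1 / 2) =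
      rayConst α c b * rayFactor α β c b s * completedSeries q α β a s := by
  have hl : 0 < 2 * Real.pi / √q := by positivity
  obtain ⟨hB, hA⟩ := gamma_arg_re_pos hp' hs
  have h1 : mellin (fun r => besselSeries q α β a (r * c) (r * b)) (s - 1 / 2) =
      ((b ^ (1 / 2 : ℝ) : ℝ) : ℂ) *
        mellin (dilationSeries a (besselKernel α β c b) (2 * Real.pi / √q)) (s - 1 / 2) := by
    rw [← smul_eq_mul, ← mellin_const_smul]
    refine setIntegral_congr_fun measurableSet_Ioi fun r hr => ?_
    simp only [besselSeries_eq_dilationSeries q α β a hb.le (le_of_lt hr), smul_eq_mul]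
  rw [h1, hg.mellin_dilationSeries hδ ha hp hl hs]
  have h2 := mellin_besselH_mul_besselK h hc hb hcb hA hB
  rw [show mellin (besselKernel α β c b) s = _ from h2]
  unfold rayConst rayFactor completedSeries
  have e1 : (((2 * Real.pi / √q : ℝ)) : ℂ) ^ (-s) * 2 ^ (s - 3 / 2) =
      ((2 ^ (-(3 / 2) : ℝ) : ℝ) : ℂ) * ((√q / Real.pi : ℝ) : ℂ) ^ s := by
    rw [show 2 * Real.pi / √q = 2 * (√q / Real.pi)⁻¹ by field_simp, Complex.ofReal_mul,
      Complex.mul_cpow_ofReal_nonneg zero_le_two (by positivity), Complex.ofReal_inv,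
      Complex.inv_cpow _ _ (by
          rw [Complex.arg_ofReal_of_nonneg (by positivity)]; exact Real.pi_pos.ne),
      Complex.cpow_neg _ s, Complex.cpow_neg _ s, inv_inv, sub_eq_add_neg,
      Complex.cpow_add _ _ two_ne_zero, Complex.ofReal_cpow zero_le_two]
    push_cast
    have : (2 : ℂ) ^ s ≠ 0 := by simp [Complex.cpow_eq_zero_iff]
    field_simp
  have e2 : ((c ^ (α + 1 / 2) : ℝ) : ℂ) = (c : ℂ) ^ (α + 1 / 2 : ℂ) := by
    rw [Complex.ofReal_cpow hc.le]; push_cast; rfl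
  rw [Complex.ofReal_mul, Complex.ofReal_mul, e2]
  linear_combination ((b ^ (1 / 2 : ℝ) : ℝ) : ℂ) * LSeries a s * (c : ℂ) ^ (α + 1 / 2 : ℂ) *
    (b : ℂ) ^ β * Complex.Gamma ((α + β + 1 / 2 + s) / 2) *
    Complex.Gamma ((α - β + 1 / 2 + s) / 2) *
    hyp α ((α + β + 1 / 2 + (1 - s)) / 2) ((α + β + 1 / 2 + s) / 2) (c ^ 2) * e1

/-! ### The entire factor -/

lemma eq_of_eq_on_re_gt {f g : ℂ → ℂ} (hf : Differentiable ℂ f) (hg : Differentiable ℂ g) {p : ℝ}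
    (h : ∀ s : ℂ, p < s.re → f s = g s) : f = g := by
  refine AnalyticOnNhd.eq_of_eventuallyEq (z₀ := ((p + 1 : ℝ) : ℂ))
    (fun z _ => hf.analyticAt z) (fun z _ => hg.analyticAt z) ?_
  have : {s : ℂ | p < s.re} ∈ 𝓝 ((p + 1 : ℝ) : ℂ) :=
    (isOpen_lt continuous_const Complex.continuous_re).mem_nhds (by simp)
  filter_upwards [this] with s hs using h s hs

lemma sq_lt_one_of_add_sq {c b : ℝ} (hb : 0 < b) (hcb : c ^ 2 + b ^ 2 = 1) : c ^ 2 < 1 := by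
  nlinarith [sq_pos_of_pos hb]

lemma differentiable_rayFactor {α : ℝ} (h : NotNegInt α) (β : ℂ) {c b : ℝ} (hc : c ^ 2 < 1) :
    Differentiable ℂ (rayFactor α β c b) := by
  unfold rayFactor
  exact (differentiable_hyp h (sq_nonneg c) hc (by fun_prop) (by fun_prop)).const_mul _

/-- The reflection exchanges the two upper parameters of the Gauss series. -/
lemma rayFactor_one_sub (α : ℝ) (β : ℂ) (c b : ℝ) (s : ℂ) :
    rayFactor α β c b (1 - s) = rayFactor α β c b s := by
  unfold rayFactor
  rw [hyp_comm, sub_sub_cancel]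

/-- This is Euler's transformation of the Gauss series. It is read off from `K_{-β} = K_β`: the
Mellin transform of the kernel is evaluated with `β` and with `-β`, the Gamma factors merely trade
places, and the identity theorem extends the equality to all `s`. -/
lemma rayFactor_neg {α : ℝ} (h : NotNegInt α) (β : ℂ) {c b : ℝ} (hc : 0 < c) (hb : 0 < b)
    (hcb : c ^ 2 + b ^ 2 = 1) : rayFactor α (-β) c b = rayFactor α β c b := by
  have hc1 := sq_lt_one_of_add_sq hb hcb
  refine eq_of_eq_on_re_gt (p := |α| + ‖β‖) (differentiable_rayFactor h _ hc1)
    (differentiable_rayFactor h _ hc1) fun s hs => ?_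
  obtain ⟨hB, hA⟩ := gamma_arg_re_pos le_rfl hs
  have h1 := mellin_besselH_mul_besselK h hc hb hcb hA hB
  have h2 := mellin_besselH_mul_besselK (β := -β) h hc hb hcb
    (by rwa [sub_neg_eq_add]) (by rwa [← sub_eq_add_neg])
  simp_rw [besselK_neg] at h2
  rw [h1] at h2
  have g1 := Complex.Gamma_ne_zero_of_re_pos hA
  have g2 := Complex.Gamma_ne_zero_of_re_pos hB
  have n1 : (2 : ℂ) ^ (s - 3 / 2) ≠ 0 := by simp [Complex.cpow_eq_zero_iff]
  have n2 : (c : ℂ) ^ (α + 1 / 2 : ℂ) ≠ 0 := by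
    simp [Complex.cpow_eq_zero_iff, hc.ne']
  rw [sub_neg_eq_add, ← sub_eq_add_neg] at h2
  unfold rayFactor
  rw [← sub_eq_add_neg]
  refine mul_left_cancel₀ (mul_ne_zero (mul_ne_zero n1 n2) (mul_ne_zero g1 g2)) ?_
  linear_combination -h2

lemma conj_rayFactor (α : ℝ) (β : ℂ) (c : ℝ) {b : ℝ} (hb : 0 < b) (s : ℂ) :
    conj (rayFactor α β c b s) = rayFactor α (conj β) c b (conj s) := by
  unfold rayFactor
  have h1 : conj ((b : ℂ) ^ β) = (b : ℂ) ^ conj β := by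
    have := Complex.cpow_conj (b : ℂ) β (by
      rw [Complex.arg_ofReal_of_nonneg hb.le]; exact Real.pi_pos.ne)
    rw [this, Complex.conj_ofReal]
  have h2 : conj (2 : ℂ) = 2 := map_ofNat (starRingEnd ℂ) 2
  rw [map_mul, conj_hyp, h1]
  simp [h2]

/-- The condition on `β` enters here: it says that `conj β` is `β` or `-β`, and `rayFactor` does not
distinguish the two. -/
lemma conj_rayFactor_one_sub {α : ℝ} (h : NotNegInt α) {β : ℂ} (hβ : β.im = 0 ∨ β.re = 0)
    {c b : ℝ} (hc : 0 < c) (hb : 0 < b) (hcb : c ^ 2 + b ^ 2 = 1) (s : ℂ) :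
    conj (rayFactor α β c b (conj (1 - s))) = rayFactor α β c b s := by
  rw [conj_rayFactor α β c hb, Complex.conj_conj, rayFactor_one_sub]
  rcases hβ with hβ | hβ
  · rw [Complex.conj_eq_iff_im.2 hβ]
  · have : conj β = -β := by apply Complex.ext <;> simp [hβ]
    rw [this, rayFactor_neg h β hc hb hcb]

lemma exists_hyp_lower_bound {γ : ℝ} (h : NotNegInt γ) : ∃ ε > 0, ε ≤ 1 / 4 ∧ ∃ κ > 0,
    ∀ (D B : ℂ) (z X : ℝ), 0 ≤ z → 1 + ‖D‖ ≤ X → 1 + ‖B‖ ≤ X → X ^ 2 * z ≤ ε →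
      κ ≤ ‖hyp γ D B z‖ := by
  obtain ⟨C, hC, hb⟩ := exists_factorial_mul_invGamma_le h one_lt_two
  have hG : 0 < |invGamma γ 0| := abs_pos.2 (invGamma_zero_ne h)
  -- The terms are at most `C y^m` with `y = 2 X² z`. The bound `1/4` gives `y ≤ 1/2`, so the tail
  -- is at most `2 C y = 4 C X² z`, and the second bound makes this at most half of the constant
  -- term.
  refine ⟨min (1 / 4) (|invGamma γ 0| / (8 * C)), by positivity, min_le_left _ _,
    |invGamma γ 0| / 2, by positivity, fun D B z X hz hD hB hX => ?_⟩
  have hX0 : 0 ≤ X := by linarith [norm_nonneg D]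
  have hX1 := hX.trans (min_le_left _ _)
  have hX2 := hX.trans (min_le_right _ _)
  set y := 2 * (X ^ 2 * z) with hy
  have hy0 : 0 ≤ y := by positivity
  have hy1 : y ≤ 1 / 2 := by linarith
  have hterm : ∀ m : ℕ,
      ‖rising D m * rising B m * invGamma γ m / m.factorial * (z : ℂ) ^ m‖ ≤ C * y ^ m := by
    intro m
    rw [norm_hyp_term γ D B hz]
    have hf : (m.factorial : ℝ) ≠ 0 := by positivity
    have e1 := norm_rising_le_pow hD m
    have e2 := norm_rising_le_pow hB m
    calc _ ≤ (m.factorial * X ^ m) * (m.factorial * X ^ m) * |invGamma γ m| / m.factorial *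
          z ^ m := by gcongr
      _ = (m.factorial * |invGamma γ m|) * (X ^ 2 * z) ^ m := by
        rw [mul_pow, ← pow_mul, mul_comm 2 m, pow_mul]
        field_simp
      _ ≤ (C * 2 ^ m) * (X ^ 2 * z) ^ m := mul_le_mul_of_nonneg_right (hb m) (by positivity)
      _ = C * y ^ m := by rw [hy, mul_pow 2]; ring
  have hgeo := (hasSum_geometric_of_lt_one hy0 (by linarith)).mul_left (C * y)
  have hs : Summable fun m : ℕ =>
      rising D m * rising B m * invGamma γ m / m.factorial * (z : ℂ) ^ m :=
    .of_norm_bounded ((summable_geometric_of_lt_one hy0 (by linarith)).mul_left C) hterm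
  have htail : ‖∑' m : ℕ, rising D (m + 1) * rising B (m + 1) * invGamma γ (m + 1) /
      (m + 1).factorial * (z : ℂ) ^ (m + 1)‖ ≤ |invGamma γ 0| / 2 := by
    refine (tsum_of_norm_bounded hgeo fun m => (hterm (m + 1)).trans
      (le_of_eq (by rw [pow_succ]; ring))).trans ?_
    have h1 : (1 - y)⁻¹ ≤ 2 := by
      rw [inv_le_comm₀ (by linarith) two_pos]; linarith
    calc C * y * (1 - y)⁻¹ ≤ C * y * 2 := by gcongr
      _ = 4 * C * (X ^ 2 * z) := by rw [hy]; ring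
      _ ≤ 4 * C * (|invGamma γ 0| / (8 * C)) := by gcongr
      _ = _ := by field_simp; norm_num
  rw [hyp, hs.tsum_eq_zero_add]
  have h0 : ‖rising D 0 * rising B 0 * invGamma γ 0 / (Nat.factorial 0) * (z : ℂ) ^ 0‖ =
      |invGamma γ 0| := by
    simp
  have := norm_sub_le_norm_add (rising D 0 * rising B 0 * invGamma γ 0 / (Nat.factorial 0) *
    (z : ℂ) ^ 0) (∑' m : ℕ, rising D (m + 1) * rising B (m + 1) * invGamma γ (m + 1) /
      (m + 1).factorial * (z : ℂ) ^ (m + 1))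
  rw [h0] at this
  linarith

lemma norm_rayFactor_args_le (α : ℝ) (β s : ℂ) :
    ‖((α : ℂ) + β + 1 / 2 + (1 - s)) / 2‖ ≤ |α| + ‖β‖ + 2 + ‖s‖ ∧
      ‖((α : ℂ) + β + 1 / 2 + s) / 2‖ ≤ |α| + ‖β‖ + 2 + ‖s‖ := by
  have h1 : ‖(α : ℂ) + β + 1 / 2‖ ≤ |α| + ‖β‖ + 1 / 2 := by
    refine (norm_add_le _ _).trans (add_le_add ((norm_add_le _ _).trans ?_) (by norm_num))
    rw [Complex.norm_real, Real.norm_eq_abs]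
  have h2 : ‖1 - s‖ ≤ 1 + ‖s‖ := (norm_sub_le _ _).trans (by simp)
  have h3 := norm_add_le ((α : ℂ) + β + 1 / 2) (1 - s)
  have h4 := norm_add_le ((α : ℂ) + β + 1 / 2) s
  have := norm_nonneg ((α : ℂ) + β + 1 / 2 + (1 - s))
  have := norm_nonneg ((α : ℂ) + β + 1 / 2 + s)
  rw [norm_div, norm_div, Complex.norm_ofNat]
  constructor <;> linarith

lemma exists_rayFactor_lower_bound {α : ℝ} (h : NotNegInt α) (β : ℂ) :
    ∃ ε > 0, ε ≤ 1 / 4 ∧ ∃ κ > 0, ∀ (c b : ℝ) (s : ℂ), 1 / 2 ≤ b → b ≤ 1 →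
      (|α| + ‖β‖ + 3 + ‖s‖) ^ 2 * c ^ 2 ≤ ε → κ ≤ ‖rayFactor α β c b s‖ := by
  obtain ⟨ε, hε, hε', κ, hκ, hb⟩ := exists_hyp_lower_bound h
  refine ⟨ε, hε, hε', (1 / 2) ^ |β.re| * κ, by positivity, fun c b s hb1 hb2 hX => ?_⟩
  have hb0 : 0 < b := by linarith
  obtain ⟨h1, h2⟩ := norm_rayFactor_args_le α β s
  rw [rayFactor, norm_mul, Complex.norm_cpow_eq_rpow_re_of_pos hb0]
  have h3 : (1 / 2 : ℝ) ^ |β.re| ≤ b ^ β.re :=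
    (Real.rpow_le_rpow (by norm_num) hb1 (abs_nonneg _)).trans
      (Real.rpow_le_rpow_of_exponent_ge hb0 hb2 (le_abs_self _))
  exact mul_le_mul h3 (hb _ _ _ _ (sq_nonneg c) (by linarith) (by linarith) hX) hκ.le
    (by positivity)

lemma exists_rayFactor_growth {α : ℝ} (h : NotNegInt α) (β : ℂ) {c b : ℝ} (hb : 0 < b)
    (hc : c ^ 2 < 1) :
    ∃ C D : ℝ, 0 ≤ D ∧ ∀ s, ‖rayFactor α β c b s‖ ≤ C * Real.exp (D * ‖s‖) := by
  obtain ⟨C, hC, L, hL, hb'⟩ := exists_norm_hyp_le h (sq_nonneg c) hc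
  refine ⟨b ^ β.re * (C * Real.exp (Real.log L * (|α| + ‖β‖ + 4))), Real.log L,
    Real.log_nonneg hL.le, fun s => ?_⟩
  obtain ⟨h1, h2⟩ := norm_rayFactor_args_le α β s
  set X := |α| + ‖β‖ + 2 + ‖s‖ with hX
  have hX0 : 0 ≤ X := by positivity
  have hN := Nat.le_ceil X
  have hN' := Nat.ceil_lt_add_one hX0
  rw [rayFactor, norm_mul, Complex.norm_cpow_eq_rpow_re_of_pos hb]
  have h3 := hb' ⌈X⌉₊ _ _ (h1.trans (by linarith)) (h2.trans (by linarith))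
  have h4 : L ^ (⌈X⌉₊ + 1) ≤ Real.exp (Real.log L * (|α| + ‖β‖ + 4)) *
      Real.exp (Real.log L * ‖s‖) := by
    rw [← Real.exp_add, ← mul_add, ← Real.rpow_natCast, Real.rpow_def_of_pos (by linarith)]
    have : 0 ≤ Real.log L := Real.log_nonneg hL.le
    gcongr
    push_cast
    linarith
  calc _ ≤ b ^ β.re * (C * (Real.exp (Real.log L * (|α| + ‖β‖ + 4)) *
      Real.exp (Real.log L * ‖s‖))) := by gcongr; exact h3.trans (by gcongr)
    _ = _ := by ring

/-! ### Mellin transforms of symmetric decaying functions -/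

/-- `h` is continuous on `(0, ∞)`, decays like `K exp(-δ r)`, and satisfies
`h(r) = conj (h(1 / r))`. -/
structure SymmDecay (h : ℝ → ℂ) (K δ : ℝ) : Prop where
  continuousOn : ContinuousOn h (Ioi 0)
  symm : ∀ r > 0, h r = conj (h r⁻¹)
  bound : ∀ r ≥ 1, ‖h r‖ ≤ K * Real.exp (-(δ * r))

section

variable {h : ℝ → ℂ} {K δ : ℝ}

lemma SymmDecay.isBigO_atTop (hh : SymmDecay h K δ) (hδ : 0 < δ) (a : ℝ) :
    h =O[atTop] fun r : ℝ => r ^ (-a) := by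
  have h1 : h =O[atTop] fun r : ℝ => Real.exp (-δ * r) := by
    refine IsBigO.of_bound K ?_
    filter_upwards [eventually_ge_atTop 1] with r hr
    rw [Real.norm_of_nonneg (Real.exp_pos _).le, neg_mul]
    exact hh.bound r hr
  exact h1.trans (isLittleO_exp_neg_mul_rpow_atTop hδ _).isBigO

lemma SymmDecay.isBigO_zero (hh : SymmDecay h K δ) (hδ : 0 < δ) (b : ℝ) :
    h =O[𝓝[>] 0] fun r : ℝ => r ^ (-b) := by
  have h1 := (hh.isBigO_atTop hδ (-b)).comp_tendsto tendsto_inv_nhdsGT_zero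
  refine (h1.congr' (f₂ := fun r => h r⁻¹) (g₂ := fun r : ℝ => r ^ (-b)) .rfl ?_).norm_left
    |>.congr' ?_ .rfl |>.of_norm_left
  · filter_upwards [self_mem_nhdsWithin] with r hr
    simp only [Function.comp, neg_neg]
    rw [Real.inv_rpow (le_of_lt hr), Real.rpow_neg (le_of_lt hr)]
  · filter_upwards [self_mem_nhdsWithin] with r hr
    rw [hh.symm r hr, RCLike.norm_conj]

lemma SymmDecay.differentiable_mellin (hh : SymmDecay h K δ) (hδ : 0 < δ) :
    Differentiable ℂ (mellin h) := fun z =>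
  mellin_differentiableAt_of_isBigO_rpow
    (hh.continuousOn.locallyIntegrableOn measurableSet_Ioi)
    (hh.isBigO_atTop hδ (z.re + 1)) (by linarith) (hh.isBigO_zero hδ (z.re - 1)) (by linarith)

lemma SymmDecay.mellin_conj (hh : SymmDecay h K δ) (z : ℂ) :
    conj (mellin h (-conj z)) = mellin h z := by
  rw [← mellin_comp_inv, mellin, mellin, ← integral_conj]
  refine setIntegral_congr_fun measurableSet_Ioi fun r hr => ?_
  have hr' : (0 : ℝ) < r := hr
  simp only [smul_eq_mul, map_mul]
  rw [← hh.symm r hr]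
  have := Complex.cpow_conj (r : ℂ) (conj z - 1) (by
      rw [Complex.arg_ofReal_of_nonneg hr'.le]; exact Real.pi_pos.ne)
  rw [Complex.conj_ofReal] at this
  rw [← this]
  simp

/-- For `r ≥ 1` half of the exponential absorbs `r^k`. For `r ≤ 1` the symmetry gives decay
`exp(-δ/r)`, whose factor `r^k` compensates `r^(x-1)`; the factor `exp δ` puts both ranges under one
majorant. -/
lemma SymmDecay.norm_mul_rpow_le (hh : SymmDecay h K δ) (hδ : 0 < δ) {x : ℝ} {k : ℕ}
    (hk : 1 + |x| ≤ k) {r : ℝ} (hr : 0 < r) : r ^ (x - 1) * ‖h r‖ ≤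
      K * (k.factorial * (2 / δ) ^ k) * Real.exp δ * Real.exp (-(δ / 2 * r)) := by
  have hK : 0 ≤ K := by
    have := (norm_nonneg _).trans (hh.bound 1 le_rfl)
    exact nonneg_of_mul_nonneg_left this (Real.exp_pos _)
  have hx1 := le_abs_self x
  have hx2 := neg_abs_le x
  rcases le_total 1 r with h1 | h1
  · have e1 : r ^ (x - 1) ≤ r ^ k := by
      rw [← Real.rpow_natCast]
      exact Real.rpow_le_rpow_of_exponent_le h1 (by linarith)
    have e2 : r ^ k * Real.exp (-(δ * r)) ≤
        k.factorial * (2 / δ) ^ k * Real.exp (-(δ / 2 * r)) := by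
      have := exp_neg_le_factorial_div_pow (y := δ / 2 * r) (by positivity) k
      calc r ^ k * Real.exp (-(δ * r))
          = r ^ k * (Real.exp (-(δ / 2 * r)) * Real.exp (-(δ / 2 * r))) := by
            rw [← Real.exp_add]; ring_nf
        _ ≤ r ^ k * (k.factorial / (δ / 2 * r) ^ k * Real.exp (-(δ / 2 * r))) := by gcongr
        _ = _ := by rw [mul_pow, div_pow, div_pow]; field_simp
    calc r ^ (x - 1) * ‖h r‖ ≤ r ^ k * (K * Real.exp (-(δ * r))) := by
          gcongr; exact hh.bound r h1
      _ = K * (r ^ k * Real.exp (-(δ * r))) := by ring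
      _ ≤ K * (k.factorial * (2 / δ) ^ k * Real.exp (-(δ / 2 * r))) := by gcongr
      _ = K * (k.factorial * (2 / δ) ^ k) * 1 * Real.exp (-(δ / 2 * r)) := by ring
      _ ≤ _ := by
        gcongr
        exact Real.one_le_exp hδ.le
  · have hi : 1 ≤ r⁻¹ := (one_le_inv₀ hr).2 h1
    have e0 : ‖h r‖ ≤ K * Real.exp (-(δ * r⁻¹)) := by
      rw [hh.symm r hr, RCLike.norm_conj]; exact hh.bound _ hi
    have e1 : Real.exp (-(δ * r⁻¹)) ≤ k.factorial * (1 / δ) ^ k * r ^ k := by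
      refine (exp_neg_le_factorial_div_pow (by positivity) k).trans (le_of_eq ?_)
      rw [mul_pow, inv_pow, one_div_pow]; field_simp
    have e2 : r ^ (x - 1) * r ^ k ≤ 1 := by
      rw [← Real.rpow_natCast, ← Real.rpow_add hr]
      exact Real.rpow_le_one hr.le h1 (by linarith)
    have e3 : 1 ≤ Real.exp δ * Real.exp (-(δ / 2 * r)) := by
      rw [← Real.exp_add]
      exact Real.one_le_exp (by nlinarith)
    calc r ^ (x - 1) * ‖h r‖
        ≤ r ^ (x - 1) * (K * (k.factorial * (1 / δ) ^ k * r ^ k)) := by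
          gcongr; exact e0.trans (by gcongr)
      _ = K * (k.factorial * (1 / δ) ^ k) * (r ^ (x - 1) * r ^ k) := by ring
      _ ≤ K * (k.factorial * (2 / δ) ^ k) * (Real.exp δ * Real.exp (-(δ / 2 * r))) := by
          refine mul_le_mul ?_ (e2.trans e3) (by positivity) (by positivity)
          gcongr
          norm_num
      _ = _ := by ring

/-- The crude estimate `k! (2/δ)^k ≤ exp(2k²/δ)`, with `k` of size `‖z‖`, suffices for finite order.
It matters that `K` enters linearly. -/
lemma SymmDecay.norm_mellin_le (hh : SymmDecay h K δ) (hδ : 0 < δ) (z : ℂ) :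
    ‖mellin h z‖ ≤ K * Real.exp (2 / δ * (‖z‖ + 2) ^ 2) * Real.exp δ * (2 / δ) := by
  have hK : 0 ≤ K := by
    have := (norm_nonneg _).trans (hh.bound 1 le_rfl)
    exact nonneg_of_mul_nonneg_left this (Real.exp_pos _)
  set k := ⌈1 + |z.re|⌉₊ with hk
  have hk1 : 1 + |z.re| ≤ k := Nat.le_ceil _
  have hk2 : (k : ℝ) ≤ ‖z‖ + 2 := by
    have := (Nat.ceil_lt_add_one (by positivity : 0 ≤ 1 + |z.re|)).le
    have := Complex.abs_re_le_norm z
    linarith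
  have hint : IntegrableOn (fun r => K * (k.factorial * (2 / δ) ^ k) * Real.exp δ *
      Real.exp (-(δ / 2 * r))) (Ioi 0) := by
    have := integrableOn_exp_mul_Ioi (a := -(δ / 2)) (by linarith) 0
    simp_rw [neg_mul] at this
    exact this.const_mul _
  have h1 := norm_integral_le_of_norm_le (f := fun r : ℝ => (r : ℂ) ^ (z - 1) • h r) hint (by
    filter_upwards [ae_restrict_mem measurableSet_Ioi] with r hr
    rw [norm_smul, Complex.norm_cpow_eq_rpow_re_of_pos hr, Complex.sub_re, Complex.one_re]
    exact hh.norm_mul_rpow_le hδ hk1 hr)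
  have h2 : ∫ r in Ioi (0 : ℝ), Real.exp (-(δ / 2 * r)) = 2 / δ := by
    have := integral_exp_mul_Ioi (a := -(δ / 2)) (by linarith) 0
    simp_rw [neg_mul] at this
    rw [this]; simp
  rw [integral_const_mul, h2] at h1
  refine h1.trans ?_
  have h3 : (k.factorial : ℝ) * (2 / δ) ^ k ≤ Real.exp (2 / δ * (‖z‖ + 2) ^ 2) := by
    have e1 : (k.factorial : ℝ) ≤ k ^ k := by exact_mod_cast Nat.factorial_le_pow k
    have e2 : (k : ℝ) * (2 / δ) ≤ Real.exp (k * (2 / δ)) := by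
      linarith [Real.add_one_le_exp (k * (2 / δ))]
    calc (k.factorial : ℝ) * (2 / δ) ^ k ≤ k ^ k * (2 / δ) ^ k := by gcongr
      _ = (k * (2 / δ)) ^ k := (mul_pow _ _ _).symm
      _ ≤ Real.exp (k * (2 / δ)) ^ k := by gcongr
      _ = Real.exp (2 / δ * k ^ 2) := by rw [← Real.exp_nat_mul]; ring_nf
      _ ≤ _ := by gcongr
  gcongr

end

/-! ### From the inversion symmetry to the functional equation -/

/-- The inversion symmetry of the Bessel series on the ray through `(c, b)`. -/
def RaySymm (q α : ℝ) (β : ℂ) (a : ℕ → ℂ) (c b : ℝ) : Prop :=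
  ∀ r > 0, besselSeries q α β a (r * c) (r * b) =
    conj (besselSeries q α β a (r⁻¹ * c) (r⁻¹ * b))

lemma ExpDecay.symmDecay_besselSeries {q α : ℝ} (hq : 0 < q) {β : ℂ} {a : ℕ → ℂ}
    (ha : ∀ s : ℂ, 1 < s.re → LSeriesSummable a s) {c b : ℝ} (hb : 0 < b) {K δ : ℝ} {p : ℕ}
    (hg : ExpDecay (besselKernel α β c b) K δ p) (hδ : 0 < δ) (hp : 2 ≤ p)
    (hS : RaySymm q α β a c b) :
    SymmDecay (fun r => besselSeries q α β a (r * c) (r * b))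
      (b ^ (1 / 2 : ℝ) * ((∑' n : ℕ+, ‖a n‖ * (((n : ℕ) : ℝ) ^ p)⁻¹) *
        (K * ((2 * Real.pi / √q) ^ p)⁻¹))) (δ * (2 * Real.pi / √q)) := by
  have hl : 0 < 2 * Real.pi / √q := by positivity
  refine ⟨?_, hS, fun r hr => ?_⟩
  · refine ((hg.continuousOn_dilationSeries hδ ha hp hl).const_mul
      (((b ^ (1 / 2 : ℝ) : ℝ) : ℂ))).congr fun r hr => ?_
    exact besselSeries_eq_dilationSeries q α β a hb.le (le_of_lt hr)
  · have hr0 : 0 < r := by linarith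
    rw [besselSeries_eq_dilationSeries q α β a hb.le hr0.le, norm_mul, Complex.norm_real,
      Real.norm_of_nonneg (by positivity)]
    have hK : 0 ≤ K := by
      have := (norm_nonneg _).trans (hg.bound 1 one_pos)
      simp only [one_pow, inv_one, mul_one] at this
      exact nonneg_of_mul_nonneg_left this (Real.exp_pos _)
    have h1 : r ^ (1 / 2 : ℝ) * (r ^ p)⁻¹ ≤ 1 := by
      rw [← div_eq_mul_inv, div_le_one (by positivity), ← Real.rpow_natCast]
      refine Real.rpow_le_rpow_of_exponent_le hr ?_
      have : (2 : ℝ) ≤ p := by exact_mod_cast hp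
      linarith
    have hD : 0 ≤ ∑' n : ℕ+, ‖a n‖ * (((n : ℕ) : ℝ) ^ p)⁻¹ := tsum_nonneg fun n => by positivity
    calc b ^ (1 / 2 : ℝ) * ‖dilationSeries a (besselKernel α β c b) (2 * Real.pi / √q) r‖
        ≤ b ^ (1 / 2 : ℝ) * ((∑' n : ℕ+, ‖a n‖ * (((n : ℕ) : ℝ) ^ p)⁻¹) *
          (K * ((2 * Real.pi / √q) ^ p)⁻¹ *
            (1 * Real.exp (-(δ * (2 * Real.pi / √q) * r))))) := by
          gcongr
          refine (hg.norm_dilationSeries_le hδ ha hp hl hr0).trans ?_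
          gcongr
      _ = _ := by ring

/-- The Gamma factors may have poles with `Re s > 1`, so the identity theorem is applied after
multiplying by the entire functions `1/Γ`; they are divided out again at points that are not poles.
-/
lemma completedSeries_eq_of_eq_on_re_gt {q α : ℝ} (hq : 0 < q) {β : ℂ} {a : ℕ → ℂ}
    (ha : ∀ s : ℂ, 1 < s.re → LSeriesSummable a s) {Φ : ℂ → ℂ} (hΦ : Differentiable ℂ Φ) {p : ℝ}
    (h : ∀ s : ℂ, p < s.re → Φ s = completedSeries q α β a s) :
    IsEntireContinuation q α β a Φ := by
  refine ⟨hΦ, fun s hs h1 h2 => ?_⟩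
  have hQ : ((√q / Real.pi : ℝ) : ℂ) ≠ 0 := by
    rw [Complex.ofReal_ne_zero]; positivity
  set U : Set ℂ := {s : ℂ | 1 < s.re} with hU
  have hUo : IsOpen U := isOpen_lt continuous_const Complex.continuous_re
  set W : ℂ → ℂ := fun s => (Complex.Gamma ((α + β + 1 / 2 + s) / 2))⁻¹ *
    (Complex.Gamma ((α - β + 1 / 2 + s) / 2))⁻¹ * Φ s with hW
  set V : ℂ → ℂ := fun s => ((√q / Real.pi : ℝ) : ℂ) ^ s * LSeries a s with hV
  have hWd : DifferentiableOn ℂ W U := by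
    have g1 : Differentiable ℂ fun s : ℂ => (Complex.Gamma ((α + β + 1 / 2 + s) / 2))⁻¹ :=
      Complex.differentiable_one_div_Gamma.comp (by fun_prop)
    have g2 : Differentiable ℂ fun s : ℂ => (Complex.Gamma ((α - β + 1 / 2 + s) / 2))⁻¹ :=
      Complex.differentiable_one_div_Gamma.comp (by fun_prop)
    exact ((g1.mul g2).mul hΦ).differentiableOn
  have hVd : DifferentiableOn ℂ V U := by
    refine DifferentiableOn.mul ?_ ((LSeries_differentiableOn a).mono fun z hz => ?_)
    · exact fun z _ => ((differentiableAt_id.const_cpow (Or.inl hQ))).differentiableWithinAt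
    · have hz1 : 1 < z.re := hz
      refine lt_of_le_of_lt (LSeries.abscissaOfAbsConv_le_of_forall_lt_LSeriesSummable
        (x := 1) fun y hy => ha y (by simpa using hy)) ?_
      exact_mod_cast hz1
  have hEq : EqOn W V U := by
    refine (hWd.analyticOnNhd hUo).eqOn_of_preconnected_of_eventuallyEq (hVd.analyticOnNhd hUo)
      (convex_halfSpace_re_gt 1).isPreconnected
      (z₀ := ((max 1 (max p (|α| + ‖β‖)) + 1 : ℝ) : ℂ)) ?_ ?_
    · change 1 < ((max 1 (max p (|α| + ‖β‖)) + 1 : ℝ) : ℂ).re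
      rw [Complex.ofReal_re]
      linarith [le_max_left 1 (max p (|α| + ‖β‖))]
    · have hn : {s : ℂ | max 1 (max p (|α| + ‖β‖)) < s.re} ∈
          𝓝 ((max 1 (max p (|α| + ‖β‖)) + 1 : ℝ) : ℂ) :=
        (isOpen_lt continuous_const Complex.continuous_re).mem_nhds (by
          change _ < ((max 1 (max p (|α| + ‖β‖)) + 1 : ℝ) : ℂ).re
          rw [Complex.ofReal_re]
          exact lt_add_one _)
      filter_upwards [hn] with z hz
      have hz' : max p (|α| + ‖β‖) < z.re := lt_of_le_of_lt (le_max_right _ _) hz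
      obtain ⟨g1, g2⟩ := gamma_arg_re_pos le_rfl (lt_of_le_of_lt (le_max_right _ _) hz')
      have n1 := Complex.Gamma_ne_zero_of_re_pos g1
      have n2 := Complex.Gamma_ne_zero_of_re_pos g2
      simp only [hW, hV, h z (lt_of_le_of_lt (le_max_left _ _) hz'), completedSeries]
      generalize Complex.Gamma ((α + β + 1 / 2 + z) / 2) = G₁ at *
      generalize Complex.Gamma ((α - β + 1 / 2 + z) / 2) = G₂ at *
      field_simp
  have hs' := hEq (show s ∈ U from hs)
  simp only [hW, hV] at hs'
  have n1 := Complex.Gamma_ne_zero h1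
  have n2 := Complex.Gamma_ne_zero h2
  unfold completedSeries
  clear hEq hWd hVd hW hV W V
  generalize Complex.Gamma ((α + β + 1 / 2 + s) / 2) = G₁ at *
  generalize Complex.Gamma ((α - β + 1 / 2 + s) / 2) = G₂ at *
  field_simp at hs'
  linear_combination hs'

lemma hasFiniteOrder_of_le_exp_sq {Φ : ℂ → ℂ} {C D : ℝ} (hC : 0 ≤ C) (hD : 0 < D)
    (h : ∀ s, ‖Φ s‖ ≤ C * Real.exp (D * (‖s‖ + 3) ^ 2)) : HasFiniteOrder Φ := by
  refine ⟨3, C * Real.exp (18 * D + (2 * D) ^ 3), by norm_num, fun s => (h s).trans ?_⟩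
  rw [mul_assoc, ← Real.exp_add, show ((3 : ℝ)) = ((3 : ℕ) : ℝ) by norm_num, Real.rpow_natCast]
  gcongr
  set x := ‖s‖
  have hx : 0 ≤ x := norm_nonneg s
  push_cast
  -- Together with `(x + 3)² ≤ 2x² + 18`, this trades the constant `D` in the exponent for the order
  -- `3`.
  have h1 : 2 * D * x ^ 2 ≤ (2 * D) ^ 3 + x ^ 3 := by
    rcases le_total (2 * D) x with h2 | h2
    · have : 2 * D * x ^ 2 ≤ x * x ^ 2 := by gcongr
      have : 0 ≤ (2 * D) ^ 3 := by positivity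
      nlinarith
    · have : 2 * D * x ^ 2 ≤ 2 * D * (2 * D) ^ 2 := by gcongr
      have : 0 ≤ x ^ 3 := by positivity
      nlinarith
  nlinarith [sq_nonneg (x - 3)]

/-- At each `s` the value is the Mellin transform on a ray depending on `s`, divided by that ray's
factor. Independence of the ray makes the quotient holomorphic, and the uniform lower bound for
`rayFactor` controls its growth. -/
theorem exists_continuation_of_raySymm {q α : ℝ} (hq : 0 < q) (hα : NotNegInt α) {β : ℂ}
    (hβ : β.im = 0 ∨ β.re = 0) {a : ℕ → ℂ} (ha : ∀ s : ℂ, 1 < s.re → LSeriesSummable a s)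
    (hS : ∀ c b : ℝ, 0 < c → 0 < b → c ^ 2 + b ^ 2 = 1 → RaySymm q α β a c b) :
    ∃ Φ : ℂ → ℂ, IsEntireContinuation q α β a Φ ∧ HasFiniteOrder Φ ∧
      ∀ s : ℂ, Φ s = conj (Φ (conj (1 - s))) := by
  obtain ⟨p, hp2, hp, hker⟩ := exists_expDecay_besselKernel hα β
  -- Only rays with `b ≥ 1/2` are used, so the decay rate and `C` are common to all of them.
  obtain ⟨C, hC, hkerC⟩ := hker (1 / 2) (by norm_num)
  obtain ⟨ε, hε, hε', κ, hκ, hlow⟩ := exists_rayFactor_lower_bound hα β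
  have hl : 0 < 2 * Real.pi / √q := by positivity
  set M : ℝ → ℝ → ℂ → ℂ := fun c b s =>
    mellin (fun r => besselSeries q α β a (r * c) (r * b)) (s - 1 / 2) with hM
  set l := 2 * Real.pi / √q with hldef
  set S := ∑' n : ℕ+, ‖a n‖ * (((n : ℕ) : ℝ) ^ p)⁻¹ with hSdef
  have hS0 : 0 ≤ S := tsum_nonneg fun n => by positivity
  have hδ : (0 : ℝ) < 1 / 2 / 4 := by norm_num
  have hsd : ∀ c b : ℝ, 0 < c → 1 / 2 ≤ b → c ^ 2 + b ^ 2 = 1 →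
      SymmDecay (fun r => besselSeries q α β a (r * c) (r * b))
        (b ^ (1 / 2 : ℝ) * (S * (C * c ^ (α + 1 / 2) * (l ^ p)⁻¹))) (1 / 2 / 4 * l) :=
    fun c b hc hb hcb => (hkerC c b hc hb hcb).symmDecay_besselSeries hq ha (by linarith) hδ hp2
      (hS c b hc (by linarith) hcb)
  have hδl : 0 < 1 / 2 / 4 * l := by positivity
  have hMd : ∀ c b : ℝ, 0 < c → 1 / 2 ≤ b → c ^ 2 + b ^ 2 = 1 → Differentiable ℂ (M c b) :=
    fun c b hc hb hcb => ((hsd c b hc hb hcb).differentiable_mellin hδl).comp (by fun_prop)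
  have hMs : ∀ c b : ℝ, 0 < c → 1 / 2 ≤ b → c ^ 2 + b ^ 2 = 1 → ∀ s,
      conj (M c b (conj (1 - s))) = M c b s := fun c b hc hb hcb s => by
    have := (hsd c b hc hb hcb).mellin_conj (s - 1 / 2)
    have h2 : conj (2 : ℂ) = 2 := map_ofNat (starRingEnd ℂ) 2
    simp only [hM]
    rw [← this]
    congr 2
    simp only [map_sub, map_one, map_div₀, h2]
    ring
  have hMF : ∀ c b : ℝ, 0 < c → 1 / 2 ≤ b → c ^ 2 + b ^ 2 = 1 → ∀ s : ℂ, p < s.re →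
      M c b s = rayConst α c b * rayFactor α β c b s * completedSeries q α β a s :=
    fun c b hc hb hcb s hs => mellin_besselSeries hq hα ha hc (by linarith) hcb
      (hkerC c b hc hb hcb) hδ hp2 hp hs
  -- Agreement of two rays in cross-multiplied form, valid also where one of the factors vanishes.
  have hcons : ∀ c b c' b' : ℝ, 0 < c → 1 / 2 ≤ b → c ^ 2 + b ^ 2 = 1 → 0 < c' → 1 / 2 ≤ b' →
      c' ^ 2 + b' ^ 2 = 1 → ∀ s, M c b s * (rayConst α c' b' * rayFactor α β c' b' s) =
        M c' b' s * (rayConst α c b * rayFactor α β c b s) := by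
    intro c b c' b' hc hb hcb hc' hb' hcb'
    refine congrFun (eq_of_eq_on_re_gt (p := p)
      ((hMd c b hc hb hcb).mul ((differentiable_rayFactor hα β
        (sq_lt_one_of_add_sq (by linarith) hcb')).const_mul _))
      ((hMd c' b' hc' hb' hcb').mul ((differentiable_rayFactor hα β
        (sq_lt_one_of_add_sq (by linarith) hcb)).const_mul _)) fun s hs => ?_)
    rw [hMF c b hc hb hcb s hs, hMF c' b' hc' hb' hcb' s hs]
    ring
  set X : ℂ → ℝ := fun s => |α| + ‖β‖ + 3 + ‖s‖ with hX
  have hX1 : ∀ s, 1 ≤ X s := fun s => by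
    have h1 := abs_nonneg α
    have h2 := norm_nonneg β
    have h3 := norm_nonneg s
    simp only [hX]; linarith
  -- The choice makes `X² c² = ε`, the limiting case of the lower bound; `ε ≤ 1/4` then forces `b ≥
  -- 1/2`.
  set c : ℂ → ℝ := fun s => √ε / X s with hc
  set b : ℂ → ℝ := fun s => √(1 - c s ^ 2) with hb
  have hXpos : ∀ s, 0 < X s := fun s => lt_of_lt_of_le one_pos (hX1 s)
  have hc0 : ∀ s, 0 < c s := fun s => div_pos (Real.sqrt_pos.2 hε) (hXpos s)
  have hcX : ∀ s, X s ^ 2 * c s ^ 2 = ε := fun s => by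
    have := (hXpos s).ne'
    simp only [hc]
    rw [div_pow, Real.sq_sqrt hε.le]
    field_simp
  have hc2 : ∀ s, c s ^ 2 ≤ 1 / 4 := fun s => by
    have h1 : 1 ≤ X s ^ 2 := one_le_pow₀ (hX1 s)
    nlinarith [hcX s, sq_nonneg (c s)]
  have hcb : ∀ s, c s ^ 2 + b s ^ 2 = 1 := fun s => by
    simp only [hb]
    rw [Real.sq_sqrt (by linarith [hc2 s])]; ring
  have hb2 : ∀ s, 1 / 2 ≤ b s := fun s => by
    simp only [hb]
    exact Real.le_sqrt_of_sq_le (by linarith [hc2 s])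
  have hb1 : ∀ s, b s ≤ 1 := fun s => Real.sqrt_le_one.2 (by linarith [sq_nonneg (c s)])
  have hbpos : ∀ s, 0 < b s := fun s => by linarith [hb2 s]
  have hR : ∀ s, κ ≤ ‖rayFactor α β (c s) (b s) s‖ := fun s =>
    hlow _ _ s (hb2 s) (hb1 s) (hcX s).le
  have hk : ∀ c b : ℝ, 0 < c → 1 / 2 ≤ b → ((rayConst α c b : ℝ) : ℂ) ≠ 0 := fun c b h1 h2 =>
    Complex.ofReal_ne_zero.2 (rayConst_pos α h1 (by linarith)).ne'
  have hR0 : ∀ s, rayFactor α β (c s) (b s) s ≠ 0 := fun s =>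
    norm_pos_iff.1 (lt_of_lt_of_le hκ (hR s))
  set Φ : ℂ → ℂ := fun s =>
    M (c s) (b s) s / (rayConst α (c s) (b s) * rayFactor α β (c s) (b s) s) with hΦ
  have hΦeq : ∀ c' b' : ℝ, 0 < c' → 1 / 2 ≤ b' → c' ^ 2 + b' ^ 2 = 1 → ∀ s,
      Φ s * (rayConst α c' b' * rayFactor α β c' b' s) = M c' b' s := by
    intro c' b' hc' hb' hcb' s
    have h1 := hk _ _ (hc0 s) (hb2 s)
    have h2 := hR0 s
    simp only [hΦ]
    rw [div_mul_eq_mul_div, div_eq_iff (mul_ne_zero h1 h2)]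
    exact hcons _ _ _ _ (hc0 s) (hb2 s) (hcb s) hc' hb' hcb' s
  refine ⟨Φ, ?_, ?_, fun s => ?_⟩
  · refine completedSeries_eq_of_eq_on_re_gt hq ha (p := p) (fun s₀ => ?_) fun s hs => ?_
    -- The chosen ray varies with `s`, but near `s₀` the quotient may be computed on the fixed ray
    -- of `s₀`, whose factor stays nonzero there.
    · have hd := differentiable_rayFactor hα β (b := b s₀)
        (sq_lt_one_of_add_sq (hbpos s₀) (hcb s₀))
      have hne : ∀ᶠ s in 𝓝 s₀, rayFactor α β (c s₀) (b s₀) s ≠ 0 :=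
        hd.continuous.continuousAt.eventually_ne (hR0 s₀)
      have h1 := hk _ _ (hc0 s₀) (hb2 s₀)
      have : Φ =ᶠ[𝓝 s₀] fun s => M (c s₀) (b s₀) s /
          (rayConst α (c s₀) (b s₀) * rayFactor α β (c s₀) (b s₀) s) := by
        filter_upwards [hne] with s hs
        rw [eq_div_iff (mul_ne_zero h1 hs)]
        exact hΦeq _ _ (hc0 s₀) (hb2 s₀) (hcb s₀) s
      exact ((hMd _ _ (hc0 s₀) (hb2 s₀) (hcb s₀) s₀).div ((hd s₀).const_mul _)
        (mul_ne_zero h1 (hR0 s₀))).congr_of_eventuallyEq this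
    · have h1 := hk _ _ (hc0 s) (hb2 s)
      simp only [hΦ]
      rw [hMF _ _ (hc0 s) (hb2 s) (hcb s) s hs, mul_div_cancel_left₀ _ (mul_ne_zero h1 (hR0 s))]
  · refine hasFiniteOrder_of_le_exp_sq (C := 2 ^ (3 / 2 : ℝ) * (S * (C * (l ^ p)⁻¹)) *
      Real.exp (1 / 2 / 4 * l) * (2 / (1 / 2 / 4 * l)) / κ) (D := 2 / (1 / 2 / 4 * l))
      (by positivity) (by positivity) fun s => ?_
    -- The decay constant and `rayConst` contain the same factor `b^{1/2} c^{α+1/2}`, so the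
    -- smallness of `c` does no harm.
    have h1 := (hsd _ _ (hc0 s) (hb2 s) (hcb s)).norm_mellin_le hδl (s - 1 / 2)
    have h2 := rayConst_pos α (hc0 s) (hbpos s)
    have hcs := hc0 s
    have hbs := hbpos s
    have h3 : ‖s - 1 / 2‖ ≤ ‖s‖ + 1 := (norm_sub_le _ _).trans (by gcongr; norm_num)
    simp only [hΦ]
    rw [norm_div, norm_mul, Complex.norm_real, Real.norm_of_nonneg h2.le,
      div_le_iff₀ (mul_pos h2 (norm_pos_iff.2 (hR0 s)))]
    have h4 : (2 : ℝ) ^ (3 / 2 : ℝ) * 2 ^ (-(3 / 2) : ℝ) = 1 := by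
      rw [← Real.rpow_add two_pos]; norm_num
    calc ‖M (c s) (b s) s‖ ≤ _ := h1
      _ ≤ b s ^ (1 / 2 : ℝ) * (S * (C * c s ^ (α + 1 / 2) * (l ^ p)⁻¹)) *
          Real.exp (2 / (1 / 2 / 4 * l) * (‖s‖ + 3) ^ 2) * Real.exp (1 / 2 / 4 * l) *
          (2 / (1 / 2 / 4 * l)) * 1 := by
        rw [mul_one]
        gcongr ?_ * Real.exp (_ * ?_ ^ 2) * _ * _
        linarith
      _ ≤ b s ^ (1 / 2 : ℝ) * (S * (C * c s ^ (α + 1 / 2) * (l ^ p)⁻¹)) *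
          Real.exp (2 / (1 / 2 / 4 * l) * (‖s‖ + 3) ^ 2) * Real.exp (1 / 2 / 4 * l) *
          (2 / (1 / 2 / 4 * l)) * (‖rayFactor α β (c s) (b s) s‖ / κ) := by
        have : 1 ≤ ‖rayFactor α β (c s) (b s) s‖ / κ := (one_le_div hκ).2 (hR s)
        gcongr
      _ = ((2 : ℝ) ^ (3 / 2 : ℝ) * 2 ^ (-(3 / 2) : ℝ)) * (b s ^ (1 / 2 : ℝ) *
          (S * (C * c s ^ (α + 1 / 2) * (l ^ p)⁻¹)) *
          Real.exp (2 / (1 / 2 / 4 * l) * (‖s‖ + 3) ^ 2) * Real.exp (1 / 2 / 4 * l) *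
          (2 / (1 / 2 / 4 * l)) * (‖rayFactor α β (c s) (b s) s‖ / κ)) := by rw [h4, one_mul]
      _ = _ := by unfold rayConst; ring
  · have h1 := hk _ _ (hc0 s) (hb2 s)
    have e1 := hΦeq _ _ (hc0 s) (hb2 s) (hcb s) s
    have e2 := congrArg conj (hΦeq _ _ (hc0 s) (hb2 s) (hcb s) (conj (1 - s)))
    rw [hMs _ _ (hc0 s) (hb2 s) (hcb s), map_mul, map_mul, Complex.conj_ofReal,
      conj_rayFactor_one_sub hα hβ (hc0 s) (hbpos s) (hcb s), ← e1] at e2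
    exact (mul_right_cancel₀ (mul_ne_zero h1 (hR0 s)) e2).symm

/-! ### Decay of the Mellin transform of the kernel on vertical lines -/

/-- The product `c_γ(l r²) K^{(j)}(b r)`, up to sign, where `c_γ` is the function `cliff γ`. -/
def cliffKernel (β : ℂ) (l b γ : ℝ) (j : ℕ) (r : ℝ) : ℂ :=
  (cliff γ (l * r ^ 2) : ℂ) * besselKMoment β j (b * r)

lemma hasDerivAt_cliffKernel (β : ℂ) {l b γ : ℝ} (h : NotNegInt γ) (hb : 0 < b) (j : ℕ) {r : ℝ}
    (hr : 0 < r) : HasDerivAt (cliffKernel β l b γ j)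
      (-(2 * l * r * cliffKernel β l b (γ + 1) j r + b * cliffKernel β l b γ (j + 1) r)) r := by
  have h1 : HasDerivAt (fun r : ℝ => cliff γ (l * r ^ 2))
      (-cliff (γ + 1) (l * r ^ 2) * (l * (2 * r))) r := by
    have h2 : HasDerivAt (fun r : ℝ => l * r ^ 2) (l * (2 * r)) r := by
      simpa using (hasDerivAt_pow 2 r).const_mul l
    exact (hasDerivAt_cliff h (l * r ^ 2)).comp r h2
  have h3 : HasDerivAt (fun r : ℝ => besselKMoment β j (b * r))
      (b • -besselKMoment β (j + 1) (b * r)) r := by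
    have h4 : HasDerivAt (fun r : ℝ => b * r) b r := by simpa using (hasDerivAt_id r).const_mul b
    exact (hasDerivAt_besselKMoment β j (mul_pos hb hr)).scomp r h4
  refine (h1.ofReal_comp.mul h3).congr_deriv ?_
  unfold cliffKernel
  rw [Complex.real_smul]
  push_cast
  ring

lemma exists_expDecay_cliffKernel (β : ℂ) {l b γ : ℝ} (h : NotNegInt γ) (hl : 0 ≤ l) (hb : 0 < b)
    (j : ℕ) : ∃ K : ℝ, ∃ p : ℕ, ExpDecay (cliffKernel β l b γ j) K (b / 4) p := by
  obtain ⟨C₁, hC₁, M, hM⟩ := exists_cliff_bound h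
  obtain ⟨C₂, hC₂, N, hN⟩ := exists_besselKMoment_bound β j
  obtain ⟨C₃, hC₃, hexp⟩ := exists_one_add_pow_le_exp (δ := b / 4) (by positivity) (2 * M)
  refine ⟨C₁ * (1 + l) ^ M * C₂ * (b ^ N)⁻¹ * C₃, N, fun r hr =>
    (hasDerivAt_cliffKernel β h hb j hr).continuousAt.continuousWithinAt, fun r hr => ?_⟩
  have h1 : |cliff γ (l * r ^ 2)| ≤ C₁ * (1 + l) ^ M * (C₃ * Real.exp (b / 4 * r)) := by
    refine (hM _ (by positivity)).trans ?_
    have h2 : 1 + l * r ^ 2 ≤ (1 + l) * (1 + r) ^ 2 := by nlinarith [mul_nonneg hl hr.le]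
    calc C₁ * (1 + l * r ^ 2) ^ M ≤ C₁ * ((1 + l) * (1 + r) ^ 2) ^ M := by gcongr
      _ = C₁ * (1 + l) ^ M * (1 + r) ^ (2 * M) := by rw [mul_pow, ← pow_mul]; ring
      _ ≤ _ := by gcongr; exact hexp r hr.le
  rw [cliffKernel, norm_mul, Complex.norm_real, Real.norm_eq_abs]
  have hexp2 : Real.exp (-(b / 4 * r)) = Real.exp (b / 4 * r) * Real.exp (-(b * r / 2)) := by
    rw [← Real.exp_add]; ring_nf
  rw [hexp2]
  calc _ ≤ (C₁ * (1 + l) ^ M * (C₃ * Real.exp (b / 4 * r))) *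
        (C₂ * ((b * r) ^ N)⁻¹ * Real.exp (-(b * r / 2))) := by
        gcongr; exact hN _ (by positivity)
    _ = _ := by rw [mul_pow, mul_inv]; ring

lemma ExpDecay.norm_cpow_mul_le {g : ℝ → ℂ} {K δ : ℝ} {p : ℕ} (hg : ExpDecay g K δ p) {z : ℂ}
    {r : ℝ} (hr : 0 < r) :
    ‖(r : ℂ) ^ z * g r‖ ≤ K * (r ^ (z.re - p) * Real.exp (-(δ * r))) := by
  rw [norm_mul, Complex.norm_cpow_eq_rpow_re_of_pos hr, Real.rpow_sub hr, Real.rpow_natCast]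
  calc r ^ z.re * ‖g r‖ ≤ r ^ z.re * (K * (r ^ p)⁻¹ * Real.exp (-(δ * r))) := by
        gcongr; exact hg.bound r hr
    _ = _ := by rw [div_eq_mul_inv]; ring

lemma ExpDecay.tendsto_atTop {g : ℝ → ℂ} {K δ : ℝ} {p : ℕ} (hg : ExpDecay g K δ p) (hδ : 0 < δ)
    (z : ℂ) : Tendsto (fun r : ℝ => (r : ℂ) ^ z * g r) atTop (𝓝 0) := by
  have h1 := (tendsto_rpow_mul_exp_neg_mul_atTop_nhds_zero (z.re - p) δ hδ).const_mul K
  rw [mul_zero] at h1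
  refine squeeze_zero_norm' ?_ h1
  filter_upwards [eventually_gt_atTop 0] with r hr
  rw [neg_mul]
  exact hg.norm_cpow_mul_le hr

lemma ExpDecay.continuousWithinAt_zero {g : ℝ → ℂ} {K δ : ℝ} {p : ℕ} (hg : ExpDecay g K δ p)
    (hδ : 0 < δ) {z : ℂ} (hz : p < z.re) :
    ContinuousWithinAt (fun r : ℝ => (r : ℂ) ^ z * g r) (Ici 0) 0 := by
  have hz0 : z ≠ 0 := fun h => by
    rw [h, Complex.zero_re] at hz
    exact absurd hz (not_lt.2 p.cast_nonneg)
  have hK : 0 ≤ K := by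
    have := (norm_nonneg _).trans (hg.bound 1 one_pos)
    simp only [one_pow, inv_one, mul_one] at this
    exact nonneg_of_mul_nonneg_left this (Real.exp_pos _)
  have h1 : Tendsto (fun r : ℝ => K * r ^ (z.re - p)) (𝓝[≥] 0) (𝓝 0) := by
    have := ((Real.continuous_rpow_const (by linarith : 0 ≤ z.re - p)).tendsto 0).const_mul K
    rw [Real.zero_rpow (by linarith), mul_zero] at this
    exact this.mono_left nhdsWithin_le_nhds
  rw [ContinuousWithinAt]
  simp only [Complex.ofReal_zero, Complex.zero_cpow hz0, zero_mul]
  refine squeeze_zero_norm' ?_ h1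
  filter_upwards [self_mem_nhdsWithin] with r hr
  rcases (mem_Ici.1 hr).eq_or_lt with h | h
  · rw [← h, Complex.ofReal_zero, Complex.zero_cpow hz0, zero_mul, norm_zero,
      Real.zero_rpow (by linarith), mul_zero]
  · refine (hg.norm_cpow_mul_le h).trans ?_
    have : Real.exp (-(δ * r)) ≤ 1 := Real.exp_le_one_iff.2 (by nlinarith)
    have h2 : 0 ≤ r ^ (z.re - p) := by positivity
    gcongr
    nlinarith

/-- Integration by parts: the derivative of `r^z` times the kernel has integral zero. The family of
kernels is closed under differentiation, which raises either `γ` or `j`. -/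
lemma mul_mellin_cliffKernel (β : ℂ) {l b γ : ℝ} (h : NotNegInt γ) (hl : 0 ≤ l) (hb : 0 < b)
    (j : ℕ) : ∃ σ₀ : ℝ, ∀ z : ℂ, σ₀ < z.re → z * mellin (cliffKernel β l b γ j) z =
      2 * l * mellin (cliffKernel β l b (γ + 1) j) (z + 2) +
        b * mellin (cliffKernel β l b γ (j + 1)) (z + 1) := by
  obtain ⟨K₀, p₀, h₀⟩ := exists_expDecay_cliffKernel β h hl hb j
  obtain ⟨K₁, p₁, h₁⟩ := exists_expDecay_cliffKernel β h.add_one hl hb j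
  obtain ⟨K₂, p₂, h₂⟩ := exists_expDecay_cliffKernel β h hl hb (j + 1)
  have hδ : 0 < b / 4 := by positivity
  refine ⟨p₀ + p₁ + p₂, fun z hz => ?_⟩
  have q₀ : (0 : ℝ) ≤ p₀ := p₀.cast_nonneg
  have q₁ : (0 : ℝ) ≤ p₁ := p₁.cast_nonneg
  have q₂ : (0 : ℝ) ≤ p₂ := p₂.cast_nonneg
  have c₀ : MellinConvergent _ z := h₀.mellinConvergent hδ (by linarith)
  have c₁ : MellinConvergent _ (z + 2) := h₁.mellinConvergent hδ (by
    rw [Complex.add_re, Complex.re_ofNat]; linarith)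
  have c₂ : MellinConvergent _ (z + 1) := h₂.mellinConvergent hδ (by
    rw [Complex.add_re, Complex.one_re]; linarith)
  set f' : ℝ → ℂ := fun r => z * ((r : ℂ) ^ (z - 1) • cliffKernel β l b γ j r) -
    (2 * l * ((r : ℂ) ^ (z + 2 - 1) • cliffKernel β l b (γ + 1) j r) +
      b * ((r : ℂ) ^ (z + 1 - 1) • cliffKernel β l b γ (j + 1) r)) with hf'
  have hz0 : z ≠ 0 := fun h => by
    rw [h, Complex.zero_re] at hz
    linarith
  have hder : ∀ r ∈ Ioi (0 : ℝ),
      HasDerivAt (fun r : ℝ => (r : ℂ) ^ z * cliffKernel β l b γ j r) (f' r) r := fun r hr => by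
    have hr0 : (r : ℂ) ≠ 0 := Complex.ofReal_ne_zero.2 (ne_of_gt hr)
    have e1 := hasDerivAt_ofReal_cpow_const' (r := z - 1) (ne_of_gt hr) (by
      intro h; exact hz0 (by linear_combination h))
    have e1 : HasDerivAt (fun r : ℝ => (r : ℂ) ^ z) (z * (r : ℂ) ^ (z - 1)) r := by
      refine (e1.const_mul z).congr_deriv ?_ |>.congr_of_eventuallyEq ?_
      · rfl
      · refine Eventually.of_forall fun y => ?_
        simp only [sub_add_cancel]
        field_simp
    refine (e1.mul (hasDerivAt_cliffKernel β h hb j hr)).congr_deriv ?_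
    simp only [hf', smul_eq_mul]
    rw [show z + 2 - 1 = z + 1 by ring, Complex.cpow_add _ _ hr0, Complex.cpow_one,
      add_sub_cancel_right]
    ring
  have i₀ := c₀.const_mul z
  have i₁ := c₁.const_mul (2 * (l : ℂ))
  have i₂ := c₂.const_mul (b : ℂ)
  have key := integral_Ioi_of_hasDerivAt_of_tendsto (h₀.continuousWithinAt_zero hδ
    (by linarith)) hder (i₀.sub (i₁.add i₂)) (h₀.tendsto_atTop hδ z)
  have e : ∫ r in Ioi (0 : ℝ), f' r = z * mellin (cliffKernel β l b γ j) z -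
      (2 * l * mellin (cliffKernel β l b (γ + 1) j) (z + 2) +
        b * mellin (cliffKernel β l b γ (j + 1)) (z + 1)) := by
    simp only [hf', mellin]
    exact (integral_sub i₀ (i₁.add i₂)).trans (congrArg₂ _ (integral_const_mul _ _)
      ((integral_add i₁ i₂).trans (congrArg₂ _ (integral_const_mul _ _) (integral_const_mul _ _))))
  rw [e, Complex.ofReal_zero, Complex.zero_cpow hz0] at key
  linear_combination key

lemma exists_mellin_cliffKernel_decay (β : ℂ) {l b : ℝ} (hl : 0 ≤ l) (hb : 0 < b) (k : ℕ) {γ : ℝ}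
    (h : NotNegInt γ) (j : ℕ) : ∃ σ₀ : ℝ, ∀ σ > σ₀, ∃ C : ℝ, ∀ z : ℂ, z.re = σ →
      ‖z‖ ^ k * ‖mellin (cliffKernel β l b γ j) z‖ ≤ C := by
  induction k generalizing γ j with
  | zero =>
    obtain ⟨K, p, hg⟩ := exists_expDecay_cliffKernel β h hl hb j
    refine ⟨p, fun σ hσ => ⟨∫ r in Ioi (0 : ℝ), r ^ (σ - 1) * ‖cliffKernel β l b γ j r‖,
      fun z hz => ?_⟩⟩
    rw [pow_zero, one_mul]
    refine (norm_integral_le_integral_norm _).trans (le_of_eq ?_)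
    refine setIntegral_congr_fun measurableSet_Ioi fun r hr => ?_
    simp only [norm_smul]
    rw [Complex.norm_cpow_eq_rpow_re_of_pos hr, Complex.sub_re, Complex.one_re, hz]
  | succ k ih =>
    obtain ⟨σ₀, h₀⟩ := mul_mellin_cliffKernel β h hl hb j
    obtain ⟨σ₁, h₁⟩ := ih h.add_one j
    obtain ⟨σ₂, h₂⟩ := ih h (j + 1)
    refine ⟨max (max σ₀ 0) (max σ₁ σ₂), fun σ hσ => ?_⟩
    obtain ⟨C₁, hC₁⟩ := h₁ (σ + 2) (by
      linarith [le_max_left σ₁ σ₂, le_max_right (max σ₀ 0) (max σ₁ σ₂)])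
    obtain ⟨C₂, hC₂⟩ := h₂ (σ + 1) (by
      linarith [le_max_right σ₁ σ₂, le_max_right (max σ₀ 0) (max σ₁ σ₂)])
    have hσ0 : 0 < σ := by linarith [le_max_right σ₀ 0, le_max_left (max σ₀ 0) (max σ₁ σ₂)]
    refine ⟨2 * l * C₁ + b * C₂, fun z hz => ?_⟩
    have e := h₀ z (by
      rw [hz]; linarith [le_max_left σ₀ 0, le_max_left (max σ₀ 0) (max σ₁ σ₂)])
    -- As `Re z > 0`, the bounds at `z + 1` and `z + 2` may be weighted by powers of `‖z‖`.
    have hle : ∀ t : ℝ, 0 ≤ t → ‖z‖ ≤ ‖z + t‖ := fun t ht => by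
      rw [Complex.norm_def, Complex.norm_def]
      refine Real.sqrt_le_sqrt ?_
      rw [Complex.normSq_apply, Complex.normSq_apply, Complex.add_re, Complex.add_im,
        Complex.ofReal_re, Complex.ofReal_im, hz]
      nlinarith
    have n₂ : ‖z‖ ≤ ‖z + 2‖ := by simpa using hle 2 (by norm_num)
    have n₁ : ‖z‖ ≤ ‖z + 1‖ := by simpa using hle 1 (by norm_num)
    have b₁ := hC₁ (z + 2) (by rw [Complex.add_re, hz, Complex.re_ofNat])
    have b₂ := hC₂ (z + 1) (by rw [Complex.add_re, hz, Complex.one_re])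
    calc ‖z‖ ^ (k + 1) * ‖mellin (cliffKernel β l b γ j) z‖
        = ‖z‖ ^ k * ‖z * mellin (cliffKernel β l b γ j) z‖ := by rw [norm_mul]; ring
      _ ≤ ‖z‖ ^ k * (2 * l * ‖mellin (cliffKernel β l b (γ + 1) j) (z + 2)‖ +
          b * ‖mellin (cliffKernel β l b γ (j + 1)) (z + 1)‖) := by
        rw [e]
        gcongr
        refine (norm_add_le _ _).trans (le_of_eq ?_)
        rw [norm_mul, norm_mul, norm_mul, Complex.norm_ofNat, Complex.norm_real,
          Complex.norm_real, Real.norm_of_nonneg hl, Real.norm_of_nonneg hb.le]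
      _ = 2 * l * (‖z‖ ^ k * ‖mellin (cliffKernel β l b (γ + 1) j) (z + 2)‖) +
          b * (‖z‖ ^ k * ‖mellin (cliffKernel β l b γ (j + 1)) (z + 1)‖) := by ring
      _ ≤ 2 * l * (‖z + 2‖ ^ k * ‖mellin (cliffKernel β l b (γ + 1) j) (z + 2)‖) +
          b * (‖z + 1‖ ^ k * ‖mellin (cliffKernel β l b γ (j + 1)) (z + 1)‖) := by gcongr
      _ ≤ _ := by gcongr

lemma mellin_besselKernel_eq (α : ℝ) (β : ℂ) {c : ℝ} (hc : 0 < c) (b : ℝ) (s : ℂ) :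
    mellin (besselKernel α β c b) s = ((c ^ (α + 1 / 2) * 2 ^ (-α) : ℝ) : ℂ) *
      mellin (cliffKernel β (c ^ 2 / 4) b α 0) (s + (α + 1 / 2)) := by
  simp_rw [mellin]
  rw [← integral_const_mul]
  refine setIntegral_congr_fun measurableSet_Ioi fun r hr => ?_
  have hr' : (0 : ℝ) < r := hr
  have hr0 : (r : ℂ) ≠ 0 := Complex.ofReal_ne_zero.2 hr'.ne'
  have e1 : besselH α (c * r) =
      c ^ (α + 1 / 2) * 2 ^ (-α) * (r ^ (α + 1 / 2) * cliff α (c ^ 2 / 4 * r ^ 2)) := by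
    rw [besselH, besselJ_eq_cliff α (mul_pos hc hr'), Real.div_rpow (by positivity) zero_le_two,
      Real.mul_rpow hc.le hr'.le, Real.mul_rpow hc.le hr'.le, Real.rpow_add hc, Real.rpow_add hr',
      Real.rpow_neg zero_le_two, show (c * r) ^ 2 / 4 = c ^ 2 / 4 * r ^ 2 by ring]
    ring
  have e2 : ((r ^ (α + 1 / 2) : ℝ) : ℂ) = (r : ℂ) ^ (α + 1 / 2 : ℂ) := by
    rw [Complex.ofReal_cpow hr'.le]; push_cast; rfl
  simp only [besselKernel, cliffKernel, besselKMoment_zero, smul_eq_mul, e1]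
  rw [show s + (α + 1 / 2) - 1 = (s - 1) + (α + 1 / 2 : ℂ) by ring, Complex.cpow_add _ _ hr0,
    Complex.ofReal_mul, Complex.ofReal_mul (r ^ (α + 1 / 2)), e2]
  ring

lemma exists_mellin_besselKernel_decay {α : ℝ} (h : NotNegInt α) (β : ℂ) {c b : ℝ} (hc : 0 < c)
    (hb : 0 < b) : ∃ σ₀ : ℝ, ∀ σ > σ₀, ∃ C : ℝ, ∀ s : ℂ, s.re = σ →
      (1 + s.im ^ 2) * ‖mellin (besselKernel α β c b) s‖ ≤ C := by
  obtain ⟨σ₀, hσ₀⟩ := exists_mellin_cliffKernel_decay β (l := c ^ 2 / 4) (by positivity) hb 2 h 0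
  refine ⟨|σ₀| + |α| + 1, fun σ hσ => ?_⟩
  have a1 := neg_abs_le α
  have a2 := le_abs_self σ₀
  have a3 := abs_nonneg σ₀
  obtain ⟨C, hC⟩ := hσ₀ (σ + (α + 1 / 2)) (by linarith)
  refine ⟨4 * (c ^ (α + 1 / 2) * 2 ^ (-α)) * C, fun s hs => ?_⟩
  have hre : (s + (α + 1 / 2 : ℂ)).re = σ + (α + 1 / 2) := by simp [hs]
  have him : (s + (α + 1 / 2 : ℂ)).im = s.im := by simp
  have h1 := hC _ hre
  have h2 : 1 + s.im ^ 2 ≤ 4 * ‖s + (α + 1 / 2 : ℂ)‖ ^ 2 := by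
    rw [← Complex.normSq_eq_norm_sq, Complex.normSq_apply, hre, him]
    have : 1 / 2 ≤ σ + (α + 1 / 2) := by linarith
    nlinarith [sq_nonneg s.im]
  rw [mellin_besselKernel_eq α β hc, norm_mul, Complex.norm_real,
    Real.norm_of_nonneg (by positivity)]
  calc _ ≤ (4 * ‖s + (α + 1 / 2 : ℂ)‖ ^ 2) * (c ^ (α + 1 / 2) * 2 ^ (-α) *
        ‖mellin (cliffKernel β (c ^ 2 / 4) b α 0) (s + (α + 1 / 2))‖) := by gcongr
    _ = 4 * (c ^ (α + 1 / 2) * 2 ^ (-α)) * (‖s + (α + 1 / 2 : ℂ)‖ ^ 2 *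
        ‖mellin (cliffKernel β (c ^ 2 / 4) b α 0) (s + (α + 1 / 2))‖) := by ring
    _ ≤ 4 * (c ^ (α + 1 / 2) * 2 ^ (-α)) * C := by gcongr

/-! ### Vertical strips -/

lemma norm_le_add_abs_im {d : ℝ} {z : ℂ} (hz : |z.re| ≤ d) : ‖z‖ ≤ d + |z.im| :=
  (Complex.norm_le_abs_re_add_abs_im z).trans (by gcongr)

/-- Quadratic decay on the boundary of a vertical strip propagates to the strip. -/
lemma exists_strip_decay {Ψ : ℂ → ℂ} (hΨ : Differentiable ℂ Ψ) {d A B C : ℝ} (hd : 0 < d)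
    (hB : 0 ≤ B) {N : ℕ} (hN : 1 ≤ N)
    (hgrowth : ∀ z, ‖Ψ z‖ ≤ A * Real.exp (B * (1 + ‖z‖) ^ N))
    (hline : ∀ z : ℂ, |z.re| = d → (1 + z.im ^ 2) * ‖Ψ z‖ ≤ C) :
    ∃ C' : ℝ, 0 ≤ C' ∧ ∀ z : ℂ, |z.re| ≤ d → (1 + z.im ^ 2) * ‖Ψ z‖ ≤ C' := by
  have hA : 0 ≤ A := by
    have := (norm_nonneg _).trans (hgrowth 0)
    exact nonneg_of_mul_nonneg_left this (Real.exp_pos _)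
  have hC : 0 ≤ C := by
    refine le_trans ?_ (hline (d : ℂ) (by simp [abs_of_pos hd]))
    positivity
  -- A multiplier comparable to `1 + (Im z)²` on the strip, its zeros `±2d` lying outside; the
  -- product `Ψ P` need only be shown bounded.
  set P : ℂ → ℂ := fun z => (z + 2 * d) * (z - 2 * d) with hP
  have hPd : Differentiable ℂ P := by simp only [hP]; fun_prop
  have hPle : ∀ z, ‖P z‖ ≤ (‖z‖ + 2 * d) ^ 2 := fun z => by
    have h2 : ‖(2 * d : ℂ)‖ = 2 * d := by
      rw [norm_mul, Complex.norm_ofNat, Complex.norm_real, Real.norm_of_nonneg hd.le]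
    simp only [hP]
    rw [norm_mul, sq]
    gcongr
    · exact (norm_add_le _ _).trans (by rw [h2])
    · exact (norm_sub_le _ _).trans (by rw [h2])
  have hPge : ∀ z : ℂ, |z.re| ≤ d → d ^ 2 + z.im ^ 2 ≤ ‖P z‖ := fun z hz => by
    obtain ⟨h1, h2⟩ := abs_le.1 hz
    have e1 : √(d ^ 2 + z.im ^ 2) ≤ ‖z + 2 * d‖ := by
      rw [Complex.norm_def, Complex.normSq_apply]
      refine Real.sqrt_le_sqrt ?_
      simp
      nlinarith
    have e2 : √(d ^ 2 + z.im ^ 2) ≤ ‖z - 2 * d‖ := by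
      rw [Complex.norm_def, Complex.normSq_apply]
      refine Real.sqrt_le_sqrt ?_
      simp
      nlinarith
    simp only [hP]
    rw [norm_mul]
    calc d ^ 2 + z.im ^ 2 = √(d ^ 2 + z.im ^ 2) * √(d ^ 2 + z.im ^ 2) :=
          (Real.mul_self_sqrt (by positivity)).symm
      _ ≤ _ := by gcongr
  set C₁ := (1 + 3 * d) ^ 2 * (2 * C) with hC₁
  have hbd : ∀ z : ℂ, |z.re| = d → ‖Ψ z * P z‖ ≤ C₁ := fun z hz => by
    have h1 := norm_le_add_abs_im hz.le
    have h2 : (‖z‖ + 2 * d) ^ 2 ≤ (1 + 3 * d) ^ 2 * (2 * (1 + z.im ^ 2)) := by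
      have h3 : ‖z‖ + 2 * d ≤ (1 + 3 * d) * (1 + |z.im|) := by nlinarith [abs_nonneg z.im]
      have h4 : (1 + |z.im|) ^ 2 ≤ 2 * (1 + z.im ^ 2) := by
        nlinarith [sq_abs z.im, sq_nonneg (|z.im| - 1)]
      calc (‖z‖ + 2 * d) ^ 2 ≤ ((1 + 3 * d) * (1 + |z.im|)) ^ 2 := by gcongr
        _ = (1 + 3 * d) ^ 2 * (1 + |z.im|) ^ 2 := mul_pow _ _ _
        _ ≤ _ := by gcongr
    rw [norm_mul]
    calc ‖Ψ z‖ * ‖P z‖ ≤ ‖Ψ z‖ * ((1 + 3 * d) ^ 2 * (2 * (1 + z.im ^ 2))) := by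
          gcongr; exact (hPle z).trans h2
      _ = (1 + 3 * d) ^ 2 * (2 * ((1 + z.im ^ 2) * ‖Ψ z‖)) := by ring
      _ ≤ _ := by rw [hC₁]; gcongr; exact hline z hz
  obtain ⟨C₃, hC₃, hexp⟩ := exists_one_add_pow_le_exp (δ := 1 / (2 * d)) (by positivity) N
  have hstrip : ∀ z : ℂ, |z.re| ≤ d → ‖Ψ z * P z‖ ≤ C₁ := fun z hz => by
    refine PhragmenLindelof.vertical_strip (f := fun z => Ψ z * P z) (a := -d) (b := d)
      (hΨ.mul hPd).diffContOnCl ?_ (fun z hz => hbd z (by rw [hz, abs_neg, abs_of_pos hd]))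
      (fun z hz => hbd z (by rw [hz, abs_of_pos hd])) (abs_le.1 hz).1 (abs_le.1 hz).2
    -- The critical rate for a strip of width `2d` is `π/(2d)`. Growth `exp(|z|^N)` lies below any
    -- double exponential, so the rate `1/(2d)` works.
    refine ⟨1 / (2 * d), ?_, (B + 2) * ((1 + d) ^ N * C₃), ?_⟩
    · rw [show d - -d = 2 * d by ring]
      gcongr
      linarith [Real.pi_gt_three]
    · refine IsBigO.of_bound (A * (1 + 2 * d) ^ 2) ?_
      filter_upwards [mem_inf_of_right (mem_principal_self _)] with z hz
      have hz' : |z.re| ≤ d := abs_le.2 ⟨(mem_Ioo.1 hz).1.le, (mem_Ioo.1 hz).2.le⟩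
      have h1 := norm_le_add_abs_im hz'
      rw [Real.norm_of_nonneg (Real.exp_pos _).le, norm_mul]
      have hy := abs_nonneg z.im
      have h2 : (1 + ‖z‖) ^ N ≤ (1 + d) ^ N * C₃ * Real.exp (1 / (2 * d) * |z.im|) := by
        calc (1 + ‖z‖) ^ N ≤ ((1 + d) * (1 + |z.im|)) ^ N := by gcongr; nlinarith
          _ = (1 + d) ^ N * (1 + |z.im|) ^ N := mul_pow _ _ _
          _ ≤ (1 + d) ^ N * (C₃ * Real.exp (1 / (2 * d) * |z.im|)) := by gcongr; exact hexp _ hy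
          _ = _ := by ring
      have hz1 : 1 ≤ 1 + ‖z‖ := by linarith [norm_nonneg z]
      have h3 : ‖P z‖ ≤ (1 + 2 * d) ^ 2 * Real.exp (2 * (1 + ‖z‖) ^ N) := by
        calc ‖P z‖ ≤ (‖z‖ + 2 * d) ^ 2 := hPle z
          _ ≤ ((1 + 2 * d) * (1 + ‖z‖)) ^ 2 := by gcongr; nlinarith [norm_nonneg z]
          _ = (1 + 2 * d) ^ 2 * (1 + ‖z‖) ^ 2 := mul_pow _ _ _
          _ ≤ (1 + 2 * d) ^ 2 * (Real.exp ((1 + ‖z‖) ^ N)) ^ 2 := by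
            gcongr
            calc 1 + ‖z‖ = (1 + ‖z‖) ^ 1 := (pow_one _).symm
              _ ≤ (1 + ‖z‖) ^ N := pow_le_pow_right₀ hz1 hN
              _ ≤ _ := by linarith [Real.add_one_le_exp ((1 + ‖z‖) ^ N)]
          _ = _ := by rw [← Real.exp_nat_mul]; push_cast; rfl
      calc ‖Ψ z‖ * ‖P z‖ ≤ (A * Real.exp (B * (1 + ‖z‖) ^ N)) *
            ((1 + 2 * d) ^ 2 * Real.exp (2 * (1 + ‖z‖) ^ N)) := by gcongr; exact hgrowth z
        _ = A * (1 + 2 * d) ^ 2 * Real.exp ((B + 2) * (1 + ‖z‖) ^ N) := by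
          rw [add_mul, Real.exp_add]; ring
        _ ≤ A * (1 + 2 * d) ^ 2 * Real.exp ((B + 2) *
            ((1 + d) ^ N * C₃ * Real.exp (1 / (2 * d) * |z.im|))) := by gcongr
        _ = _ := by rw [mul_assoc (B + 2)]
  refine ⟨(1 + (d ^ 2)⁻¹) * C₁, by positivity, fun z hz => ?_⟩
  have h1 := hPge z hz
  have h2 : 1 + z.im ^ 2 ≤ (1 + (d ^ 2)⁻¹) * ‖P z‖ := by
    have : 1 = (d ^ 2)⁻¹ * d ^ 2 := by field_simp
    have h3 : 0 ≤ (d ^ 2)⁻¹ := by positivity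
    nlinarith [sq_nonneg z.im, mul_nonneg h3 (sq_nonneg z.im), mul_le_mul_of_nonneg_left h1 h3,
      sq_nonneg d]
  have h4 := hstrip z hz
  rw [norm_mul] at h4
  calc (1 + z.im ^ 2) * ‖Ψ z‖ ≤ ((1 + (d ^ 2)⁻¹) * ‖P z‖) * ‖Ψ z‖ := by gcongr
    _ = (1 + (d ^ 2)⁻¹) * (‖Ψ z‖ * ‖P z‖) := by ring
    _ ≤ _ := by gcongr

lemma integrable_vertical_of_decay {F : ℂ → ℂ} (hF : Continuous F) {C σ : ℝ}
    (h : ∀ y : ℝ, (1 + y ^ 2) * ‖F (σ + y * Complex.I)‖ ≤ C) :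
    Integrable fun y : ℝ => F (σ + y * Complex.I) := by
  refine Integrable.mono' (integrable_inv_one_add_sq.const_mul C)
    (Continuous.aestronglyMeasurable (by fun_prop)) (Eventually.of_forall fun y => ?_)
  rw [← div_eq_mul_inv, le_div_iff₀ (by positivity), mul_comm]
  exact h y

/-- Shifting a vertical line of integration across a strip of quadratic decay. -/
lemma integral_vertical_shift {F : ℂ → ℂ} (hF : Differentiable ℂ F) {d C : ℝ} (hd : 0 < d)
    (h : ∀ z : ℂ, |z.re| ≤ d → (1 + z.im ^ 2) * ‖F z‖ ≤ C) :
    ∫ y : ℝ, F (d + y * Complex.I) = ∫ y : ℝ, F (-d + y * Complex.I) := by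
  have hre : ∀ x y : ℝ, ((x : ℂ) + y * Complex.I).re = x := fun x y => by simp
  have him : ∀ x y : ℝ, ((x : ℂ) + y * Complex.I).im = y := fun x y => by simp
  have hb : ∀ x y : ℝ, |x| ≤ d → ‖F (x + y * Complex.I)‖ ≤ C * (1 + y ^ 2)⁻¹ := fun x y hx => by
    have := h (x + y * Complex.I) (by rwa [hre])
    rw [him] at this
    rwa [← div_eq_mul_inv, le_div_iff₀ (by positivity), mul_comm]
  have i₁ : Integrable fun y : ℝ => F (d + y * Complex.I) :=
    integrable_vertical_of_decay hF.continuous fun y => by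
      have := h (d + y * Complex.I) (by rw [hre, abs_of_pos hd])
      rwa [him] at this
  have i₂ : Integrable fun y : ℝ => F (-d + y * Complex.I) := by
    have := integrable_vertical_of_decay (σ := -d) hF.continuous fun y => by
      have := h ((-d : ℝ) + y * Complex.I) (by rw [hre, abs_neg, abs_of_pos hd])
      rwa [him] at this
    simpa using this
  have t₁ := intervalIntegral_tendsto_integral i₁ tendsto_neg_atTop_atBot tendsto_id
  have t₂ := intervalIntegral_tendsto_integral i₂ tendsto_neg_atTop_atBot tendsto_id
  have hrect : ∀ T : ℝ, (∫ y in (-T)..T, F (d + y * Complex.I)) -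
      (∫ y in (-T)..T, F (-d + y * Complex.I)) =
      -Complex.I * ((∫ x in (-d)..d, F (x + T * Complex.I)) -
        ∫ x in (-d)..d, F (x + (-T : ℝ) * Complex.I)) := fun T => by
    have key := Complex.integral_boundary_rect_eq_zero_of_differentiableOn F
      ((-d : ℝ) + (-T : ℝ) * Complex.I) (d + T * Complex.I) hF.differentiableOn
    simp only [hre, him, smul_eq_mul] at key
    rw [Complex.ofReal_neg d] at key
    linear_combination -Complex.I * key + ((∫ y in (-T)..T, F (d + y * Complex.I)) -
      (∫ y in (-T)..T, F (-d + y * Complex.I))) * Complex.I_mul_I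
  have hhor : ∀ T : ℝ, ‖(∫ y in (-T)..T, F (d + y * Complex.I)) -
      (∫ y in (-T)..T, F (-d + y * Complex.I))‖ ≤ 4 * d * C * (1 + T ^ 2)⁻¹ := fun T => by
    rw [hrect, norm_mul, norm_neg, Complex.norm_I, one_mul]
    have hx : ∀ x ∈ uIoc (-d) d, |x| ≤ d := fun x hx => by
      rw [uIoc_of_le (by linarith)] at hx
      exact abs_le.2 ⟨hx.1.le, hx.2⟩
    have e1 := intervalIntegral.norm_integral_le_of_norm_le_const
      (f := fun x : ℝ => F (x + T * Complex.I)) fun x hx' => hb x T (hx x hx')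
    have e2 := intervalIntegral.norm_integral_le_of_norm_le_const
      (f := fun x : ℝ => F (x + (-T : ℝ) * Complex.I)) fun x hx' => hb x (-T) (hx x hx')
    rw [sub_neg_eq_add, abs_of_pos (by linarith)] at e1 e2
    rw [neg_sq] at e2
    refine (norm_sub_le _ _).trans ((add_le_add e1 e2).trans (le_of_eq (by ring)))
  have hlim : Tendsto (fun T : ℝ => 4 * d * C * (1 + T ^ 2)⁻¹) atTop (𝓝 0) := by
    have : Tendsto (fun T : ℝ => (1 + T ^ 2)⁻¹) atTop (𝓝 0) :=
      tendsto_inv_atTop_zero.comp (tendsto_atTop_add_const_left _ _ (tendsto_pow_atTop two_ne_zero))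
    simpa using this.const_mul (4 * d * C)
  have := squeeze_zero_norm hhor hlim
  exact sub_eq_zero.1 (tendsto_nhds_unique (t₁.sub t₂) this)

/-- If the Mellin transform of `h` continues to an entire function with the symmetry
`Ψ(z) = conj (Ψ(-conj z))`, then `h(r) = conj (h(1 / r))`. -/
lemma eq_conj_inv_of_mellin_symm {h : ℝ → ℂ} (hc : ContinuousOn h (Ioi 0)) {Ψ : ℂ → ℂ}
    (hΨ : Differentiable ℂ Ψ) (hsymm : ∀ z, Ψ z = conj (Ψ (-conj z))) {d C : ℝ} (hd : 0 < d)
    (hconv : MellinConvergent h d) (hmel : ∀ z : ℂ, z.re = d → mellin h z = Ψ z)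
    (hdecay : ∀ z : ℂ, |z.re| ≤ d → (1 + z.im ^ 2) * ‖Ψ z‖ ≤ C) {r : ℝ}
    (hr : 0 < r) : h r = conj (h r⁻¹) := by
  have hre : ∀ y : ℝ, ((d : ℂ) + y * Complex.I).re = d := fun y => by simp
  have him : ∀ y : ℝ, ((d : ℂ) + y * Complex.I).im = y := fun y => by simp
  have hinv : ∀ x : ℝ, 0 < x → mellinInv d Ψ x = h x := fun x hx => by
    have hvert : Complex.VerticalIntegrable (mellin h) d := by
      have := integrable_vertical_of_decay (σ := d) hΨ.continuous fun y => by
        have := hdecay (d + y * Complex.I) (by rw [hre, abs_of_pos hd])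
        rwa [him] at this
      refine this.congr (Eventually.of_forall fun y => ?_)
      exact (hmel _ (hre y)).symm
    rw [← mellinInv_mellin_eq d h hx hconv hvert (hc.continuousAt (Ioi_mem_nhds hx))]
    unfold mellinInv
    congr 1
    refine integral_congr_ae (Eventually.of_forall fun y => ?_)
    simp only [hmel _ (hre y)]
  rw [← hinv r hr, ← hinv r⁻¹ (inv_pos.2 hr)]
  have hr0 : (r : ℂ) ≠ 0 := Complex.ofReal_ne_zero.2 hr.ne'
  have hshift := integral_vertical_shift (F := fun z => (r : ℂ) ^ (-z) * Ψ z) (d := d)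
    (C := max (r ^ d) (r ^ (-d)) * C)
    ((Differentiable.const_cpow (by fun_prop) (Or.inl hr0)).mul hΨ) hd fun z hz => by
      rw [norm_mul, Complex.norm_cpow_eq_rpow_re_of_pos hr, Complex.neg_re]
      obtain ⟨h1, h2⟩ := abs_le.1 hz
      have : r ^ (-z.re) ≤ max (r ^ d) (r ^ (-d)) := by
        rcases le_total 1 r with h3 | h3
        · exact (Real.rpow_le_rpow_of_exponent_le h3 (by linarith)).trans (le_max_left _ _)
        · exact (Real.rpow_le_rpow_of_exponent_ge hr h3 (by linarith)).trans (le_max_right _ _)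
      calc (1 + z.im ^ 2) * (r ^ (-z.re) * ‖Ψ z‖) = r ^ (-z.re) * ((1 + z.im ^ 2) * ‖Ψ z‖) := by
            ring
        _ ≤ _ := by gcongr; exact hdecay z hz
  unfold mellinInv
  simp only [smul_eq_mul]
  rw [hshift, Complex.real_smul, Complex.real_smul, map_mul, Complex.conj_ofReal, ← integral_conj]
  congr 1
  refine integral_congr_ae (Eventually.of_forall fun y => ?_)
  simp only [map_mul]
  -- At `z = -d + iy` the point `-conj z` is `d + iy`, and `r^(-z)` is the conjugate of
  -- `(1/r)^(-(d+iy))`. The shifted integrand is thus the conjugate of the original one at `1/r`.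
  rw [hsymm (-d + y * Complex.I)]
  have e1 := Complex.cpow_conj ((r⁻¹ : ℝ) : ℂ) (-(d + y * Complex.I)) (by
      rw [Complex.arg_ofReal_of_nonneg (by positivity)]; exact Real.pi_pos.ne)
  rw [Complex.conj_ofReal] at e1
  rw [← e1, Complex.ofReal_inv, Complex.inv_cpow _ _ (by
      rw [Complex.arg_ofReal_of_nonneg hr.le]; exact Real.pi_pos.ne), ← Complex.cpow_neg]
  congr 2
  · simp; ring
  · congr 1
    simp
    ring

/-! ### From the functional equation to the inversion symmetry -/

lemma ExpDecay.dilationSeries {g : ℝ → ℂ} {K δ : ℝ} {p : ℕ} (hg : ExpDecay g K δ p)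
    (hδ : 0 < δ) {a : ℕ → ℂ} (ha : ∀ s : ℂ, 1 < s.re → LSeriesSummable a s) (hp : 2 ≤ p) {l : ℝ}
    (hl : 0 < l) : ∃ K' : ℝ, ExpDecay (dilationSeries a g l) K' (δ * l / 2) p := by
  obtain ⟨C, hC, hexp⟩ := exists_one_add_pow_le_exp (δ := δ * l / 2) (by positivity) 1
  have hK : 0 ≤ K := by
    have := (norm_nonneg _).trans (hg.bound 1 one_pos)
    simp only [one_pow, inv_one, mul_one] at this
    exact nonneg_of_mul_nonneg_left this (Real.exp_pos _)
  have hS : 0 ≤ ∑' n : ℕ+, ‖a n‖ * (((n : ℕ) : ℝ) ^ p)⁻¹ := tsum_nonneg fun n => by positivity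
  refine ⟨(∑' n : ℕ+, ‖a n‖ * (((n : ℕ) : ℝ) ^ p)⁻¹) * (K * (l ^ p)⁻¹ * C),
    hg.continuousOn_dilationSeries hδ ha hp hl, fun r hr => ?_⟩
  have h1 : r ^ (1 / 2 : ℝ) ≤ C * Real.exp (δ * l / 2 * r) := by
    have h2 := hexp r hr.le
    rw [pow_one] at h2
    refine le_trans ?_ h2
    calc r ^ (1 / 2 : ℝ) ≤ (1 + r) ^ (1 / 2 : ℝ) := by gcongr; linarith
      _ ≤ (1 + r) ^ (1 : ℝ) := Real.rpow_le_rpow_of_exponent_le (by linarith) (by norm_num)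
      _ = _ := Real.rpow_one _
  have h3 : Real.exp (-(δ * l / 2 * r)) =
      Real.exp (δ * l / 2 * r) * Real.exp (-(δ * l * r)) := by
    rw [← Real.exp_add]; ring_nf
  rw [h3]
  refine (hg.norm_dilationSeries_le hδ ha hp hl hr).trans ?_
  calc _ ≤ (∑' n : ℕ+, ‖a n‖ * (((n : ℕ) : ℝ) ^ p)⁻¹) * (K * (l ^ p)⁻¹ *
        (C * Real.exp (δ * l / 2 * r) * (r ^ p)⁻¹ * Real.exp (-(δ * l * r)))) := by gcongr
    _ = _ := by ring

lemma exists_norm_LSeries_le {a : ℕ → ℂ} (ha : ∀ s : ℂ, 1 < s.re → LSeriesSummable a s) {σ : ℝ}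
    (hσ : 1 < σ) : ∃ C : ℝ, 0 ≤ C ∧ ∀ s : ℂ, s.re = σ → ‖LSeries a s‖ ≤ C := by
  refine ⟨∑' n, ‖LSeries.term a σ n‖, tsum_nonneg fun n => norm_nonneg _, fun s hs => ?_⟩
  refine tsum_of_norm_bounded (ha σ (by simpa using hσ)).norm.hasSum fun n => le_of_eq ?_
  rw [LSeries.norm_term_eq, LSeries.norm_term_eq, hs, Complex.ofReal_re]

lemma HasFiniteOrder.exists_growth {Φ : ℂ → ℂ} (hΦ : HasFiniteOrder Φ) : ∃ C : ℝ, 0 ≤ C ∧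
    ∃ N : ℕ, 1 ≤ N ∧ ∀ s, ‖Φ s‖ ≤ C * Real.exp ((1 + ‖s‖) ^ N) := by
  obtain ⟨ρ, C, hρ, h⟩ := hΦ
  have hC : 0 ≤ C := nonneg_of_mul_nonneg_left ((norm_nonneg _).trans (h 0)) (Real.exp_pos _)
  obtain ⟨N, hN⟩ := exists_nat_ge (max ρ 1)
  refine ⟨C, hC, N, by exact_mod_cast (le_max_right _ _).trans hN, fun s => (h s).trans ?_⟩
  have hs := norm_nonneg s
  gcongr
  rw [← Real.rpow_natCast]
  calc ‖s‖ ^ ρ ≤ (1 + ‖s‖) ^ ρ := by gcongr; linarith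
    _ ≤ _ := Real.rpow_le_rpow_of_exponent_le (by linarith) ((le_max_left _ _).trans hN)

/-- Multiplying `Φ` by the factor of the ray continues the Mellin transform of the Bessel series to
an entire function with the symmetry and growth required by `eq_conj_inv_of_mellin_symm` and
`exists_strip_decay`. -/
theorem raySymm_of_continuation {q α : ℝ} (hq : 0 < q) (hα : NotNegInt α) {β : ℂ}
    (hβ : β.im = 0 ∨ β.re = 0) {a : ℕ → ℂ} (ha : ∀ s : ℂ, 1 < s.re → LSeriesSummable a s)
    {Φ : ℂ → ℂ} (hΦ : IsEntireContinuation q α β a Φ) (hfin : HasFiniteOrder Φ)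
    (hsymm : ∀ s : ℂ, Φ s = conj (Φ (conj (1 - s)))) {c b : ℝ} (hc : 0 < c) (hb : 0 < b)
    (hcb : c ^ 2 + b ^ 2 = 1) : RaySymm q α β a c b := by
  obtain ⟨p, hp2, hp, hker⟩ := exists_expDecay_besselKernel hα β
  obtain ⟨C₀, hC₀, hkerC⟩ := hker b hb
  have hg := hkerC c b hc le_rfl hcb
  have hδ : 0 < b / 4 := by positivity
  have hl : 0 < 2 * Real.pi / √q := by positivity
  set l := 2 * Real.pi / √q with hldef
  obtain ⟨K', hD⟩ := hg.dilationSeries hδ ha hp2 hl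
  obtain ⟨σ₀, hσ₀⟩ := exists_mellin_besselKernel_decay hα β hc hb
  set σ := max (p : ℝ) σ₀ + 1 with hσ
  have hσp : (p : ℝ) + 1 ≤ σ := by simp only [hσ]; gcongr; exact le_max_left _ _
  have hp2' : (2 : ℝ) ≤ p := by exact_mod_cast hp2
  have hσσ₀ : σ₀ < σ := lt_of_le_of_lt (le_max_right _ _) (lt_add_one _)
  obtain ⟨C₁, hC₁⟩ := hσ₀ σ hσσ₀
  obtain ⟨C₂, hC₂, hL⟩ := exists_norm_LSeries_le ha (σ := σ) (by linarith)
  obtain ⟨C₃, hC₃, N, hN, hgr⟩ := hfin.exists_growth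
  have hc1 := sq_lt_one_of_add_sq hb hcb
  obtain ⟨C₄, D, hD0, hR⟩ := exists_rayFactor_growth hα β hb hc1
  have hk := rayConst_pos α hc hb
  have hC₄ : 0 ≤ C₄ := nonneg_of_mul_nonneg_left ((norm_nonneg _).trans (hR 0)) (Real.exp_pos _)
  set d := σ - 1 / 2 with hd
  have hd0 : 0 < d := by linarith
  set h : ℝ → ℂ := fun r => besselSeries q α β a (r * c) (r * b) with hh
  have hser : ∀ r ∈ Ioi (0 : ℝ), h r = ((b ^ (1 / 2 : ℝ) : ℝ) : ℂ) •
      dilationSeries a (besselKernel α β c b) l r := fun r hr =>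
    besselSeries_eq_dilationSeries q α β a hb.le (le_of_lt hr)
  have hmh : ∀ z, mellin h z = ((b ^ (1 / 2 : ℝ) : ℝ) : ℂ) *
      mellin (dilationSeries a (besselKernel α β c b) l) z := fun z => by
    rw [← smul_eq_mul, ← mellin_const_smul]
    exact setIntegral_congr_fun measurableSet_Ioi fun r hr => by simp only [hser r hr]
  -- The shift by `1/2` moves the axis of the functional equation to the imaginary axis.
  set Ψ : ℂ → ℂ := fun z => rayConst α c b * rayFactor α β c b (z + 1 / 2) * Φ (z + 1 / 2) with hΨ
  have hΨd : Differentiable ℂ Ψ :=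
    (((differentiable_rayFactor hα β hc1).comp (by fun_prop)).const_mul _).mul
      (hΦ.1.comp (by fun_prop))
  have hΨs : ∀ z, Ψ z = conj (Ψ (-conj z)) := fun z => by
    have e : conj (1 - (z + 1 / 2)) = -conj z + 1 / 2 := by
      rw [show (1 : ℂ) - (z + 1 / 2) = -z + ((1 / 2 : ℝ) : ℂ) by push_cast; ring, map_add,
        Complex.conj_ofReal, map_neg]
      push_cast; rfl
    simp only [hΨ, map_mul, Complex.conj_ofReal]
    rw [← e, conj_rayFactor_one_sub hα hβ hc hb hcb, ← hsymm]
  have hmel : ∀ z : ℂ, z.re = d → mellin h z = Ψ z := fun z hz => by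
    have hs : (z + 1 / 2).re = σ := by simp [hz, hd]
    have hs' : (p : ℝ) < (z + 1 / 2).re := by linarith
    have e := mellin_besselSeries hq hα ha hc hb hcb hg hδ hp2 hp hs'
    obtain ⟨g1, g2⟩ := gamma_arg_re_pos hp hs'
    have hne : ∀ w : ℂ, 0 < w.re → ∀ m : ℕ, w ≠ -(m : ℂ) := fun w hw m hm => by
      rw [hm, Complex.neg_re, Complex.natCast_re] at hw
      linarith [(m.cast_nonneg : (0 : ℝ) ≤ m)]
    rw [add_sub_cancel_right] at e
    rw [hΨ]
    simp only
    rw [hΦ.2 _ (by linarith) (hne _ g1) (hne _ g2)]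
    exact e
  have hline₁ : ∀ z : ℂ, z.re = d →
      (1 + z.im ^ 2) * ‖Ψ z‖ ≤ b ^ (1 / 2 : ℝ) * (l ^ (-σ) * C₂) * C₁ := fun z hz => by
    have hs : (z + 1 / 2).re = σ := by simp [hz, hd]
    have him : (z + 1 / 2).im = z.im := by simp
    have e := hg.mellin_dilationSeries hδ ha hp2 hl (s := z + 1 / 2) (by linarith)
    rw [add_sub_cancel_right] at e
    rw [← hmel z hz, hmh, e, norm_mul, norm_mul, norm_mul, Complex.norm_real,
      Real.norm_of_nonneg (by positivity), Complex.norm_cpow_eq_rpow_re_of_pos hl, Complex.neg_re,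
      hs]
    have h1 := hC₁ _ hs
    have h2 := hL _ hs
    rw [him] at h1
    have h3 : 0 ≤ C₁ := le_trans (by positivity) h1
    calc _ = b ^ (1 / 2 : ℝ) * (l ^ (-σ) * ‖LSeries a (z + 1 / 2)‖) *
          ((1 + z.im ^ 2) * ‖mellin (besselKernel α β c b) (z + 1 / 2)‖) := by ring
      _ ≤ _ := by gcongr
  -- The left edge of the strip inherits the decay of the right edge through the functional
  -- equation.
  have hline : ∀ z : ℂ, |z.re| = d →
      (1 + z.im ^ 2) * ‖Ψ z‖ ≤ b ^ (1 / 2 : ℝ) * (l ^ (-σ) * C₂) * C₁ := fun z hz => by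
    rcases (abs_eq hd0.le).1 hz with hz | hz
    · exact hline₁ z hz
    · have := hline₁ (-conj z) (by simp [hz])
      rw [hΨs z, Complex.norm_conj]
      simpa using this
  have hgrowth : ∀ z, ‖Ψ z‖ ≤ (rayConst α c b * C₄ * C₃) *
      Real.exp ((2 * D + 2 ^ N) * (1 + ‖z‖) ^ N) := fun z => by
    have hz := norm_nonneg z
    have h1 : 1 + ‖z + 1 / 2‖ ≤ 2 * (1 + ‖z‖) := by
      have : ‖z + 1 / 2‖ ≤ ‖z‖ + 1 / 2 := (norm_add_le _ _).trans (by norm_num)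
      linarith
    have h2 : ‖rayFactor α β c b (z + 1 / 2)‖ ≤ C₄ * Real.exp (2 * D * (1 + ‖z‖) ^ N) := by
      refine (hR _).trans ?_
      rw [mul_comm 2 D, mul_assoc]
      gcongr
      have h3 : 1 + ‖z‖ ≤ (1 + ‖z‖) ^ N := le_self_pow₀ (by linarith) (by omega)
      linarith
    have h3 : ‖Φ (z + 1 / 2)‖ ≤ C₃ * Real.exp (2 ^ N * (1 + ‖z‖) ^ N) := by
      refine (hgr _).trans ?_
      rw [← mul_pow]
      gcongr
    rw [hΨ]
    simp only
    rw [norm_mul, norm_mul, Complex.norm_real, Real.norm_of_nonneg hk.le, add_mul, Real.exp_add]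
    calc _ ≤ rayConst α c b * (C₄ * Real.exp (2 * D * (1 + ‖z‖) ^ N)) *
          (C₃ * Real.exp (2 ^ N * (1 + ‖z‖) ^ N)) := by gcongr
      _ = _ := by ring
  obtain ⟨C', -, hC'⟩ := exists_strip_decay hΨd hd0 (by positivity) hN hgrowth hline
  have hcont : ContinuousOn h (Ioi 0) := 
    (hD.continuousOn.const_smul (((b ^ (1 / 2 : ℝ) : ℝ) : ℂ))).congr hser
  have hconv : MellinConvergent h d := by
    have h1 : MellinConvergent (dilationSeries a (besselKernel α β c b) l) d :=
      hD.mellinConvergent (by positivity) (by rw [Complex.ofReal_re]; linarith)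
    exact IntegrableOn.congr_fun (h1.const_smul (((b ^ (1 / 2 : ℝ) : ℝ) : ℂ)))
      (fun r hr => by simp only [hser r hr]) measurableSet_Ioi
  exact fun r hr => eq_conj_inv_of_mellin_symm hcont hΨd hΨs hd0 hconv hmel hC' hr

end SelbergDegreeTwo

end

theorem theorem6p1 (q : ℝ) (hq : 0 < q) (α : ℝ) (hα : ∀ k : ℕ, α ≠ -((k : ℝ) + 1))
    (β : ℂ) (hβ : β.im = 0 ∨ β.re = 0) (a : ℕ → ℂ)
    (ha : ∀ s : ℂ, 1 < s.re → LSeriesSummable a s) :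
    (∃ Φ : ℂ → ℂ, SelbergDegreeTwo.IsEntireContinuation q α β a Φ ∧
        SelbergDegreeTwo.HasFiniteOrder Φ ∧
        ∀ s : ℂ, Φ s = conj (Φ (conj (1 - s)))) ↔
      ∀ r θ : ℝ, 0 < r → 0 < θ → θ < Real.pi / 2 →
        SelbergDegreeTwo.besselSeries q α β a (r * Real.cos θ) (r * Real.sin θ) =
          conj (SelbergDegreeTwo.besselSeries q α β a
            (r⁻¹ * Real.cos θ) (r⁻¹ * Real.sin θ)) := by
  constructor
  · rintro ⟨Φ, hΦ, hfin, hsymm⟩ r θ hr hθ hθ'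
    exact SelbergDegreeTwo.raySymm_of_continuation hq hα hβ ha hΦ hfin hsymm
      (Real.cos_pos_of_mem_Ioo ⟨by linarith, hθ'⟩)
      (Real.sin_pos_of_pos_of_lt_pi hθ (by linarith [Real.pi_pos])) (Real.cos_sq_add_sin_sq θ) r hr
  · intro h
    refine SelbergDegreeTwo.exists_continuation_of_raySymm hq hα hβ ha fun c b hc hb hcb r hr => ?_
    have hc1 : c < 1 := by nlinarith
    have := h r (Real.arccos c) hr (Real.arccos_pos.2 hc1) (Real.arccos_lt_pi_div_two.2 hc)
    rwa [Real.cos_arccos (by linarith) hc1.le, Real.sin_arccos,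
      show 1 - c ^ 2 = b ^ 2 by linarith, Real.sqrt_sq hb.le] at this
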